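/- **Setting.** Let $k$ be a number field and let $G\subseteq S_{2^m}$ be a transitive permutation $2$-group that contains a transposition. A $G$-extension of $k$ is a finite extension $K/k$ inside $\bar k$, together with an isomorphism of permutation groups between $\mathrm{Gal}(\tilde K/k)$, acting on the $k$-embeddings $K\to\tilde K$, and $G$; here $\tilde K$ is the Galois closure of $K/k$. For an extension $L'/L$ of number fields, $\mathrm{Cl}_{L'/L}$ denotes the kernel of the norm $\mathrm{Cl}_{L'}\to \mathrm{Cl}_{L}$, and $h_3(L'/L)=|\mathrm{Cl}_{L'/L}[3]|$. For a $G$-extension $K/k$ and a place $v\mid\infty$ of $k$, let $G_v\le G$ be a decomposition group at $v$. The enriched signature of $K/k$ is the isomorphism class of the $\mathbb{Q}[G]$-module $\bigoplus_{v\mid\infty}\mathrm{Ind}_{G_v}^{G}\mathbb{Q}$. **The heuristics.** Let $f$ be a real-valued function on the isomorphism classes of finite $G$-modules. For the family of $G$-extensions $K/k$ with a given enriched signature and a prime $p\nmid |G|$, the Cohen–Martinet heuristics predict that the average of $f(\mathrm{Cl}_{\tilde K/k}[p^\infty])$ over the $K$ in the family with $|\mathrm{Disc}(K)|\le X$ tends,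 as $X\to\infty$, to $$\lim_{N\to\infty}\frac{\sum_{|M|\le N} f(M)\,w(M)}{\sum_{|M|\le N} w(M)},\qquad w(M)=\frac1{|\mathrm{Aut}_G(M)|\prod_{v\mid\infty}|M^{G_v}|},$$ whenever this limit exists. The sums run over the isomorphism classes of finite $G$-modules $M$ of $p$-power order with $M^G=0$. This limit is called the predicted average of $f$. **Proposition.** Every $G$-extension $K/k$ has exactly one subfield $F\supseteq k$ with $[K:F]=2$. Let $u$ be an integer for which there is a $G$-extension $K/k$ with $\mathrm{rk}\,\mathcal O_K^*-\mathrm{rk}\,\mathcal O_F^*=u$. Let $(b\ b')\in G$ be any transposition and let $S$ be the stabilizer of $\{b,b'\}$ in $G$. Let $U=\mathbb F_3$ with $g\in S$ acting as $1$ if $g$ fixes $b$ and as $-1$ otherwise, and put $f(M)=|\mathrm{Hom}_S(M,U)|$. Then: 1. For every $G$-extension $K/k$ we have $h_3(K/F)=f(\mathrm{Cl}_{\tilde K/k}[3^\infty])$, so $h_3(K/F)$ is a quantity to which the heuristics apply. 2. For every enriched signature of a $G$-extension $K/k$ with $\mathrm{rk}\,\mathcal O_K^*-\mathrm{rk}\,\mathcal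 O_F^*=u$, the predicted average of $f$ at $p=3$ exists and equals $1+3^{-u}$. 3. Consequently, if the heuristics hold for $f$ and $p=3$ on the family of each of these enriched signatures, then the average of $h_3(K/F)$ over all $G$-extensions $K/k$ with $\mathrm{rk}\,\mathcal O_K^*-\mathrm{rk}\,\mathcal O_F^*=u$ and $|\mathrm{Disc}(K)|\le X$ tends to $1+3^{-u}$ as $X\to\infty$. -/

import Mathlib

universe u v

open scoped nonZeroDivisors Pointwise NumberField
open Filter Topology

namespace CohenMartinet

/-! ### Ideal classes: norms and the Galois action -/

section ClassGroups

set_option linter.unusedSectionVars false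

/-- A homomorphism on nonzero ideals that kills principal ideals induces one on the class group. -/
noncomputable def classLift {R H : Type*} [CommRing R] [IsDedekindDomain R] [CommGroup H]
    (f : (Ideal R)⁰ →* H)
    (hf : ∀ I : (Ideal R)⁰, (∃ x : R, (I : Ideal R) = Ideal.span {x}) → f I = 1) :
    ClassGroup R →* H :=
  have key : ∀ I J : (Ideal R)⁰, ClassGroup.mk0 I = ClassGroup.mk0 J → f I = f J := by
    intro I J h
    obtain ⟨x, y, hx, hy, hxy⟩ := ClassGroup.mk0_eq_mk0_iff.1 h
    have nz : ∀ z : R, z ≠ 0 → Ideal.span {z} ∈ (Ideal R)⁰ := fun z hz =>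
      mem_nonZeroDivisors_iff_ne_zero.2 (by simpa [Ideal.zero_eq_bot] using hz)
    have e : (⟨_, nz x hx⟩ : (Ideal R)⁰) * I = ⟨_, nz y hy⟩ * J := Subtype.ext hxy
    have := congrArg f e
    rwa [map_mul, map_mul, hf ⟨_, nz x hx⟩ ⟨x, rfl⟩, hf ⟨_, nz y hy⟩ ⟨y, rfl⟩,
      one_mul, one_mul] at this
  have spec : ∀ c : ClassGroup R,
      ClassGroup.mk0 (Function.surjInv ClassGroup.mk0_surjective c) = c :=
    Function.surjInv_eq ClassGroup.mk0_surjective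
  MonoidHom.mk' (fun c => f (Function.surjInv ClassGroup.mk0_surjective c)) (by
    intro a b
    rw [← map_mul]
    exact key _ _ (by rw [map_mul, spec, spec, spec]))

theorem classLift_mk0 {R H : Type*} [CommRing R] [IsDedekindDomain R] [CommGroup H]
    (f : (Ideal R)⁰ →* H)
    (hf : ∀ I : (Ideal R)⁰, (∃ x : R, (I : Ideal R) = Ideal.span {x}) → f I = 1)
    (I : (Ideal R)⁰) : classLift f hf (ClassGroup.mk0 I) = f I := by
  obtain ⟨x, y, hx, hy, hxy⟩ := ClassGroup.mk0_eq_mk0_iff.1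
    (Function.surjInv_eq ClassGroup.mk0_surjective (ClassGroup.mk0 I))
  have nz : ∀ z : R, z ≠ 0 → Ideal.span {z} ∈ (Ideal R)⁰ := fun z hz =>
    mem_nonZeroDivisors_iff_ne_zero.2 (by simpa [Ideal.zero_eq_bot] using hz)
  have e : (⟨_, nz x hx⟩ : (Ideal R)⁰) *
      Function.surjInv ClassGroup.mk0_surjective (ClassGroup.mk0 I) = ⟨_, nz y hy⟩ * I :=
    Subtype.ext hxy
  have := congrArg f e
  rwa [map_mul, map_mul, hf ⟨_, nz x hx⟩ ⟨x, rfl⟩, hf ⟨_, nz y hy⟩ ⟨y, rfl⟩,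
      one_mul, one_mul] at this

variable (K : Type*) (L : Type*) [Field K] [Field L] [NumberField K] [NumberField L] [Algebra K L]

/-- The relative norm on nonzero ideals of `𝓞 L`. -/
noncomputable def idealNorm : (Ideal (𝓞 L))⁰ →* (Ideal (𝓞 K))⁰ where
  toFun I := ⟨Ideal.relNorm (𝓞 K) (I : Ideal (𝓞 L)), mem_nonZeroDivisors_iff_ne_zero.2 (by
    have := mem_nonZeroDivisors_iff_ne_zero.1 I.2
    rw [Ideal.zero_eq_bot] at this ⊢
    rwa [Ne, Ideal.relNorm_eq_bot_iff])⟩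
  map_one' := Subtype.ext (by simp)
  map_mul' I J := Subtype.ext (by simp)

/-- The norm map `Cl_L → Cl_K`, induced by the norm of ideals. -/
noncomputable def classNorm : ClassGroup (𝓞 L) →* ClassGroup (𝓞 K) :=
  classLift (ClassGroup.mk0.comp (idealNorm K L)) (by
    rintro I ⟨x, hx⟩
    refine (ClassGroup.mk0_eq_one_iff (idealNorm K L I).2).2 ?_
    change (Ideal.relNorm (𝓞 K) (I : Ideal (𝓞 L))).IsPrincipal
    rw [hx, Ideal.relNorm_singleton]
    exact ⟨⟨_, rfl⟩⟩)

theorem classNorm_mk0 (I : (Ideal (𝓞 L))⁰) :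
    classNorm K L (ClassGroup.mk0 I) = ClassGroup.mk0 (idealNorm K L I) :=
  classLift_mk0 _ _ I

/-- The relative class group `Cl_{L/K}`: the kernel of the norm `Cl_L → Cl_K`. -/
noncomputable def relClassGroup : Subgroup (ClassGroup (𝓞 L)) := (classNorm K L).ker

/-- `h_ℓ(L/K)`: the number of elements of `Cl_{L/K}` killed by `ℓ`. -/
noncomputable def relTorsion (ℓ : ℕ) : ℕ :=
  Nat.card {c : ClassGroup (𝓞 L) // c ∈ relClassGroup K L ∧ c ^ ℓ = 1}

instance galSMulComm : SMulCommClass Gal(L/K) (𝓞 K) (𝓞 L) where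
  smul_comm σ a x := by
    have h : ∀ y : 𝓞 L, algebraMap (𝓞 L) L (σ • y) = σ (algebraMap (𝓞 L) L y) := fun y =>
      algebraMap.smul' σ y L
    apply NumberField.RingOfIntegers.ext
    change algebraMap (𝓞 L) L _ = algebraMap (𝓞 L) L _
    rw [h, Algebra.smul_def, Algebra.smul_def, map_mul, map_mul, map_mul, h]
    congr 1
    exact σ.commutes (a : K)

/-- An automorphism `σ` of `L/K` acts on nonzero ideals by `I ↦ σ(I)`. -/
noncomputable def galIdeal (σ : Gal(L/K)) : (Ideal (𝓞 L))⁰ →* (Ideal (𝓞 L))⁰ where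
  toFun I := ⟨σ • (I : Ideal (𝓞 L)), mem_nonZeroDivisors_iff_ne_zero.2 (by
    have := mem_nonZeroDivisors_iff_ne_zero.1 I.2
    intro h
    apply this
    rw [← inv_smul_smul σ (I : Ideal (𝓞 L)), h, smul_zero])⟩
  map_one' := Subtype.ext (by
    change σ • (1 : Ideal (𝓞 L)) = 1
    rw [smul_one])
  map_mul' I J := Subtype.ext (smul_mul' σ (I : Ideal (𝓞 L)) J)

/-- The action of `σ` on the class group. -/
noncomputable def galClass (σ : Gal(L/K)) : ClassGroup (𝓞 L) →* ClassGroup (𝓞 L) :=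
  classLift (ClassGroup.mk0.comp (galIdeal K L σ)) (by
    rintro I ⟨x, hx⟩
    refine (ClassGroup.mk0_eq_one_iff (galIdeal K L σ I).2).2 ?_
    change (σ • (I : Ideal (𝓞 L))).IsPrincipal
    rw [hx, Ideal.pointwise_smul_def, Ideal.map_span, Set.image_singleton]
    exact ⟨⟨_, rfl⟩⟩)

theorem galClass_mk0 (σ : Gal(L/K)) (I : (Ideal (𝓞 L))⁰) :
    galClass K L σ (ClassGroup.mk0 I) = ClassGroup.mk0 (galIdeal K L σ I) :=
  classLift_mk0 _ _ I

theorem galClass_one (c : ClassGroup (𝓞 L)) : galClass K L 1 c = c := by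
  obtain ⟨I, rfl⟩ := ClassGroup.mk0_surjective c
  rw [galClass_mk0]
  exact congrArg _ (Subtype.ext (one_smul _ (I : Ideal (𝓞 L))))

theorem galClass_mul (σ τ : Gal(L/K)) (c : ClassGroup (𝓞 L)) :
    galClass K L (σ * τ) c = galClass K L σ (galClass K L τ c) := by
  obtain ⟨I, rfl⟩ := ClassGroup.mk0_surjective c
  rw [galClass_mk0, galClass_mk0, galClass_mk0]
  exact congrArg _ (Subtype.ext (mul_smul σ τ (I : Ideal (𝓞 L))))

theorem classNorm_galClass (σ : Gal(L/K)) (c : ClassGroup (𝓞 L)) :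
    classNorm K L (galClass K L σ c) = classNorm K L c := by
  obtain ⟨I, rfl⟩ := ClassGroup.mk0_surjective c
  rw [galClass_mk0, classNorm_mk0, classNorm_mk0]
  exact congrArg _ (Subtype.ext (Ideal.relNorm_smul (𝓞 K) σ (I : Ideal (𝓞 L))))

/-- The `p`-primary part of `Cl_{L/K}`, written additively. -/
noncomputable def relClassPart (p : ℕ) : AddSubgroup (Additive (ClassGroup (𝓞 L))) where
  carrier := {c | c.toMul ∈ relClassGroup K L ∧ ∃ n : ℕ, p ^ n • c = 0}
  zero_mem' := ⟨one_mem _, 0, by simp⟩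
  add_mem' := by
    rintro a b ⟨ha, m, hm⟩ ⟨hb, n, hn⟩
    refine ⟨mul_mem ha hb, m + n, ?_⟩
    rw [smul_add, pow_add, mul_smul, mul_smul, hn, smul_zero, add_zero, smul_comm, hm, smul_zero]
  neg_mem' := by
    rintro a ⟨ha, m, hm⟩
    exact ⟨inv_mem ha, m, by rw [smul_neg, hm, neg_zero]⟩

/-- `Gal(L/K)` acts on the `p`-primary part of `Cl_{L/K}`. -/
noncomputable instance relClassPartAction (p : ℕ) :
    DistribMulAction Gal(L/K) (relClassPart K L p) where
  smul σ c := ⟨Additive.ofMul (galClass K L σ c.1.toMul), by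
    obtain ⟨c, hc, n, hn⟩ := c
    refine ⟨?_, n, ?_⟩
    · change classNorm K L (galClass K L σ c.toMul) = 1
      rw [classNorm_galClass]
      exact hc
    · have h1 : c.toMul ^ p ^ n = 1 := hn
      change galClass K L σ c.toMul ^ p ^ n = 1
      rw [← map_pow, h1, map_one]⟩
  one_smul c := Subtype.ext (galClass_one K L c.1.toMul)
  mul_smul σ τ c := Subtype.ext (galClass_mul K L σ τ c.1.toMul)
  smul_zero σ := Subtype.ext (map_one (galClass K L σ))
  smul_add σ c d := Subtype.ext (map_mul (galClass K L σ) c.1.toMul d.1.toMul)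

end ClassGroups

/-! ### Extensions with prescribed permutation Galois group -/

/-- A `G`-extension `K/k` inside a fixed algebraic closure of `k`: a finite extension, together with
an isomorphism of permutation groups from the Galois group of the normal closure, acting on the
`k`-embeddings of `K` into its normal closure, to the permutation group `G`. -/
structure GExt (k : Type u) [Field k] {B : Type} (G : Subgroup (Equiv.Perm B)) where
  /-- the field `K` -/
  K : IntermediateField k (AlgebraicClosure k)
  finite : FiniteDimensional k K
  /-- the bijection between the embeddings of `K` and the points on which `G` acts -/
  emb : B ≃ (K →ₐ[k] IntermediateField.normalClosure k K (AlgebraicClosure k))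
  /-- the induced isomorphism of groups -/
  iso : Gal(IntermediateField.normalClosure k K (AlgebraicClosure k)/k) ≃* G
  compat : ∀ (σ : Gal(IntermediateField.normalClosure k K (AlgebraicClosure k)/k)) (b : B),
    emb ((iso σ : Equiv.Perm B) b) = σ.toAlgHom.comp (emb b)

namespace GExt

variable {k : Type u} [Field k] [NumberField k] {B : Type} {G : Subgroup (Equiv.Perm B)}

/-- The normal closure `K̃` of `K/k`. -/
noncomputable abbrev closure (E : GExt k G) : IntermediateField k (AlgebraicClosure k) :=
  IntermediateField.normalClosure k E.K (AlgebraicClosure k)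

instance (E : GExt k G) : FiniteDimensional k E.K := E.finite

instance (E : GExt k G) : NumberField E.K := NumberField.of_module_finite k E.K

instance (E : GExt k G) : NumberField E.closure := NumberField.of_module_finite k E.closure

end GExt

/-! ### Finite modules over a finite group -/

/-- A finite abelian group with an action of `Γ` by automorphisms. -/
structure FinGMod (Γ : Type v) [Group Γ] where
  carrier : Type u
  [group : AddCommGroup carrier]
  [finite : Finite carrier]
  [action : DistribMulAction Γ carrier]

namespace FinGMod

attribute [instance] FinGMod.group FinGMod.finite FinGMod.action

variable {Γ : Type v} [Group Γ]

/-- The `Γ`-equivariant isomorphisms from `M` to `N`. -/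
abbrev Iso (M N : FinGMod.{u} Γ) : Type u :=
  {e : M.carrier ≃+ N.carrier // ∀ (g : Γ) (x : M.carrier), e (g • x) = g • e x}

/-- The isomorphism relation. -/
def isoSetoid (Γ : Type v) [Group Γ] : Setoid (FinGMod.{u} Γ) where
  r M N := Nonempty (Iso M N)
  iseqv :=
    { refl := fun M => ⟨⟨AddEquiv.refl _, fun _ _ => rfl⟩⟩
      symm := by
        rintro M N ⟨e, he⟩
        exact ⟨⟨e.symm, fun g x => e.injective (by simp [he])⟩⟩
      trans := by
        rintro M N P ⟨e, he⟩ ⟨f, hf⟩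
        exact ⟨⟨e.trans f, fun g x => by simp [he, hf]⟩⟩ }

/-- Isomorphism classes of finite `Γ`-modules. -/
abbrev IsoClass (Γ : Type v) [Group Γ] : Type (max (u + 1) v) :=
  Quotient (isoSetoid.{u} Γ)

/-- The isomorphism classes of finite `Γ`-modules of `p`-power order and of order at most `N`
without nonzero `Γ`-invariants. For `p` prime to the order of `Γ`, having no nonzero invariants
means that the component belonging to the trivial representation is zero. -/
def classesUpTo (Γ : Type v) [Group Γ] (p N : ℕ) : Set (IsoClass.{u} Γ) :=
  {c | (∃ n : ℕ, Nat.card c.out.carrier = p ^ n) ∧ Nat.card c.out.carrier ≤ N ∧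
    ∀ x : c.out.carrier, (∀ g : Γ, g • x = x) → x = 0}

end FinGMod

/-! ### The heuristic prediction -/

namespace GExt

variable {k : Type u} [Field k] [NumberField k] {B : Type} [Finite B] {G : Subgroup (Equiv.Perm B)}

/-- The `p`-primary part of the relative class group `Cl_{K̃/k}`, as a `G`-module. -/
noncomputable def classModule (E : GExt k G) (p : ℕ) : FinGMod.{u} G :=
  letI : DistribMulAction G (relClassPart k E.closure p) :=
    DistribMulAction.compHom _ E.iso.symm.toMonoidHom
  letI : Finite (ClassGroup (𝓞 E.closure)) := Finite.of_fintype _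
  letI : Finite (Additive (ClassGroup (𝓞 E.closure))) := Finite.of_equiv _ Additive.ofMul
  { carrier := relClassPart k E.closure p }

/-- The enriched signature: the permutation representation of `G` on the infinite places of `K̃`
over `ℚ`, that is, the direct sum over the infinite places `v` of `k` of the representations
induced from the trivial representation of the decomposition group of `v`. -/
noncomputable def placesRep (E : GExt k G) :
    Representation ℚ G (MonoidAlgebra ℚ (NumberField.InfinitePlace E.closure)) :=
  (Representation.ofMulAction ℚ Gal(E.closure/k) (NumberField.InfinitePlace E.closure)).comp
    E.iso.symm.toMonoidHom

/-- The family of all `G`-extensions of `k` with the same enriched signature as `E`. -/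
def sameSignature (E : GExt k G) : Set (GExt k G) :=
  {E' | Nonempty (E.placesRep.Equiv E'.placesRep)}

/-- A place of `K̃` above the infinite place `v` of `k`. -/
noncomputable def placeAbove (E : GExt k G) (v : NumberField.InfinitePlace k) :
    NumberField.InfinitePlace E.closure :=
  (NumberField.InfinitePlace.comap_surjective (k := k) (K := E.closure) v).choose

/-- The decomposition group `G_v ≤ G` of an infinite place `v` of `k` (well defined up to
conjugation). -/
noncomputable def decomposition (E : GExt k G) (v : NumberField.InfinitePlace k) : Subgroup G :=
  (MulAction.stabilizer Gal(E.closure/k) (E.placeAbove v)).map E.iso.toMonoidHom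

/-- The weight `1 / (∏_v |M^{G_v}| · |Aut_G M|)` of a finite `G`-module `M`, where `v` runs over the
infinite places of `k`. -/
noncomputable def weight (E : GExt k G) (M : FinGMod.{u} G) : ℝ :=
  1 / ((∏ v : NumberField.InfinitePlace k,
      (Nat.card {x : M.carrier // ∀ g ∈ E.decomposition v, g • x = x} : ℝ)) *
    Nat.card (FinGMod.Iso M M))

/-- `E.HasPrediction p f a`: for the family of `G`-extensions with the enriched signature of `E` and
the prime `p`, not dividing the order of `G`, the heuristics predict `a` as the average of the
isomorphism invariant `f` of the `G`-module `Cl_{K̃/k}[p^∞]`. That is, `a` is the weighted average of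
`f` over the isomorphism classes of finite `G`-modules of `p`-power order with trivial component at
the trivial representation, taken as the limit of the averages over the modules of order at most
`N`. -/
def HasPrediction (E : GExt k G) (p : ℕ) (f : FinGMod.{u} G → ℝ) (a : ℝ) : Prop :=
  Tendsto (fun N : ℕ =>
    (∑ᶠ c ∈ FinGMod.classesUpTo.{u} G p N, f (Quotient.out c) * E.weight (Quotient.out c)) /
      ∑ᶠ c ∈ FinGMod.classesUpTo.{u} G p N, E.weight (Quotient.out c)) atTop (𝓝 a)

/-- The absolute discriminant `Disc(K)`. -/
noncomputable def absDisc (E : GExt k G) : ℕ := (NumberField.discr E.K).natAbs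

/-- The average of `q` over the members `K` of the family `S` with `Disc(K) ≤ X`. -/
noncomputable def average (S : Set (GExt k G)) (q : GExt k G → ℝ) (X : ℝ) : ℝ :=
  (∑ᶠ E ∈ {E : GExt k G | E ∈ S ∧ (E.absDisc : ℝ) ≤ X}, q E) /
    ({E : GExt k G | E ∈ S ∧ (E.absDisc : ℝ) ≤ X}.ncard : ℝ)

/-- The heuristics for the function `f` and the family of `G`-extensions with the enriched signature
of `E`, ordered by `Disc(K)`: the average of `f(Cl_{K̃/k}[p^∞])` over the family is the predicted
one. -/
def HeuristicHolds (E : GExt k G) (p : ℕ) (f : FinGMod.{u} G → ℝ) : Prop :=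
  ∀ a : ℝ, E.HasPrediction p f a →
    Tendsto (average E.sameSignature fun E' => f (E'.classModule p)) atTop (𝓝 a)

/-! ### The quadratic subextension -/

/-- The field `F` with `k ⊆ F ⊆ K` and `[K : F] = 2`, in case there is exactly one. -/
noncomputable def quadSubfield (E : GExt k G) : IntermediateField k E.K :=
  sInf {F : IntermediateField k E.K | Module.finrank F E.K = 2}

/-- The relative unit rank `rk 𝓞_K^* - rk 𝓞_F^*` of `K/F`. -/
noncomputable def relUnitRank (E : GExt k G) : ℤ :=
  (NumberField.Units.rank E.K : ℤ) - NumberField.Units.rank E.quadSubfield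

/-- `h_3(K/F)`, the size of the `3`-torsion of the relative class group of `K/F`. -/
noncomputable def h3 (E : GExt k G) : ℕ := relTorsion E.quadSubfield E.K 3

end GExt

/-- The family of `G`-extensions `K/k` for which `K/F` has relative unit rank `u`. -/
def unitRankFamily (k : Type u) [Field k] [NumberField k] {B : Type} [Finite B]
    (G : Subgroup (Equiv.Perm B)) (u : ℤ) : Set (GExt k G) :=
  {E | E.relUnitRank = u}

open Classical in
/-- The number of homomorphisms of `S`-modules from `M` to `U`, where `S` is the stabilizer in `G` of
the set `{b, b'}` and `U = 𝔽₃`, on which `g ∈ S` acts as `1` if `g` fixes `b` and as `-1` if not. -/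
noncomputable def signHoms {B : Type} (G : Subgroup (Equiv.Perm B)) (b b' : B)
    (M : FinGMod.{u} G) : ℝ :=
  Nat.card {ψ : M.carrier →+ ZMod 3 // ∀ g ∈ MulAction.stabilizer G ({b, b'} : Set B),
    ∀ x : M.carrier, ψ (g • x) = (if g • b = b then 1 else -1) * ψ x}

end CohenMartinet

namespace CohenMartinet

/-! ### Norm and extension of ideal classes -/

section NormAndExtension

set_option linter.unusedSectionVars false

variable (F K L : Type*) [Field F] [Field K] [Field L] [NumberField F] [NumberField K]
  [NumberField L] [Algebra F K] [Algebra K L] [Algebra F L] [IsScalarTower F K L]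

theorem coe_gal_smul (σ : Gal(L/K)) (x : 𝓞 L) : ((σ • x : 𝓞 L) : L) = σ (x : L) :=
  algebraMap.smul' σ x L

theorem algebraMap_intNorm_eq_prod [IsGalois K L] (x : 𝓞 L) :
    algebraMap (𝓞 K) (𝓞 L) (Algebra.intNorm (𝓞 K) (𝓞 L) x) = ∏ σ : Gal(L/K), σ • x := by
  apply NumberField.RingOfIntegers.ext
  have h1 : algebraMap (𝓞 L) L (algebraMap (𝓞 K) (𝓞 L) (Algebra.intNorm (𝓞 K) (𝓞 L) x)) =
      algebraMap K L (algebraMap (𝓞 K) K (Algebra.intNorm (𝓞 K) (𝓞 L) x)) := rfl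
  change algebraMap (𝓞 L) L _ = algebraMap (𝓞 L) L _
  rw [h1, Algebra.algebraMap_intNorm (L := L), Algebra.norm_eq_prod_automorphisms, map_prod]
  exact Finset.prod_congr rfl fun σ _ => (coe_gal_smul K L σ x).symm

theorem map_relNorm_eq_prod [IsGalois K L] (I : Ideal (𝓞 L)) :
    (Ideal.relNorm (𝓞 K) I).map (algebraMap (𝓞 K) (𝓞 L)) = ∏ σ : Gal(L/K), σ • I := by
  by_cases hI : I = ⊥
  · subst hI
    have h : ∀ σ : Gal(L/K), σ • (⊥ : Ideal (𝓞 L)) = ⊥ := fun σ => smul_zero σ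
    rw [Ideal.relNorm_bot, Ideal.map_bot, Finset.prod_congr rfl fun σ _ => h σ, Finset.prod_const,
      ← Ideal.zero_eq_bot, zero_pow]
    simp
  have hle : (Ideal.relNorm (𝓞 K) I).map (algebraMap (𝓞 K) (𝓞 L)) ≤ ∏ σ : Gal(L/K), σ • I := by
    rw [Ideal.map_relNorm, Ideal.span_le]
    rintro _ ⟨x, hx, rfl⟩
    change algebraMap (𝓞 K) (𝓞 L) (Algebra.intNorm (𝓞 K) (𝓞 L) x) ∈ _
    rw [algebraMap_intNorm_eq_prod]
    exact Ideal.prod_mem_prod fun σ _ => Ideal.smul_mem_pointwise_smul σ x I hx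
  obtain ⟨C, hC⟩ := Ideal.dvd_iff_le.2 hle
  have hn : Ideal.relNorm (𝓞 K) (∏ σ : Gal(L/K), σ • I) =
      Ideal.relNorm (𝓞 K) I ^ Module.finrank (𝓞 K) (𝓞 L) := by
    rw [map_prod, Finset.prod_congr rfl fun σ _ => Ideal.relNorm_smul (𝓞 K) σ I, Finset.prod_const,
      Finset.card_univ, ← Nat.card_eq_fintype_card, IsGalois.card_aut_eq_finrank,
      IsFractionRing.finrank_eq (𝓞 K) K (𝓞 L) L]
  have hne : Ideal.relNorm (𝓞 K) I ≠ ⊥ := by rwa [Ne, Ideal.relNorm_eq_bot_iff]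
  have hCn : Ideal.relNorm (𝓞 K) C = 1 := by
    have := congrArg (Ideal.relNorm (𝓞 K)) hC
    rw [map_mul, hn, Ideal.relNorm_algebraMap] at this
    exact (mul_eq_left₀ (pow_ne_zero _ hne)).1 this.symm
  have hC1 : C = 1 := by
    have h := Ideal.relNorm_le_comap (𝓞 K) C
    rw [hCn, Ideal.one_eq_top, top_le_iff, Ideal.comap_eq_top_iff] at h
    rw [h, Ideal.one_eq_top]
  rw [hC, hC1, mul_one]

theorem classNorm_extendedHom (c : ClassGroup (𝓞 K)) :
    classNorm K L (ClassGroup.extendedHom (𝓞 K) (𝓞 L) c) = c ^ Module.finrank K L := by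
  obtain ⟨I, rfl⟩ := ClassGroup.mk0_surjective c
  rw [ClassGroup.extendedHom_mk0, classNorm_mk0, ← map_pow]
  refine congrArg _ (Subtype.ext ?_)
  change Ideal.relNorm (𝓞 K) ((I : Ideal (𝓞 K)).map (algebraMap (𝓞 K) (𝓞 L))) = _
  rw [Ideal.relNorm_algebraMap, SubmonoidClass.coe_pow, IsFractionRing.finrank_eq (𝓞 K) K (𝓞 L) L]

theorem extendedHom_classNorm [IsGalois K L] (c : ClassGroup (𝓞 L)) :
    ClassGroup.extendedHom (𝓞 K) (𝓞 L) (classNorm K L c) = ∏ σ : Gal(L/K), galClass K L σ c := by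
  obtain ⟨I, rfl⟩ := ClassGroup.mk0_surjective c
  rw [classNorm_mk0, ClassGroup.extendedHom_mk0,
    Finset.prod_congr rfl fun σ _ => galClass_mk0 K L σ I, ← map_prod]
  refine congrArg _ (Subtype.ext ?_)
  rw [SubmonoidClass.coe_finsetProd]
  exact map_relNorm_eq_prod K L I

theorem classNorm_classNorm (c : ClassGroup (𝓞 L)) :
    classNorm F K (classNorm K L c) = classNorm F L c := by
  obtain ⟨I, rfl⟩ := ClassGroup.mk0_surjective c
  rw [classNorm_mk0, classNorm_mk0, classNorm_mk0]
  exact congrArg _ (Subtype.ext (Ideal.relNorm_relNorm (𝓞 F) (𝓞 K) (I : Ideal (𝓞 L))))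

theorem galClass_extendedHom (σ : Gal(L/F)) (ρ : Gal(K/F))
    (h : ∀ x : K, σ (algebraMap K L x) = algebraMap K L (ρ x)) (c : ClassGroup (𝓞 K)) :
    galClass F L σ (ClassGroup.extendedHom (𝓞 K) (𝓞 L) c) =
      ClassGroup.extendedHom (𝓞 K) (𝓞 L) (galClass F K ρ c) := by
  obtain ⟨I, rfl⟩ := ClassGroup.mk0_surjective c
  rw [galClass_mk0, ClassGroup.extendedHom_mk0, ClassGroup.extendedHom_mk0, galClass_mk0]
  refine congrArg _ (Subtype.ext ?_)
  change σ • (I : Ideal (𝓞 K)).map (algebraMap (𝓞 K) (𝓞 L)) =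
    (ρ • (I : Ideal (𝓞 K))).map (algebraMap (𝓞 K) (𝓞 L))
  rw [Ideal.pointwise_smul_def, Ideal.pointwise_smul_def, Ideal.map_map, Ideal.map_map]
  congr 1
  ext x
  change ((σ • algebraMap (𝓞 K) (𝓞 L) x : 𝓞 L) : L) = algebraMap K L ((ρ • x : 𝓞 K) : K)
  rw [coe_gal_smul, coe_gal_smul, ← h]
  rfl

theorem galClass_eq_of_coe_eq (σ : Gal(L/F)) (τ : Gal(L/K)) (h : ∀ x : L, σ x = τ x)
    (c : ClassGroup (𝓞 L)) : galClass F L σ c = galClass K L τ c := by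
  obtain ⟨I, rfl⟩ := ClassGroup.mk0_surjective c
  rw [galClass_mk0, galClass_mk0]
  refine congrArg _ (Subtype.ext ?_)
  change σ • (I : Ideal (𝓞 L)) = τ • (I : Ideal (𝓞 L))
  rw [Ideal.pointwise_smul_def, Ideal.pointwise_smul_def]
  congr 1
  ext x
  change ((σ • x : 𝓞 L) : L) = ((τ • x : 𝓞 L) : L)
  rw [coe_gal_smul, coe_gal_smul, h]

theorem eq_one_of_pow_eq_one_of_coprime {A : Type*} [Group A] {x : A} {m n : ℕ}
    (hmn : m.Coprime n) (hm : x ^ m = 1) (hn : x ^ n = 1) : x = 1 := by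
  have := Nat.dvd_gcd (orderOf_dvd_of_pow_eq_one hm) (orderOf_dvd_of_pow_eq_one hn)
  rw [hmn] at this
  exact orderOf_eq_one_iff.1 (Nat.dvd_one.1 this)

/-- The norm to a quadratic subfield: the `ℓ`-torsion of `Cl_{K/F}` is the part of the `ℓ`-torsion of
`Cl_L` on which `Gal(L/F)` acts through the character of order two that cuts out `K`. -/
theorem relTorsion_eq_card [IsGalois F L] (hKF : Module.finrank F K = 2) {ℓ : ℕ}
    (hℓ : ℓ.Coprime (Module.finrank F L)) :
    relTorsion F K ℓ = Nat.card {c : ClassGroup (𝓞 L) // c ^ ℓ = 1 ∧ ∀ σ : Gal(L/F),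
      ((∀ x : K, σ (algebraMap K L x) = algebraMap K L x) → galClass F L σ c = c) ∧
      ((¬ ∀ x : K, σ (algebraMap K L x) = algebraMap K L x) → galClass F L σ c = c⁻¹)} := by
  have : Algebra.IsQuadraticExtension F K := ⟨hKF⟩
  have : FiniteDimensional F K := inferInstance
  have : FiniteDimensional K L := inferInstance
  have : IsGalois K L := IsGalois.tower_top_of_isGalois F K L
  have hmul := Module.finrank_mul_finrank F K L
  have hn : ℓ.Coprime (Module.finrank K L) := hℓ.coprime_dvd_right ⟨_, by rw [← hmul, mul_comm]⟩
  have h2 : ℓ.Coprime 2 := hℓ.coprime_dvd_right ⟨Module.finrank K L, by rw [← hmul, hKF]⟩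
  have hcard : Nat.card Gal(K/F) = 2 := by rw [IsGalois.card_aut_eq_finrank, hKF]
  obtain ⟨ρ, hρ1, hρ⟩ : ∃ ρ : Gal(K/F), ρ ≠ 1 ∧ ∀ τ : Gal(K/F), τ ≠ 1 → τ = ρ := by
    obtain ⟨x, y, hxy, hu⟩ := Nat.card_eq_two_iff.1 hcard
    have hmem : ∀ z : Gal(K/F), z = x ∨ z = y := fun z => by
      have : z ∈ ({x, y} : Set Gal(K/F)) := hu ▸ Set.mem_univ z
      simpa using this
    rcases hmem 1 with h | h
    · exact ⟨y, fun h' => hxy (h.symm.trans h'.symm),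
        fun τ hτ => (hmem τ).resolve_left fun h' => hτ (h'.trans h.symm)⟩
    · exact ⟨x, fun h' => hxy (h'.trans h),
        fun τ hτ => (hmem τ).resolve_right fun h' => hτ (h'.trans h.symm)⟩
  have hres : ∀ (σ : Gal(L/F)) (x : K), σ (algebraMap K L x) =
      algebraMap K L (σ.restrictNormal K x) :=
    fun σ x => (AlgEquiv.restrictNormal_commutes σ K x).symm
  have hfix : ∀ σ : Gal(L/F), (∀ x : K, σ (algebraMap K L x) = algebraMap K L x) ↔
      σ.restrictNormal K = 1 := fun σ => by
    refine ⟨fun h => AlgEquiv.ext fun x => (algebraMap K L).injective ?_, fun h x => ?_⟩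
    · rw [← hres, h]; rfl
    · rw [hres, h]; rfl
  obtain ⟨τ, hτ⟩ := AlgEquiv.restrictNormalHom_surjective (F := F) (K₁ := K) L ρ
  have hτ' : τ.restrictNormal K = ρ := hτ
  set j := ClassGroup.extendedHom (𝓞 K) (𝓞 L) with hj
  have hprodKF : ∀ c : ClassGroup (𝓞 K), ∏ σ : Gal(K/F), galClass F K σ c =
      c * galClass F K ρ c := fun c => by
    classical
    have : (Finset.univ : Finset Gal(K/F)) = {1, ρ} := by
      ext z
      simp only [Finset.mem_univ, Finset.mem_insert, Finset.mem_singleton, true_iff]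
      exact or_iff_not_imp_left.2 (hρ z)
    rw [this, Finset.prod_pair hρ1.symm, galClass_one]
  refine Nat.card_eq_of_bijective (fun c => ⟨j c.1, ?_, fun σ => ⟨fun h => ?_, fun h => ?_⟩⟩) ⟨?_, ?_⟩
  · rw [← map_pow, c.2.2, map_one]
  · rw [hj, galClass_extendedHom F K L σ 1 h, galClass_one]
  · have hσ : σ.restrictNormal K = ρ := hρ _ fun h' => h ((hfix σ).2 h')
    have hc : classNorm F K c.1 = 1 := c.2.1
    have h1 := extendedHom_classNorm F K c.1
    rw [hc, map_one, hprodKF] at h1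
    rw [hj, galClass_extendedHom F K L σ ρ (fun x => by rw [hres, hσ]), ← map_inv,
      eq_inv_of_mul_eq_one_right h1.symm]
  · rintro ⟨c, hc, hc3⟩ ⟨d, hd, hd3⟩ h
    have h : j c = j d := congrArg Subtype.val h
    refine Subtype.ext (div_eq_one.1 (eq_one_of_pow_eq_one_of_coprime hn ?_ ?_))
    · rw [div_pow, hc3, hd3, div_one]
    · rw [← classNorm_extendedHom K L, map_div, ← hj, h, div_self', map_one]
  · rintro ⟨c, hc, hσ⟩
    obtain ⟨a, ha⟩ : ∃ a : ℕ, (c ^ Module.finrank K L) ^ a = c := by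
      have : (orderOf c).Coprime (Module.finrank K L) :=
        hn.coprime_dvd_left (orderOf_dvd_of_pow_eq_one hc)
      exact exists_pow_eq_self_of_coprime this.symm
    have hprod : j (classNorm K L c) = c ^ Module.finrank K L := by
      rw [hj, extendedHom_classNorm]
      have : ∀ σ : Gal(L/K), galClass K L σ c = c := fun σ => by
        rw [← galClass_eq_of_coe_eq F K L (σ.restrictScalars F) σ (fun _ => rfl)]
        exact (hσ _).1 fun x => σ.commutes x
      rw [Finset.prod_congr rfl fun σ _ => this σ, Finset.prod_const, Finset.card_univ,
        ← Nat.card_eq_fintype_card, IsGalois.card_aut_eq_finrank]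
    have hN : classNorm F L c = 1 := by
      refine eq_one_of_pow_eq_one_of_coprime h2 (by rw [← map_pow, hc, map_one]) ?_
      have h1 := classNorm_galClass F L τ c
      rw [(hσ τ).2 (fun h => hρ1 (hτ'.symm.trans ((hfix τ).1 h))), map_inv] at h1
      rw [sq]
      nth_rewrite 1 [← h1]
      exact inv_mul_cancel _
    refine ⟨⟨classNorm K L c ^ a, ?_, ?_⟩, Subtype.ext ?_⟩
    · change classNorm F K (classNorm K L c ^ a) = 1
      rw [map_pow, classNorm_classNorm, hN, one_pow]
    · rw [pow_right_comm, ← map_pow, hc, map_one, one_pow]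
    · change j (classNorm K L c ^ a) = c
      rw [map_pow, hprod, ha]

end NormAndExtension

end CohenMartinet

namespace CohenMartinet

/-! ### Isotypic parts for quadratic characters and their duals -/

theorem exists_nat_mul_smul_eq {M : Type*} [AddCommGroup M] [Finite M] {n : ℕ}
    (h : n.Coprime (Nat.card M)) : ∃ m : ℕ, ∀ x : M, m • n • x = x := by
  rcases Nat.exists_mul_mod_eq_one_of_coprime (k := Nat.card M) (n := n) h with hm
  by_cases h1 : 1 < Nat.card M
  · obtain ⟨m, -, hm⟩ := hm h1
    refine ⟨m, fun x => ?_⟩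
    have hx : Nat.card M • x = 0 := card_nsmul_eq_zero'
    rw [smul_smul, mul_comm, ← Nat.mod_add_div (n * m) (Nat.card M), hm, add_smul, one_smul,
      mul_comm, mul_smul, hx, smul_zero, add_zero]
  · have : Subsingleton M := Finite.card_le_one_iff_subsingleton.1 (not_lt.1 h1)
    exact ⟨0, fun x => Subsingleton.elim _ _⟩

theorem card_addMonoidHom_zmod_of_module (V : Type*) [AddCommGroup V] [Finite V] (p : ℕ)
    [Fact p.Prime] [Module (ZMod p) V] : Nat.card (V →+ ZMod p) = Nat.card V := by
  have : Module.Finite (ZMod p) V := Module.Finite.of_finite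
  have hd : Module.Finite (ZMod p) (Module.Dual (ZMod p) V) :=
    Subspace.instModuleDualFiniteDimensional
  rw [Nat.card_congr (AddMonoidHom.toZModLinearMapEquiv p).toEquiv]
  change Nat.card (Module.Dual (ZMod p) V) = _
  rw [Module.natCard_eq_pow_finrank (K := ZMod p) (V := V), ← Subspace.dual_finrank_eq]
  exact Module.natCard_eq_pow_finrank

theorem card_addMonoidHom_zmod (A : Type*) [AddCommGroup A] [Finite A] (p : ℕ) [Fact p.Prime] :
    Nat.card (A →+ ZMod p) = Nat.card {x : A // p • x = 0} := by
  set f : A →+ A := nsmulAddMonoidHom p with hf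
  let Q := A ⧸ f.range
  have hQ : ∀ x : Q, p • x = 0 := by
    intro x
    obtain ⟨a, rfl⟩ := QuotientAddGroup.mk_surjective x
    rw [← QuotientAddGroup.mk_nsmul]
    exact (QuotientAddGroup.eq_zero_iff _).2 ⟨a, rfl⟩
  let _ : Module (ZMod p) Q := AddCommGroup.zmodModule hQ
  have h1 : Nat.card (A →+ ZMod p) = Nat.card (Q →+ ZMod p) := by
    refine Nat.card_congr
      { toFun := fun g => QuotientAddGroup.lift f.range g ?_
        invFun := fun h => h.comp (QuotientAddGroup.mk' f.range)
        left_inv := fun g => AddMonoidHom.ext fun x => rfl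
        right_inv := fun h => AddMonoidHom.ext fun x => by
          obtain ⟨a, rfl⟩ := QuotientAddGroup.mk_surjective x
          rfl }
    rintro _ ⟨a, rfl⟩
    change g (p • a) = 0
    rw [map_nsmul, nsmul_eq_mul, ZMod.natCast_self, zero_mul]
  have h2 := card_addMonoidHom_zmod_of_module Q p
  have h4 : Nat.card f.ker = Nat.card {x : A // p • x = 0} := Nat.card_congr (Equiv.refl _)
  have h5 := AddSubgroup.card_eq_card_quotient_mul_card_addSubgroup f.range
  have h6 := AddSubgroup.card_eq_card_quotient_mul_card_addSubgroup f.ker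
  rw [Nat.card_congr (QuotientAddGroup.quotientKerEquivRange f).toEquiv, h5, mul_comm] at h6
  rw [h1, h2, ← h4]
  exact Nat.eq_of_mul_eq_mul_left Nat.card_pos h6

section Isotypic

variable {S : Type*} [Group S] {M : Type*} [AddCommGroup M] [DistribMulAction S M]

/-- The part of `M` on which `S` acts through the quadratic character `χ`. -/
def isotypic (M : Type*) [AddCommGroup M] [DistribMulAction S M] (χ : S →* ℤˣ) : AddSubgroup M where
  carrier := {x | ∀ s : S, s • x = (χ s : ℤ) • x}
  zero_mem' s := by simp
  add_mem' {x y} hx hy s := by rw [smul_add, hx s, hy s, smul_add]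
  neg_mem' {x} hx s := by rw [smul_neg, hx s, smul_neg]

theorem units_int_smul_smul (u : ℤˣ) (x : M) : (u : ℤ) • (u : ℤ) • x = x := by
  rw [smul_smul, ← Units.val_mul, Int.units_mul_self, Units.val_one, one_smul]

/-- For `p` prime to the order of `S`, the `χ`-part of the `p`-torsion of `M` is as large as its
`𝔽_p`-dual. -/
theorem card_isotypic_torsion [Finite S] [Finite M] (χ : S →* ℤˣ) {p : ℕ} [Fact p.Prime]
    (hS : (Nat.card S).Coprime (Nat.card M)) :
    Nat.card {x : M // p • x = 0 ∧ ∀ s : S, s • x = (χ s : ℤ) • x} =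
      Nat.card {ψ : M →+ ZMod p // ∀ (s : S) (x : M), ψ (s • x) = (χ s : ℤ) • ψ x} := by
  have := Fintype.ofFinite S
  obtain ⟨m, hm⟩ := exists_nat_mul_smul_eq hS
  let B := isotypic M χ
  let f : M → M := fun x => ∑ s : S, (χ s : ℤ) • s • x
  have hleft : ∀ (t : S) (x : M), t • f x = (χ t : ℤ) • f x := fun t x => by
    change t • ∑ s : S, (χ s : ℤ) • s • x = (χ t : ℤ) • ∑ s : S, (χ s : ℤ) • s • x
    rw [Finset.smul_sum, Finset.smul_sum]
    refine Fintype.sum_equiv (Equiv.mulLeft t) _ _ fun s => ?_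
    rw [Equiv.coe_mulLeft, map_mul, Units.val_mul, mul_smul, units_int_smul_smul, mul_smul,
      smul_comm]
  have hright : ∀ (t : S) (x : M), f (t • x) = (χ t : ℤ) • f x := fun t x => by
    change ∑ s : S, (χ s : ℤ) • s • t • x = (χ t : ℤ) • ∑ s : S, (χ s : ℤ) • s • x
    rw [Finset.smul_sum]
    refine Fintype.sum_equiv (Equiv.mulRight t) _ _ fun s => ?_
    rw [Equiv.coe_mulRight, map_mul, mul_comm, Units.val_mul, mul_smul, units_int_smul_smul,
      mul_smul]
  let e : M →+ B :=
    { toFun := fun x => ⟨m • f x, fun t => by rw [smul_comm, hleft, smul_comm]⟩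
      map_zero' := Subtype.ext (by simp [f])
      map_add' := fun x y => Subtype.ext (by simp [f, Finset.sum_add_distrib]) }
  have he : ∀ x : B, e x = x := fun x => Subtype.ext (by
    change m • ∑ s : S, (χ s : ℤ) • s • (x : M) = x
    rw [Finset.sum_congr rfl fun s _ => by rw [x.2 s, units_int_smul_smul], Finset.sum_const,
      Finset.card_univ, ← Nat.card_eq_fintype_card, hm])
  have h1 : Nat.card {x : M // p • x = 0 ∧ ∀ s : S, s • x = (χ s : ℤ) • x} =
      Nat.card {x : B // p • x = 0} :=
    Nat.card_congr
      { toFun := fun x => ⟨⟨x.1, x.2.2⟩, Subtype.ext x.2.1⟩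
        invFun := fun x => ⟨x.1.1, congrArg Subtype.val x.2, x.1.2⟩
        left_inv := fun _ => rfl
        right_inv := fun _ => rfl }
  rw [h1, ← card_addMonoidHom_zmod]
  have hequiv : ∀ (θ : B →+ ZMod p) (t : S) (x : M), θ (e (t • x)) = (χ t : ℤ) • θ (e x) :=
    fun θ t x => by
      rw [← map_zsmul]
      congr 1
      refine Subtype.ext ?_
      change m • f (t • x) = (χ t : ℤ) • m • f x
      rw [hright, smul_comm]
  have hback : ∀ (ψ : M →+ ZMod p), (∀ (s : S) (x : M), ψ (s • x) = (χ s : ℤ) • ψ x) → ∀ x,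
      ψ (e x : M) = ψ x := fun ψ hψ x => by
    change ψ (m • ∑ s : S, (χ s : ℤ) • s • x) = ψ x
    rw [map_nsmul, map_sum, Finset.sum_congr rfl fun s _ => by
      rw [map_zsmul, hψ, units_int_smul_smul], Finset.sum_const, Finset.card_univ,
      ← Nat.card_eq_fintype_card, ← map_nsmul, ← map_nsmul, hm]
  exact (Nat.card_congr
    { toFun := fun ψ => ψ.1.comp B.subtype
      invFun := fun θ => ⟨θ.comp e, hequiv θ⟩
      left_inv := fun ψ => Subtype.ext (AddMonoidHom.ext fun x => hback ψ.1 ψ.2 x)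
      right_inv := fun θ => AddMonoidHom.ext fun x => congrArg θ (he x) }).symm

end Isotypic

end CohenMartinet

namespace CohenMartinet

/-! ### Modules over an integral group ring, at a prime not dividing the order of the group -/

section GroupRing

open scoped MonoidAlgebra

set_option linter.unusedSectionVars false

variable {Γ : Type*} [Group Γ] [Finite Γ]

theorem exists_average {B N : Type*} [AddCommGroup B] [Module ℤ[Γ] B] [AddCommGroup N]
    [Module ℤ[Γ] N] [Finite N] (h : (Nat.card Γ).Coprime (Nat.card N)) (π : B →+ N) :
    ∃ π' : B →ₗ[ℤ[Γ]] N, ∀ N' : Submodule ℤ[Γ] N, ∀ b : B,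
      (∀ g : Γ, π (MonoidAlgebra.single g (1 : ℤ) • b) - MonoidAlgebra.single g (1 : ℤ) • π b ∈ N') →
        π' b - π b ∈ N' := by
  have := Fintype.ofFinite Γ
  obtain ⟨m, hm⟩ := exists_nat_mul_smul_eq h
  refine ⟨m • π.toIntLinearMap.sumOfConjugatesEquivariant Γ, fun N' b hb => ?_⟩
  have h1 : π b = m • ∑ g : Γ, MonoidAlgebra.single g⁻¹ (1 : ℤ) •
      MonoidAlgebra.single g (1 : ℤ) • π b := by
    rw [Finset.sum_congr rfl fun g _ => by
      rw [smul_smul, MonoidAlgebra.single_mul_single, mul_one, inv_mul_cancel,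
        ← MonoidAlgebra.one_def, one_smul], Finset.sum_const, Finset.card_univ,
      ← Nat.card_eq_fintype_card, hm]
  rw [h1, LinearMap.smul_apply, LinearMap.sumOfConjugatesEquivariant_apply, ← smul_sub,
    ← Finset.sum_sub_distrib]
  refine N'.nsmul_mem (N'.sum_mem fun g _ => ?_) m
  rw [LinearMap.conjugate_apply, ← smul_sub]
  exact N'.smul_mem _ (hb g)

theorem natCard_hom_self (N : Type*) [AddCommGroup N] [Module ℤ[Γ] N] :
    Nat.card (ℤ[Γ] →ₗ[ℤ[Γ]] N) = Nat.card N :=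
  Nat.card_congr (LinearMap.ringLmapEquivSelf ℤ[Γ] ℕ N).toEquiv

theorem exists_addMonoidHom_factor {A Q N : Type*} [AddCommGroup A] [AddCommGroup Q]
    [AddCommGroup N] {p : ℕ} [Fact p.Prime] [Module (ZMod p) Q] [Module (ZMod p) N] (q : A →+ Q)
    (ψ : A →+ N) (h : ∀ a, q a = 0 → ψ a = 0) : ∃ g : Q →+ N, ∀ a, g (q a) = ψ a := by
  let W : Submodule (ZMod p) Q := AddSubgroup.toZModSubmodule p q.range
  have hW : ∀ x : W, ∃ a, q a = x := fun x => x.2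
  let θ : W →+ N :=
    AddMonoidHom.mk' (fun x => ψ (hW x).choose) (fun x y => by
      rw [← map_add, ← sub_eq_zero, ← map_sub]
      apply h
      rw [map_sub, map_add, (hW _).choose_spec, (hW _).choose_spec, (hW _).choose_spec]
      simp)
  obtain ⟨g, hg⟩ := LinearMap.exists_extend (AddMonoidHom.toZModLinearMap p θ)
  refine ⟨g.toAddMonoidHom, fun a => ?_⟩
  have h1 := LinearMap.congr_fun hg (⟨q a, a, rfl⟩ : W)
  change g (q a) = ψ (hW ⟨q a, a, rfl⟩).choose at h1
  change g (q a) = ψ a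
  rw [h1, ← sub_eq_zero, ← map_sub]
  apply h
  rw [map_sub, (hW _).choose_spec, sub_self]

/-- Over `𝔽_p`, an additive map from a subgroup extends as soon as it is trivial on multiples
of `p`. -/
theorem exists_addMonoidHom_extension {A B N : Type*} [AddCommGroup A] [AddCommGroup B]
    [AddCommGroup N] {p : ℕ} [Fact p.Prime] (hN : ∀ x : N, p • x = 0) (i : A →+ B) (ψ : A →+ N)
    (h : ∀ a, (∃ b, i a = p • b) → ψ a = 0) : ∃ ψ' : B →+ N, ∀ a, ψ' (i a) = ψ a := by
  let f : B →+ B := nsmulAddMonoidHom p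
  let Q := B ⧸ f.range
  have hQ : ∀ x : Q, p • x = 0 := by
    intro x
    obtain ⟨a, rfl⟩ := QuotientAddGroup.mk_surjective x
    rw [← QuotientAddGroup.mk_nsmul]
    exact (QuotientAddGroup.eq_zero_iff _).2 ⟨a, rfl⟩
  let _ : Module (ZMod p) Q := AddCommGroup.zmodModule hQ
  let _ : Module (ZMod p) N := AddCommGroup.zmodModule hN
  let q : A →+ Q := (QuotientAddGroup.mk' f.range).comp i
  have hker : ∀ a, q a = 0 → ψ a = 0 := fun a ha => by
    obtain ⟨b, hb⟩ := (QuotientAddGroup.eq_zero_iff _).1 ha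
    exact h a ⟨b, hb.symm⟩
  obtain ⟨g, hg⟩ := exists_addMonoidHom_factor (p := p) q ψ hker
  exact ⟨g.comp (QuotientAddGroup.mk' f.range), hg⟩

theorem exists_linearMap_extension {A B N : Type*} [AddCommGroup A] [Module ℤ[Γ] A]
    [AddCommGroup B] [Module ℤ[Γ] B] [AddCommGroup N] [Module ℤ[Γ] N] [Finite N] {p : ℕ}
    [Fact p.Prime] (hΓ : (Nat.card Γ).Coprime (Nat.card N)) (hN : ∀ x : N, p • x = 0)
    (i : A →ₗ[ℤ[Γ]] B) (ψ : A →ₗ[ℤ[Γ]] N) (h : ∀ a, (∃ b, i a = p • b) → ψ a = 0) :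
    ∃ ψ' : B →ₗ[ℤ[Γ]] N, ∀ a, ψ' (i a) = ψ a := by
  obtain ⟨π, hπ⟩ := exists_addMonoidHom_extension hN i.toAddMonoidHom ψ.toAddMonoidHom h
  have hπ : ∀ a, π (i a) = ψ a := hπ
  obtain ⟨π', hπ'⟩ := exists_average hΓ π
  refine ⟨π', fun a => ?_⟩
  have := hπ' ⊥ (i a) fun g => by
    rw [← map_smul, hπ, hπ, map_smul, sub_self]
    exact Submodule.zero_mem _
  rw [Submodule.mem_bot, sub_eq_zero] at this
  rw [this, hπ]

/-- Maps from a submodule of the group ring lift along surjections of finite modules. -/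
theorem exists_linearMap_lift (K : Submodule ℤ[Γ] ℤ[Γ]) {N : Type*} [AddCommGroup N]
    [Module ℤ[Γ] N] [Finite N] (hΓ : (Nat.card Γ).Coprime (Nat.card N)) (N' : Submodule ℤ[Γ] N)
    (φ : K →ₗ[ℤ[Γ]] N ⧸ N') : ∃ φ' : K →ₗ[ℤ[Γ]] N, N'.mkQ.comp φ' = φ := by
  have hfree : Module.Free ℤ K := by
    have : Module.Free ℤ (K.restrictScalars ℤ) := inferInstance
    exact this
  obtain ⟨π, hπ⟩ := Module.projective_lifting_property (N'.mkQ.restrictScalars ℤ)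
    (φ.restrictScalars ℤ) N'.mkQ_surjective
  have hπ : ∀ a, N'.mkQ (π a) = φ a := fun a => LinearMap.congr_fun hπ a
  obtain ⟨π', hπ'⟩ := exists_average hΓ π.toAddMonoidHom
  refine ⟨π', LinearMap.ext fun a => ?_⟩
  have := hπ' N' a fun g => by
    rw [← Submodule.ker_mkQ N', LinearMap.mem_ker, map_sub, sub_eq_zero, LinearMap.map_smul]
    change N'.mkQ (π _) = _ • N'.mkQ (π _)
    rw [hπ, hπ, LinearMap.map_smul]
  rw [← Submodule.ker_mkQ N', LinearMap.mem_ker, map_sub, sub_eq_zero] at this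
  exact this.trans (hπ a)

theorem natCard_eq_ker_mul_range {A B : Type*} [AddCommGroup A] [AddCommGroup B] (f : A →+ B) :
    Nat.card A = Nat.card f.ker * Nat.card f.range := by
  rw [AddSubgroup.card_eq_card_quotient_mul_card_addSubgroup f.ker, mul_comm,
    Nat.card_congr (QuotientAddGroup.quotientKerEquivRange f).toEquiv]

theorem natCard_hom_of_smul_eq_zero (K : Submodule ℤ[Γ] ℤ[Γ]) {p : ℕ} [Fact p.Prime]
    (hK : ∀ r : ℤ[Γ], p • r ∈ K) {N : Type*} [AddCommGroup N] [Module ℤ[Γ] N] [Finite N]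
    (hΓ : (Nat.card Γ).Coprime (Nat.card N)) (hN : ∀ x : N, p • x = 0) :
    Nat.card (K →ₗ[ℤ[Γ]] N) = Nat.card N := by
  let res : (ℤ[Γ] →ₗ[ℤ[Γ]] N) →+ (K →ₗ[ℤ[Γ]] N) :=
    AddMonoidHom.mk' (fun f => f.comp K.subtype) fun _ _ => rfl
  let μ : ℤ[Γ] →ₗ[ℤ[Γ]] K := (p • LinearMap.id).codRestrict K hK
  let mul : (K →ₗ[ℤ[Γ]] N) →+ (ℤ[Γ] →ₗ[ℤ[Γ]] N) :=
    AddMonoidHom.mk' (fun f => f.comp μ) fun _ _ => rfl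
  have hp : p ≠ 0 := (Fact.out : p.Prime).ne_zero
  have hinj : ∀ a b : ℤ[Γ], p • a = p • b → a = b := fun a b hab => by
    ext g
    have : p • a.coeff g = p • b.coeff g := by
      simpa only [MonoidAlgebra.coeff_smul_apply] using congrArg (fun r : ℤ[Γ] => r.coeff g) hab
    simpa [hp] using this
  have h1 : res.range = mul.ker := by
    ext φ
    constructor
    · rintro ⟨f, rfl⟩
      refine LinearMap.ext fun r => ?_
      change f (p • r) = 0
      rw [map_nsmul, hN]
    · intro hφ
      obtain ⟨f, hf⟩ := exists_linearMap_extension hΓ hN K.subtype φ fun a ⟨b, hb⟩ => by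
        have : a = μ b := Subtype.ext hb
        rw [this]
        exact LinearMap.congr_fun hφ b
      exact ⟨f, LinearMap.ext hf⟩
  have h2 : mul.range = res.ker := by
    ext ψ
    constructor
    · rintro ⟨f, rfl⟩
      refine LinearMap.ext fun r => ?_
      change f (μ (r : ℤ[Γ])) = 0
      have : μ (r : ℤ[Γ]) = p • r := Subtype.ext rfl
      rw [this, map_nsmul, hN]
    · intro hψ
      obtain ⟨f, hf⟩ := exists_linearMap_extension hΓ hN μ ψ fun a ⟨b, hb⟩ => by
        have : a = (b : ℤ[Γ]) := hinj _ _ (congrArg Subtype.val hb)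
        rw [this]
        exact LinearMap.congr_fun hψ b
      exact ⟨f, LinearMap.ext hf⟩
  rw [← natCard_hom_self (Γ := Γ) N, natCard_eq_ker_mul_range mul, natCard_eq_ker_mul_range res, h1, h2,
    mul_comm]

/-- A left ideal of `p`-power index of the group ring has as many maps to a finite `p`-primary module
as the group ring itself. -/
theorem natCard_hom_leftIdeal (K : Submodule ℤ[Γ] ℤ[Γ]) {p : ℕ} [Fact p.Prime]
    (hK : ∀ r : ℤ[Γ], p • r ∈ K) (hp : p.Coprime (Nat.card Γ)) (n : ℕ) :
    ∀ (N : Type*) [AddCommGroup N] [Module ℤ[Γ] N] [Finite N], (∃ k : ℕ, Nat.card N = p ^ k) →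
      Nat.card N ≤ n → Nat.card (K →ₗ[ℤ[Γ]] N) = Nat.card N := by
  induction n with
  | zero => exact fun N _ _ _ _ h => absurd (Nat.card_pos (α := N)) (by omega)
  | succ n ih =>
    intro N _ _ _ hk hn
    have hcop : ∀ (N : Type _) [AddCommGroup N] [Module ℤ[Γ] N] [Finite N],
        (∃ k : ℕ, Nat.card N = p ^ k) → (Nat.card Γ).Coprime (Nat.card N) := by
      rintro N _ _ _ ⟨k, hk⟩
      rw [hk]
      exact (hp.pow_left k).symm
    by_cases hN : ∀ x : N, p • x = 0
    · exact natCard_hom_of_smul_eq_zero K hK (hcop N hk) hN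
    obtain ⟨k, hk⟩ := hk
    let N' : Submodule ℤ[Γ] N := LinearMap.range (p • LinearMap.id)
    have hN' : Nat.card N = Nat.card (N ⧸ N') * Nat.card N' :=
      AddSubgroup.card_eq_card_quotient_mul_card_addSubgroup N'.toAddSubgroup
    have hd1 : Nat.card N' ∣ p ^ k := ⟨_, by rw [← hk, hN', mul_comm]⟩
    have hd2 : Nat.card (N ⧸ N') ∣ p ^ k := ⟨_, by rw [← hk, hN']⟩
    obtain ⟨k1, -, hk1⟩ := (Nat.dvd_prime_pow Fact.out).1 hd1
    obtain ⟨k2, -, hk2⟩ := (Nat.dvd_prime_pow Fact.out).1 hd2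
    have hlt : Nat.card N' < Nat.card N := by
      refine lt_of_le_of_ne (Nat.card_le_card_of_injective _ N'.injective_subtype) fun h => ?_
      have : ∀ x : N, p ^ (k + 1) • x = 0 → x = 0 := by
        intro x hx
        have hsurj : Function.Surjective (fun x : N => p • x) := by
          intro y
          have hs : Function.Surjective N'.subtype :=
            ((Nat.bijective_iff_injective_and_card _).2 ⟨N'.injective_subtype, h⟩).2
          obtain ⟨⟨_, x, rfl⟩, rfl⟩ := hs y
          exact ⟨x, rfl⟩
        have hinj : Function.Injective (fun x : N => p • x) := Finite.injective_iff_surjective.2 hsurj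
        have : ∀ j : ℕ, p ^ j • x = 0 → x = 0 := fun j => by
          induction j with
          | zero => simp
          | succ j ih =>
            intro hx
            rw [pow_succ', mul_smul] at hx
            exact ih (hinj (by simpa using hx))
        exact this _ hx
      apply hN
      intro x
      have hx : x = 0 := this x (by
        rw [pow_succ', mul_smul, ← hk, card_nsmul_eq_zero', smul_zero])
      rw [hx, smul_zero]
    have hfin : Finite (N ⧸ N') := Finite.of_surjective _ N'.mkQ_surjective
    have ih1 := ih N' ⟨k1, hk1⟩ (by omega)
    have ih2 := natCard_hom_of_smul_eq_zero K hK (hcop (N ⧸ N') ⟨k2, hk2⟩) (fun x => by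
      obtain ⟨y, rfl⟩ := N'.mkQ_surjective x
      rw [← map_nsmul]
      exact (Submodule.Quotient.mk_eq_zero _).2 ⟨y, rfl⟩)
    let push : (K →ₗ[ℤ[Γ]] N) →+ (K →ₗ[ℤ[Γ]] N ⧸ N') :=
      AddMonoidHom.mk' (fun f => N'.mkQ.comp f) fun f g => LinearMap.comp_add _ _ _
    have hr : push.range = ⊤ := by
      refine AddMonoidHom.range_eq_top.2 fun φ => ?_
      exact exists_linearMap_lift K (hcop N ⟨k, hk⟩) N' φ
    have hker : Nat.card push.ker = Nat.card (K →ₗ[ℤ[Γ]] N') := by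
      refine Nat.card_congr
        { toFun := fun f => f.1.codRestrict N' fun x =>
            (Submodule.Quotient.mk_eq_zero _).1 (LinearMap.congr_fun f.2 x)
          invFun := fun f => ⟨N'.subtype.comp f, LinearMap.ext fun x =>
            (Submodule.Quotient.mk_eq_zero _).2 (f x).2⟩
          left_inv := fun _ => rfl
          right_inv := fun _ => rfl }
    rw [natCard_eq_ker_mul_range push, hr, hker, ih1, AddSubgroup.card_top, ih2, hN', mul_comm]

end GroupRing

end CohenMartinet

namespace CohenMartinet

/-! ### Finite modules as modules over the group ring -/

namespace FinGMod

open scoped MonoidAlgebra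

section Module

universe w

variable {Γ : Type w} [Group Γ]

/-- A module over the group is a module over the group ring. -/
noncomputable instance groupRingModule (M : FinGMod.{u} Γ) : Module ℤ[Γ] M.carrier :=
  Module.compHom M.carrier (MonoidAlgebra.lift ℤ (AddMonoid.End M.carrier) Γ
    (DistribMulAction.toAddMonoidEnd Γ M.carrier)).toRingHom

theorem single_smul (M : FinGMod.{u} Γ) (g : Γ) (x : M.carrier) :
    (MonoidAlgebra.single g (1 : ℤ) : ℤ[Γ]) • x = g • x := by
  change (MonoidAlgebra.lift ℤ (AddMonoid.End M.carrier) Γ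
    (DistribMulAction.toAddMonoidEnd Γ M.carrier)) (MonoidAlgebra.single g 1) x = g • x
  rw [MonoidAlgebra.lift_single, one_smul]
  rfl

/-- A finite module over the group ring as a module over the group. -/
noncomputable def ofModule (Γ : Type w) [Group Γ] (X : Type u) [AddCommGroup X] [Module ℤ[Γ] X] [Finite X] :
    FinGMod.{u} Γ :=
  letI : DistribMulAction Γ X := DistribMulAction.compHom X (MonoidAlgebra.of ℤ Γ)
  { carrier := X }

/-- An equivariant additive map is linear over the group ring. -/
noncomputable def linearMapOfEquivariant {X Y : Type*} [AddCommGroup X] [Module ℤ[Γ] X]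
    [AddCommGroup Y] [Module ℤ[Γ] Y] (f : X →+ Y) (h : ∀ (g : Γ) (x : X),
      f ((MonoidAlgebra.single g (1 : ℤ) : ℤ[Γ]) • x) = (MonoidAlgebra.single g (1 : ℤ) : ℤ[Γ]) • f x) :
    X →ₗ[ℤ[Γ]] Y :=
  MonoidAlgebra.equivariantOfLinearOfComm f.toIntLinearMap h

/-- Isomorphisms of modules over the group are linear equivalences over the group ring. -/
noncomputable def isoEquiv (M N : FinGMod.{u} Γ) :
    Iso M N ≃ (M.carrier ≃ₗ[ℤ[Γ]] N.carrier) where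
  toFun e :=
    { linearMapOfEquivariant (Γ := Γ) e.1.toAddMonoidHom (fun g x => by
        rw [single_smul, single_smul]; exact e.2 g x) with
      invFun := e.1.symm
      left_inv := e.1.left_inv
      right_inv := e.1.right_inv }
  invFun e := ⟨e.toAddEquiv, fun g x => by
    rw [← single_smul, ← single_smul]
    exact e.map_smul _ x⟩
  left_inv e := rfl
  right_inv e := rfl

/-- Passing to the group and back does not change the module. -/
noncomputable def ofModuleEquiv (X : Type u) [AddCommGroup X] [Module ℤ[Γ] X] [Finite X] :
    (ofModule Γ X).carrier ≃ₗ[ℤ[Γ]] X :=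
  { linearMapOfEquivariant (Γ := Γ) (X := (ofModule Γ X).carrier) (Y := X) (AddMonoidHom.id X)
      (fun g x => single_smul (ofModule Γ X) g x) with
    invFun := fun x => x
    left_inv := fun _ => rfl
    right_inv := fun _ => rfl }

/-- The isomorphism class of a finite module over the group ring. -/
noncomputable def cls (Γ : Type w) [Group Γ] (X : Type u) [AddCommGroup X] [Module ℤ[Γ] X] [Finite X] :
    IsoClass.{u} Γ := Quotient.mk _ (ofModule Γ X)

theorem cls_eq_iff {X Y : Type u} [AddCommGroup X] [Module ℤ[Γ] X] [Finite X]
    [AddCommGroup Y] [Module ℤ[Γ] Y] [Finite Y] :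
    cls Γ X = cls Γ Y ↔ Nonempty (X ≃ₗ[ℤ[Γ]] Y) := by
  rw [cls, cls, Quotient.eq]
  change Nonempty (Iso _ _) ↔ _
  constructor
  · rintro ⟨e⟩
    exact ⟨(ofModuleEquiv X).symm.trans ((isoEquiv _ _ e).trans (ofModuleEquiv Y))⟩
  · rintro ⟨e⟩
    exact ⟨(isoEquiv _ _).symm ((ofModuleEquiv X).trans (e.trans (ofModuleEquiv Y).symm))⟩

/-- The underlying group of the chosen representative of an isomorphism class. -/
noncomputable abbrev rep (c : IsoClass.{u} Γ) : Type u := (Quotient.out c).carrier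

theorem cls_carrier (M : FinGMod.{u} Γ) : cls Γ M.carrier = Quotient.mk _ M :=
  Quotient.sound ⟨(isoEquiv _ _).symm (ofModuleEquiv M.carrier)⟩

theorem cls_rep (c : IsoClass.{u} Γ) : cls Γ (rep c) = c := by
  rw [cls_carrier]
  exact Quotient.out_eq c

theorem nonempty_equiv_rep (X : Type u) [AddCommGroup X] [Module ℤ[Γ] X] [Finite X] :
    Nonempty (X ≃ₗ[ℤ[Γ]] rep (cls Γ X)) := cls_eq_iff.1 (cls_rep _).symm

theorem natCard_equiv_of_equiv {X Y : Type*} [AddCommGroup X] [Module ℤ[Γ] X]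
    [AddCommGroup Y] [Module ℤ[Γ] Y] (e : X ≃ₗ[ℤ[Γ]] Y) :
    Nat.card (X ≃ₗ[ℤ[Γ]] Y) = Nat.card (Y ≃ₗ[ℤ[Γ]] Y) :=
  Nat.card_congr
    { toFun := fun f => e.symm.trans f
      invFun := fun f => e.trans f
      left_inv := fun f => by ext; simp
      right_inv := fun f => by ext; simp }

open Classical in
theorem natCard_equiv_rep (X : Type u) [AddCommGroup X] [Module ℤ[Γ] X] [Finite X]
    (c : IsoClass.{u} Γ) : Nat.card (X ≃ₗ[ℤ[Γ]] rep c) =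
      if cls Γ X = c then Nat.card (rep c ≃ₗ[ℤ[Γ]] rep c) else 0 := by
  split_ifs with h
  · obtain ⟨e⟩ := cls_eq_iff.1 (h.trans (cls_rep c).symm)
    exact natCard_equiv_of_equiv e
  · have : IsEmpty (X ≃ₗ[ℤ[Γ]] rep c) := ⟨fun e => h ((cls_eq_iff.2 ⟨e⟩).trans (cls_rep c))⟩
    exact Nat.card_of_isEmpty

open Classical in
theorem natCard_rep_equiv (X : Type u) [AddCommGroup X] [Module ℤ[Γ] X] [Finite X]
    (c : IsoClass.{u} Γ) : Nat.card (rep c ≃ₗ[ℤ[Γ]] X) =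
      if cls Γ X = c then Nat.card (rep c ≃ₗ[ℤ[Γ]] rep c) else 0 := by
  rw [← natCard_equiv_rep]
  exact Nat.card_congr
    { toFun := LinearEquiv.symm, invFun := LinearEquiv.symm,
      left_inv := fun _ => rfl, right_inv := fun _ => rfl }

theorem natCard_aut_pos (c : IsoClass.{u} Γ) : 0 < Nat.card (rep c ≃ₗ[ℤ[Γ]] rep c) := by
  have : Finite (rep c ≃ₗ[ℤ[Γ]] rep c) := Finite.of_injective _ (DFunLike.coe_injective)
  have : Nonempty (rep c ≃ₗ[ℤ[Γ]] rep c) := ⟨LinearEquiv.refl _ _⟩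
  exact Nat.card_pos

end Module

/-! ### Counting extensions by a cyclic module -/

section Extensions

variable {Γ : Type} [Group Γ] {K : Submodule ℤ[Γ] ℤ[Γ]}
variable {N M : Type u} [AddCommGroup N] [Module ℤ[Γ] N] [AddCommGroup M] [Module ℤ[Γ] M]

/-- Extensions of `ℤ[Γ] ⧸ K` by `N` with middle term `M` and a chosen lift of the generator. -/
def RigidExt (K : Submodule ℤ[Γ] ℤ[Γ]) (N M : Type u) [AddCommGroup N] [Module ℤ[Γ] N]
    [AddCommGroup M] [Module ℤ[Γ] M] : Type u :=
  {t : (M →ₗ[ℤ[Γ]] ℤ[Γ] ⧸ K) × (N →ₗ[ℤ[Γ]] M) × M // Function.Injective t.2.1 ∧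
    LinearMap.range t.2.1 = LinearMap.ker t.1 ∧ t.1 t.2.2 = K.mkQ 1}

theorem mkQ_eq_smul (r : ℤ[Γ]) : K.mkQ r = r • K.mkQ 1 := by
  rw [← LinearMap.map_smul, smul_eq_mul, mul_one]

/-- The relations that hold for the lift of the generator. -/
noncomputable def RigidExt.relations (t : RigidExt K N M) : K →ₗ[ℤ[Γ]] N :=
  (LinearEquiv.ofInjective t.1.2.1 t.2.1).symm.toLinearMap.comp
    (((LinearMap.toSpanSingleton ℤ[Γ] M t.1.2.2).comp K.subtype).codRestrict _ fun k => by
      rw [t.2.2.1, LinearMap.mem_ker]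
      change t.1.1 ((k : ℤ[Γ]) • t.1.2.2) = 0
      rw [LinearMap.map_smul, t.2.2.2, ← mkQ_eq_smul]
      exact (Submodule.Quotient.mk_eq_zero _).2 k.2)

theorem RigidExt.map_relations (t : RigidExt K N M) (k : K) :
    t.1.2.1 (t.relations k) = (k : ℤ[Γ]) • t.1.2.2 :=
  congrArg Subtype.val ((LinearEquiv.ofInjective t.1.2.1 t.2.1).apply_symm_apply _)

theorem RigidExt.relations_eq_iff (t : RigidExt K N M) (κ : K →ₗ[ℤ[Γ]] N) :
    t.relations = κ ↔ ∀ k : K, t.1.2.1 (κ k) = (k : ℤ[Γ]) • t.1.2.2 := by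
  constructor
  · rintro rfl k
    exact t.map_relations k
  · intro h
    exact LinearMap.ext fun k => t.2.1 ((t.map_relations k).trans (h k).symm)

/-- The extension of `ℤ[Γ] ⧸ K` by `N` with prescribed relations for the lift of the generator. -/
abbrev Pushout (κ : K →ₗ[ℤ[Γ]] N) : Type u :=
  (N × ℤ[Γ]) ⧸ LinearMap.range (κ.prod (-K.subtype))

namespace Pushout

variable (κ : K →ₗ[ℤ[Γ]] N)

/-- The inclusion of `N`. -/
noncomputable def inc : N →ₗ[ℤ[Γ]] Pushout κ := (Submodule.mkQ _).comp (LinearMap.inl ℤ[Γ] N ℤ[Γ])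

/-- The lift of the generator. -/
noncomputable def gen : Pushout κ := Submodule.mkQ _ (0, 1)

/-- The projection to the quotient. -/
noncomputable def proj : Pushout κ →ₗ[ℤ[Γ]] ℤ[Γ] ⧸ K :=
  Submodule.liftQ _ (K.mkQ.comp (LinearMap.snd ℤ[Γ] N ℤ[Γ])) (by
    rintro _ ⟨k, rfl⟩
    rw [LinearMap.mem_ker]
    change K.mkQ (-(k : ℤ[Γ])) = 0
    rw [map_neg, neg_eq_zero]
    exact (Submodule.Quotient.mk_eq_zero _).2 k.2)

theorem mk_eq (x : N × ℤ[Γ]) : (Submodule.mkQ _ x : Pushout κ) = inc κ x.1 + x.2 • gen κ := by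
  rw [inc, gen, LinearMap.comp_apply, ← LinearMap.map_smul, ← map_add]
  congr 1
  ext <;> simp

theorem inc_relation (k : K) : inc κ (κ k) = (k : ℤ[Γ]) • gen κ := by
  rw [← sub_eq_zero, sub_eq_add_neg, ← neg_smul]
  rw [← mk_eq κ (κ k, -(k : ℤ[Γ]))]
  exact (Submodule.Quotient.mk_eq_zero _).2 ⟨k, rfl⟩

theorem inc_injective : Function.Injective (inc κ) := by
  rw [← LinearMap.ker_eq_bot, LinearMap.ker_eq_bot']
  intro n hn
  obtain ⟨k, hk⟩ := (Submodule.Quotient.mk_eq_zero _).1 hn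
  have h1 : κ k = n := congrArg Prod.fst hk
  have h2 : -(k : ℤ[Γ]) = 0 := congrArg Prod.snd hk
  have h3 : k = 0 := Subtype.ext (neg_eq_zero.1 h2)
  rw [← h1, h3, map_zero]

theorem proj_inc (n : N) : proj κ (inc κ n) = 0 := map_zero K.mkQ

theorem proj_gen : proj κ (gen κ) = K.mkQ 1 := rfl

theorem range_inc : LinearMap.range (inc κ) = LinearMap.ker (proj κ) := by
  ext x
  constructor
  · rintro ⟨n, rfl⟩
    exact proj_inc κ n
  · obtain ⟨⟨n, r⟩, rfl⟩ := Submodule.mkQ_surjective _ x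
    intro h
    rw [LinearMap.mem_ker, mk_eq, map_add, proj_inc, zero_add, LinearMap.map_smul, proj_gen,
      ← mkQ_eq_smul] at h
    have hr : r ∈ K := (Submodule.Quotient.mk_eq_zero _).1 h
    exact ⟨n + κ ⟨r, hr⟩, by rw [mk_eq, map_add, inc_relation]⟩

/-- The map from the pushout determined by its values. -/
noncomputable def desc (i : N →ₗ[ℤ[Γ]] M) (y : M) (h : ∀ k : K, i (κ k) = (k : ℤ[Γ]) • y) :
    Pushout κ →ₗ[ℤ[Γ]] M :=
  Submodule.liftQ _ (i.coprod (LinearMap.toSpanSingleton ℤ[Γ] M y)) (by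
    rintro _ ⟨k, rfl⟩
    rw [LinearMap.mem_ker]
    change i (κ k) + (-(k : ℤ[Γ])) • y = 0
    rw [h, neg_smul, add_neg_cancel])

theorem desc_inc (i : N →ₗ[ℤ[Γ]] M) (y : M) (h) (n : N) : desc κ i y h (inc κ n) = i n := by
  change i n + (0 : ℤ[Γ]) • y = i n
  rw [zero_smul, add_zero]

theorem desc_gen (i : N →ₗ[ℤ[Γ]] M) (y : M) (h) : desc κ i y h (gen κ) = y := by
  change i 0 + (1 : ℤ[Γ]) • y = y
  rw [one_smul, map_zero, zero_add]

theorem finite [Finite N] [Finite (ℤ[Γ] ⧸ K)] : Finite (Pushout κ) := by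
  have h1 : Finite (proj κ).toAddMonoidHom.ker := by
    refine Finite.of_surjective (fun n : N => (⟨inc κ n, proj_inc κ n⟩ :
      (proj κ).toAddMonoidHom.ker)) ?_
    rintro ⟨x, hx⟩
    have hx' : x ∈ LinearMap.range (inc κ) := by rw [range_inc]; exact hx
    obtain ⟨n, hn⟩ := hx'
    exact ⟨n, Subtype.ext hn⟩
  have h2 : Finite (Pushout κ ⧸ (proj κ).toAddMonoidHom.ker) :=
    Finite.of_injective _ (QuotientAddGroup.kerLift_injective (proj κ).toAddMonoidHom)
  exact Finite.of_equiv _ (AddSubgroup.addGroupEquivQuotientProdAddSubgroup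
    (s := (proj κ).toAddMonoidHom.ker)).symm

end Pushout

theorem natCard_fiber_relations (κ : K →ₗ[ℤ[Γ]] N) :
    Nat.card {t : RigidExt K N M // t.relations = κ} = Nat.card (Pushout κ ≃ₗ[ℤ[Γ]] M) := by
  symm
  refine Nat.card_eq_of_bijective (fun e => ⟨⟨((Pushout.proj κ).comp e.symm.toLinearMap,
    e.toLinearMap.comp (Pushout.inc κ), e (Pushout.gen κ)), ?_, ?_, ?_⟩, ?_⟩) ⟨?_, ?_⟩
  · exact e.injective.comp (Pushout.inc_injective κ)
  · ext x
    rw [LinearMap.mem_ker]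
    change _ ↔ e.symm x ∈ LinearMap.ker (Pushout.proj κ)
    rw [← Pushout.range_inc]
    constructor
    · rintro ⟨n, rfl⟩
      exact ⟨n, (e.symm_apply_apply _).symm⟩
    · rintro ⟨n, hn⟩
      exact ⟨n, by
        change e (Pushout.inc κ n) = x
        rw [hn, e.apply_symm_apply]⟩
  · change Pushout.proj κ (e.symm (e (Pushout.gen κ))) = _
    rw [e.symm_apply_apply, Pushout.proj_gen]
  · refine (RigidExt.relations_eq_iff _ _).2 fun k => ?_
    change e (Pushout.inc κ (κ k)) = (k : ℤ[Γ]) • e (Pushout.gen κ)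
    rw [Pushout.inc_relation, e.map_smul]
  · intro e e' h
    have h1 := congrArg (fun t => t.1.1.2.1) h
    have h2 : e (Pushout.gen κ) = e' (Pushout.gen κ) := congrArg (fun t => t.1.1.2.2) h
    refine LinearEquiv.ext fun x => ?_
    obtain ⟨⟨n, r⟩, rfl⟩ := Submodule.mkQ_surjective _ x
    have h3 : e (Pushout.inc κ n) = e' (Pushout.inc κ n) := LinearMap.congr_fun h1 n
    rw [Pushout.mk_eq, map_add, map_add, e.map_smul, e'.map_smul, h2, h3]
  · rintro ⟨⟨⟨π, i, y⟩, hi, hr, hy⟩, ht⟩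
    have ht : ∀ k : K, i (κ k) = (k : ℤ[Γ]) • y := (RigidExt.relations_eq_iff _ _).1 ht
    have hr : LinearMap.range i = LinearMap.ker π := hr
    have hy : π y = K.mkQ 1 := hy
    have hi : Function.Injective i := hi
    have hπ : ∀ x, π (Pushout.desc κ i y ht x) = Pushout.proj κ x := fun x => by
      obtain ⟨⟨n, r⟩, rfl⟩ := Submodule.mkQ_surjective _ x
      have : π (i n) = 0 := by rw [← LinearMap.mem_ker, ← hr]; exact ⟨n, rfl⟩
      rw [Pushout.mk_eq, map_add, map_add, map_add, LinearMap.map_smul, LinearMap.map_smul,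
        LinearMap.map_smul, Pushout.desc_gen, Pushout.desc_inc, hy, this, Pushout.proj_inc,
        Pushout.proj_gen]
    have hbij : Function.Bijective (Pushout.desc κ i y ht) := by
      constructor
      · rw [← LinearMap.ker_eq_bot, LinearMap.ker_eq_bot']
        intro x hx
        have h1 : x ∈ LinearMap.ker (Pushout.proj κ) := by
          rw [LinearMap.mem_ker, ← hπ, hx, map_zero]
        rw [← Pushout.range_inc] at h1
        obtain ⟨n, rfl⟩ := h1
        rw [Pushout.desc_inc] at hx
        rw [hi (hx.trans (map_zero i).symm), map_zero]
      · intro m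
        obtain ⟨r, hr'⟩ := K.mkQ_surjective (π m)
        have h1 : m - r • y ∈ LinearMap.range i := by
          rw [hr, LinearMap.mem_ker, map_sub, LinearMap.map_smul, hy, ← mkQ_eq_smul, hr', sub_self]
        obtain ⟨n, hn⟩ := h1
        refine ⟨Pushout.inc κ n + r • Pushout.gen κ, ?_⟩
        rw [map_add, LinearMap.map_smul, Pushout.desc_gen, Pushout.desc_inc, hn, sub_add_cancel]
    refine ⟨LinearEquiv.ofBijective _ hbij, Subtype.ext (Subtype.ext ?_)⟩
    refine Prod.ext ?_ (Prod.ext ?_ ?_)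
    · refine LinearMap.ext fun x => ?_
      obtain ⟨z, rfl⟩ := (LinearEquiv.ofBijective _ hbij).surjective x
      change Pushout.proj κ ((LinearEquiv.ofBijective _ hbij).symm _) = π _
      rw [LinearEquiv.symm_apply_apply]
      exact (hπ z).symm
    · exact LinearMap.ext fun n => Pushout.desc_inc κ i y ht n
    · exact Pushout.desc_gen κ i y ht

/-- Surjections onto a cyclic module. -/
abbrev Surj (K : Submodule ℤ[Γ] ℤ[Γ]) (M : Type u) [AddCommGroup M] [Module ℤ[Γ] M] : Type u :=
  {π : M →ₗ[ℤ[Γ]] ℤ[Γ] ⧸ K // Function.Surjective π}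

theorem RigidExt.surjective (t : RigidExt K N M) : Function.Surjective t.1.1 := fun v => by
  obtain ⟨r, rfl⟩ := K.mkQ_surjective v
  exact ⟨r • t.1.2.2, by rw [LinearMap.map_smul, t.2.2.2, ← mkQ_eq_smul]⟩

theorem natCard_fiber_proj (π : Surj K M) :
    Nat.card {t : RigidExt K N M // t.1.1 = π.1} =
      Nat.card (N ≃ₗ[ℤ[Γ]] LinearMap.ker π.1) * Nat.card {y : M // π.1 y = K.mkQ 1} := by
  rw [← Nat.card_prod]
  symm
  refine Nat.card_eq_of_bijective (fun e => ⟨⟨(π.1, (Submodule.subtype _).comp e.1.toLinearMap,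
    e.2.1), ?_, ?_, e.2.2⟩, rfl⟩) ⟨?_, ?_⟩
  · exact Subtype.val_injective.comp e.1.injective
  · change LinearMap.range ((LinearMap.ker π.1).subtype.comp e.1.toLinearMap) = _
    rw [LinearMap.range_comp, LinearEquiv.range, Submodule.map_top, Submodule.range_subtype]
  · rintro ⟨e, y⟩ ⟨e', y'⟩ h
    have h1 := congrArg (fun t => t.1.1.2.1) h
    have h2 : y.1 = y'.1 := congrArg (fun t => t.1.1.2.2) h
    refine Prod.ext (LinearEquiv.ext fun n => Subtype.ext ?_) (Subtype.ext h2)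
    exact LinearMap.congr_fun h1 n
  · rintro ⟨⟨⟨π', i, y⟩, hi, hr, hy⟩, ht⟩
    have ht : π' = π.1 := ht
    subst ht
    have hr : LinearMap.range i = LinearMap.ker π.1 := hr
    exact ⟨((LinearEquiv.ofInjective i hi).trans (LinearEquiv.ofEq _ _ hr), ⟨y, hy⟩), rfl⟩

theorem natCard_fiber_generator (π : Surj K M) :
    Nat.card {y : M // π.1 y = K.mkQ 1} = Nat.card (LinearMap.ker π.1) := by
  obtain ⟨y, hy⟩ := π.2 (K.mkQ 1)
  exact Nat.card_congr
    { toFun := fun z => ⟨z.1 - y, by rw [LinearMap.mem_ker, map_sub, z.2, hy, sub_self]⟩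
      invFun := fun z => ⟨z.1 + y, by
        have : π.1 z.1 = 0 := z.2
        rw [map_add, this, hy, zero_add]⟩
      left_inv := fun z => Subtype.ext (sub_add_cancel _ _)
      right_inv := fun z => Subtype.ext (add_sub_cancel_right _ _) }

theorem natCard_rigidExt_eq_sum_pushout [Finite M] [Finite N] [Finite (ℤ[Γ] ⧸ K)]
    [Fintype (K →ₗ[ℤ[Γ]] N)] : Nat.card (RigidExt K N M) =
      ∑ κ : K →ₗ[ℤ[Γ]] N, Nat.card (Pushout κ ≃ₗ[ℤ[Γ]] M) := by
  have : Finite (M →ₗ[ℤ[Γ]] ℤ[Γ] ⧸ K) := Finite.of_injective _ DFunLike.coe_injective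
  have : Finite (N →ₗ[ℤ[Γ]] M) := Finite.of_injective _ DFunLike.coe_injective
  have : Finite (RigidExt K N M) := Subtype.finite
  rw [Nat.card_congr (Equiv.sigmaFiberEquiv (RigidExt.relations (K := K) (N := N) (M := M))).symm,
    Nat.card_sigma]
  exact Finset.sum_congr rfl fun κ _ => natCard_fiber_relations κ

theorem natCard_rigidExt_eq_sum_surj [Finite M] [Finite N] [Finite (ℤ[Γ] ⧸ K)]
    [Fintype (Surj K M)] : Nat.card (RigidExt K N M) =
      ∑ π : Surj K M, Nat.card (N ≃ₗ[ℤ[Γ]] LinearMap.ker π.1) * Nat.card N := by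
  have : Finite (M →ₗ[ℤ[Γ]] ℤ[Γ] ⧸ K) := Finite.of_injective _ DFunLike.coe_injective
  have : Finite (N →ₗ[ℤ[Γ]] M) := Finite.of_injective _ DFunLike.coe_injective
  have : Finite (RigidExt K N M) := Subtype.finite
  rw [Nat.card_congr (Equiv.sigmaFiberEquiv (fun t : RigidExt K N M =>
    (⟨t.1.1, t.surjective⟩ : Surj K M))).symm, Nat.card_sigma]
  refine Finset.sum_congr rfl fun π _ => ?_
  have h1 : Nat.card {t : RigidExt K N M // (⟨t.1.1, t.surjective⟩ : Surj K M) = π} =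
      Nat.card {t : RigidExt K N M // t.1.1 = π.1} :=
    Nat.card_congr (Equiv.subtypeEquivRight fun t => Subtype.ext_iff)
  rw [h1, natCard_fiber_proj, natCard_fiber_generator]
  rcases isEmpty_or_nonempty (N ≃ₗ[ℤ[Γ]] LinearMap.ker π.1) with h | ⟨⟨e⟩⟩
  · rw [Nat.card_of_isEmpty, zero_mul, zero_mul]
  · rw [Nat.card_congr e.toEquiv]

open Classical in
/-- The double count of extensions of a cyclic module: on the left by the middle term and the
surjection, on the right by the kernel and the relations. -/
theorem sum_mul_natCard_surj [Finite (ℤ[Γ] ⧸ K)] (A D : Finset (IsoClass.{u} Γ))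
    (hAD : ∀ c ∈ A, ∀ π : Surj K (rep c), cls Γ (LinearMap.ker π.1) ∈ D)
    (hfin : ∀ d ∈ D, Finite (K →ₗ[ℤ[Γ]] rep d)) (α : IsoClass.{u} Γ → ℝ) :
    ∑ c ∈ A, α c / Nat.card (rep c ≃ₗ[ℤ[Γ]] rep c) * Nat.card (Surj K (rep c)) =
      ∑ d ∈ D, (∑ᶠ κ : K →ₗ[ℤ[Γ]] rep d, haveI := Pushout.finite κ;
        if cls Γ (Pushout κ) ∈ A then α (cls Γ (Pushout κ)) else 0) /
          (Nat.card (rep d) * Nat.card (rep d ≃ₗ[ℤ[Γ]] rep d)) := by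
  have h1 : ∀ c ∈ A, (Nat.card (Surj K (rep c)) : ℝ) = ∑ d ∈ D,
      (Nat.card (RigidExt K (rep d) (rep c)) : ℝ) /
        (Nat.card (rep d) * Nat.card (rep d ≃ₗ[ℤ[Γ]] rep d)) := by
    intro c hc
    have : Finite (rep c →ₗ[ℤ[Γ]] ℤ[Γ] ⧸ K) := Finite.of_injective _ DFunLike.coe_injective
    have := Fintype.ofFinite (Surj K (rep c))
    have h2 : ∀ d ∈ D, (Nat.card (RigidExt K (rep d) (rep c)) : ℝ) /
        (Nat.card (rep d) * Nat.card (rep d ≃ₗ[ℤ[Γ]] rep d)) =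
          ∑ π : Surj K (rep c), if cls Γ (LinearMap.ker π.1) = d then 1 else 0 := by
      intro d _
      rw [natCard_rigidExt_eq_sum_surj, ← Finset.sum_mul, Nat.cast_mul, Nat.cast_sum]
      have h3 : (Nat.card (rep d) : ℝ) ≠ 0 := Nat.cast_ne_zero.2 Nat.card_pos.ne'
      have h4 : (Nat.card (rep d ≃ₗ[ℤ[Γ]] rep d) : ℝ) ≠ 0 :=
        Nat.cast_ne_zero.2 (natCard_aut_pos d).ne'
      rw [mul_comm, mul_div_mul_left _ _ h3, Finset.sum_div]
      refine Finset.sum_congr rfl fun π _ => ?_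
      rw [natCard_rep_equiv]
      split_ifs
      · rw [div_self h4]
      · simp
    rw [Finset.sum_congr rfl h2, Finset.sum_comm, Nat.card_eq_fintype_card, ← Finset.card_univ,
      Finset.card_eq_sum_ones, Nat.cast_sum]
    refine Finset.sum_congr rfl fun π _ => ?_
    rw [Finset.sum_ite_eq, if_pos (hAD c hc π), Nat.cast_one]
  rw [Finset.sum_congr rfl fun c hc => by rw [h1 c hc, Finset.mul_sum], Finset.sum_comm]
  refine Finset.sum_congr rfl fun d hd => ?_
  have := hfin d hd
  have := Fintype.ofFinite (K →ₗ[ℤ[Γ]] rep d)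
  rw [finsum_eq_sum_of_fintype, Finset.sum_div]
  have h2 : ∀ c ∈ A, α c / Nat.card (rep c ≃ₗ[ℤ[Γ]] rep c) *
      ((Nat.card (RigidExt K (rep d) (rep c)) : ℝ) /
        (Nat.card (rep d) * Nat.card (rep d ≃ₗ[ℤ[Γ]] rep d))) =
      ∑ κ : K →ₗ[ℤ[Γ]] rep d, haveI := Pushout.finite κ;
        (if cls Γ (Pushout κ) = c then α c else 0) /
          (Nat.card (rep d) * Nat.card (rep d ≃ₗ[ℤ[Γ]] rep d)) := by
    intro c _
    rw [natCard_rigidExt_eq_sum_pushout, Nat.cast_sum, ← Finset.sum_div, ← mul_div_assoc,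
      Finset.mul_sum]
    congr 1
    refine Finset.sum_congr rfl fun κ _ => ?_
    have := Pushout.finite κ
    have h4 : (Nat.card (rep c ≃ₗ[ℤ[Γ]] rep c) : ℝ) ≠ 0 :=
      Nat.cast_ne_zero.2 (natCard_aut_pos c).ne'
    rw [natCard_equiv_rep (Pushout κ) c]
    split_ifs
    · rw [div_mul_cancel₀ _ h4]
    · simp
  rw [Finset.sum_congr rfl h2, Finset.sum_comm]
  refine Finset.sum_congr rfl fun κ _ => ?_
  rw [← Finset.sum_div, Finset.sum_ite_eq]

end Extensions

end FinGMod

end CohenMartinet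

namespace CohenMartinet

namespace FinGMod

open scoped MonoidAlgebra

/-! ### Fixed points -/

section Fixed

variable {Γ : Type*} [Group Γ]

/-- The elements of a module fixed by a subgroup. -/
def fixedBy (D : Subgroup Γ) (X : Type*) [AddCommGroup X] [Module ℤ[Γ] X] : AddSubgroup X where
  carrier := {x | ∀ g ∈ D, (MonoidAlgebra.single g (1 : ℤ) : ℤ[Γ]) • x = x}
  zero_mem' g _ := smul_zero _
  add_mem' {x y} hx hy g hg := by rw [smul_add, hx g hg, hy g hg]
  neg_mem' {x} hx g hg := by rw [smul_neg, hx g hg]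

theorem natCard_fixedBy_congr (D : Subgroup Γ) {X Y : Type*} [AddCommGroup X] [Module ℤ[Γ] X]
    [AddCommGroup Y] [Module ℤ[Γ] Y] (e : X ≃ₗ[ℤ[Γ]] Y) :
    Nat.card (fixedBy D X) = Nat.card (fixedBy D Y) :=
  Nat.card_congr (e.toEquiv.subtypeEquiv fun x => by
    refine forall₂_congr fun g _ => ?_
    change _ ↔ _ • e x = e x
    rw [← e.map_smul, e.injective.eq_iff])

theorem exists_fixedBy_preimage [Finite Γ] (D : Subgroup Γ) {X Y : Type*} [AddCommGroup X]
    [Module ℤ[Γ] X] [Finite X] [AddCommGroup Y] [Module ℤ[Γ] Y]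
    (h : (Nat.card Γ).Coprime (Nat.card X)) (π : X →ₗ[ℤ[Γ]] Y) (x : X) (hx : π x ∈ fixedBy D Y) :
    ∃ z ∈ fixedBy D X, π z = π x := by
  have := Fintype.ofFinite D
  obtain ⟨m, hm⟩ := exists_nat_mul_smul_eq (h.coprime_dvd_left (Subgroup.card_subgroup_dvd_card D))
  refine ⟨m • ∑ g : D, (MonoidAlgebra.single (g : Γ) (1 : ℤ) : ℤ[Γ]) • x, fun g hg => ?_, ?_⟩
  · rw [smul_comm, Finset.smul_sum]
    congr 1
    refine Fintype.sum_equiv (Equiv.mulLeft (⟨g, hg⟩ : D)) _ _ fun s => ?_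
    rw [Equiv.coe_mulLeft, smul_smul, MonoidAlgebra.single_mul_single, mul_one]
    rfl
  · rw [map_nsmul, map_sum, Finset.sum_congr rfl fun g _ => by
      rw [LinearMap.map_smul, hx g g.2], Finset.sum_const, Finset.card_univ,
      ← Nat.card_eq_fintype_card, ← map_nsmul, ← map_nsmul, hm]

theorem natCard_fixedBy_eq_mul [Finite Γ] (D : Subgroup Γ) {X Y : Type*} [AddCommGroup X]
    [Module ℤ[Γ] X] [Finite X] [AddCommGroup Y] [Module ℤ[Γ] Y]
    (h : (Nat.card Γ).Coprime (Nat.card X)) (π : X →ₗ[ℤ[Γ]] Y) (hπ : Function.Surjective π) :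
    Nat.card (fixedBy D X) = Nat.card (fixedBy D (LinearMap.ker π)) * Nat.card (fixedBy D Y) := by
  have hmap : ∀ x ∈ fixedBy D X, π x ∈ fixedBy D Y := fun x hx g hg => by
    rw [← LinearMap.map_smul, hx g hg]
  let f : fixedBy D X →+ fixedBy D Y :=
    AddMonoidHom.mk' (fun x => ⟨π x, hmap x x.2⟩) fun x y => Subtype.ext (map_add π _ _)
  have hf : f.range = ⊤ := AddMonoidHom.range_eq_top.2 fun y => by
    obtain ⟨x, hx⟩ := hπ y
    obtain ⟨z, hz, hzx⟩ := exists_fixedBy_preimage D h π x (hx ▸ y.2)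
    exact ⟨⟨z, hz⟩, Subtype.ext (hzx.trans hx)⟩
  rw [natCard_eq_ker_mul_range f, hf, AddSubgroup.card_top]
  congr 1
  exact Nat.card_congr
    { toFun := fun x => ⟨⟨x.1, congrArg Subtype.val x.2⟩, fun g hg => Subtype.ext (x.1.2 g hg)⟩
      invFun := fun x => ⟨⟨x.1, fun g hg => congrArg Subtype.val (x.2 g hg)⟩, Subtype.ext x.1.2⟩
      left_inv := fun _ => rfl
      right_inv := fun _ => rfl }

variable {ι : Type*} [Fintype ι]

/-- The product of the numbers of fixed points of several subgroups. -/
noncomputable def fixedCard (D : ι → Subgroup Γ) (X : Type*) [AddCommGroup X] [Module ℤ[Γ] X] : ℕ :=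
  ∏ i, Nat.card (fixedBy (D i) X)

theorem fixedCard_pos (D : ι → Subgroup Γ) (X : Type*) [AddCommGroup X] [Module ℤ[Γ] X]
    [Finite X] : 0 < fixedCard D X := Finset.prod_pos fun _ _ => Nat.card_pos

theorem fixedCard_congr (D : ι → Subgroup Γ) {X Y : Type*} [AddCommGroup X] [Module ℤ[Γ] X]
    [AddCommGroup Y] [Module ℤ[Γ] Y] (e : X ≃ₗ[ℤ[Γ]] Y) : fixedCard D X = fixedCard D Y :=
  Finset.prod_congr rfl fun i _ => natCard_fixedBy_congr (D i) e

theorem fixedCard_eq_mul [Finite Γ] (D : ι → Subgroup Γ) {X Y : Type*} [AddCommGroup X]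
    [Module ℤ[Γ] X] [Finite X] [AddCommGroup Y] [Module ℤ[Γ] Y]
    (h : (Nat.card Γ).Coprime (Nat.card X)) (π : X →ₗ[ℤ[Γ]] Y) (hπ : Function.Surjective π) :
    fixedCard D X = fixedCard D (LinearMap.ker π) * fixedCard D Y := by
  rw [fixedCard, fixedCard, fixedCard, ← Finset.prod_mul_distrib]
  exact Finset.prod_congr rfl fun i _ => natCard_fixedBy_eq_mul (D i) h π hπ

theorem natCard_eq_ker_mul {X Y : Type*} [AddCommGroup X] [Module ℤ[Γ] X] [AddCommGroup Y]
    [Module ℤ[Γ] Y] (π : X →ₗ[ℤ[Γ]] Y) (hπ : Function.Surjective π) :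
    Nat.card X = Nat.card (LinearMap.ker π) * Nat.card Y := by
  rw [natCard_eq_ker_mul_range π.toAddMonoidHom, AddMonoidHom.range_eq_top.2 hπ,
    AddSubgroup.card_top]
  rfl

end Fixed

/-! ### The isomorphism classes of bounded order -/

section Classes

universe w

variable {Γ : Type w} [Group Γ]

theorem mem_classesUpTo_iff (p n : ℕ) (X : Type u) [AddCommGroup X] [Module ℤ[Γ] X] [Finite X] :
    cls Γ X ∈ classesUpTo.{u} Γ p n ↔ (∃ k : ℕ, Nat.card X = p ^ k) ∧ Nat.card X ≤ n ∧
      ∀ x : X, (∀ g : Γ, (MonoidAlgebra.single g (1 : ℤ) : ℤ[Γ]) • x = x) → x = 0 := by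
  obtain ⟨e⟩ := nonempty_equiv_rep (Γ := Γ) X
  rw [Nat.card_congr e.toEquiv]
  refine and_congr_right fun _ => and_congr_right fun _ => ?_
  constructor
  · intro h x hx
    refine (map_eq_zero_iff e e.injective).1 (h (e x) fun g => ?_)
    rw [← single_smul, ← e.map_smul, hx]
  · intro h x hx
    refine (map_eq_zero_iff e.symm e.symm.injective).1 (h _ fun g => ?_)
    rw [← e.symm.map_smul, single_smul, hx]

theorem finite_classesUpTo [Finite Γ] (p n : ℕ) : (classesUpTo.{u} Γ p n).Finite := by
  have hj : ∀ c : classesUpTo.{u} Γ p n, ∃ j : rep c.1 → Fin n, Function.Injective j := by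
    rintro ⟨c, -, hc, -⟩
    exact ⟨fun x => Fin.castLE hc (Finite.equivFin _ x),
      (Fin.castLE_injective hc).comp (Equiv.injective _)⟩
  choose j hj using hj
  let code : classesUpTo.{u} Γ p n → Set (Fin n × Fin n × Fin n) × Set (Γ × Fin n × Fin n) :=
    fun c => ({t | ∃ x y, t = (j c x, j c y, j c (x + y))}, {t | ∃ g x, t = (g, j c x, j c (g • x))})
  have hadd : ∀ {c d}, code c = code d → ∀ x y, ∃ x' y',
      j c x = j d x' ∧ j c y = j d y' ∧ j c (x + y) = j d (x' + y') := by
    intro c d hcd x y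
    have h : (j c x, j c y, j c (x + y)) ∈ (code d).1 := hcd ▸ ⟨x, y, rfl⟩
    obtain ⟨x', y', h⟩ := h
    rw [Prod.mk.injEq, Prod.mk.injEq] at h
    exact ⟨x', y', h⟩
  have hsmul : ∀ {c d}, code c = code d → ∀ (g : Γ) x, ∃ x',
      j c x = j d x' ∧ j c (g • x) = j d (g • x') := by
    intro c d hcd g x
    have h : (g, j c x, j c (g • x)) ∈ (code d).2 := hcd ▸ ⟨g, x, rfl⟩
    obtain ⟨g', x', h⟩ := h
    rw [Prod.mk.injEq, Prod.mk.injEq] at h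
    obtain ⟨rfl, h⟩ := h
    exact ⟨x', h⟩
  rw [← Set.finite_coe_iff]
  refine Finite.of_injective code fun c d hcd => ?_
  have hex : ∀ x, ∃ y, j c x = j d y := fun x => (hsmul hcd 1 x).imp fun _ h => h.1
  choose f hf using hex
  have hbij : Function.Bijective f := by
    refine ⟨fun x y hxy => hj c (by rw [hf, hf, hxy]), fun y => ?_⟩
    obtain ⟨x, hx, -⟩ := hsmul hcd.symm 1 y
    exact ⟨x, hj d (by rw [← hf, hx])⟩
  refine Subtype.ext ?_
  rw [← Quotient.out_eq c.1, ← Quotient.out_eq d.1]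
  refine Quotient.sound ⟨⟨AddEquiv.mk' (Equiv.ofBijective f hbij) fun x y => ?_, fun g x => ?_⟩⟩
  · obtain ⟨x', y', h1, h2, h3⟩ := hadd hcd x y
    change f (x + y) = f x + f y
    rw [hf] at h1 h2 h3
    rw [hj d h1, hj d h2, hj d h3]
  · obtain ⟨x', h1, h2⟩ := hsmul hcd g x
    change f (g • x) = g • f x
    rw [hf] at h1 h2
    rw [hj d h1, hj d h2]

end Classes

/-! ### Moments -/

section Moments

set_option linter.unusedSectionVars false

variable {Γ : Type} [Group Γ] {ι : Type*} [Fintype ι]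

/-- The weight of an isomorphism class. -/
noncomputable def classWeight (D : ι → Subgroup Γ) (c : IsoClass.{u} Γ) : ℝ :=
  (1 / fixedCard D (rep c) : ℝ) / Nat.card (rep c ≃ₗ[ℤ[Γ]] rep c)

theorem classWeight_pos (D : ι → Subgroup Γ) (c : IsoClass.{u} Γ) : 0 < classWeight D c :=
  div_pos (one_div_pos.2 (Nat.cast_pos.2 (fixedCard_pos D _))) (Nat.cast_pos.2 (natCard_aut_pos c))

theorem classWeight_le_one (D : ι → Subgroup Γ) (c : IsoClass.{u} Γ) : classWeight D c ≤ 1 := by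
  have h1 : (1 : ℝ) ≤ fixedCard D (rep c) := Nat.one_le_cast.2 (fixedCard_pos D _)
  have h2 : (1 : ℝ) ≤ Nat.card (rep c ≃ₗ[ℤ[Γ]] rep c) := Nat.one_le_cast.2 (natCard_aut_pos c)
  exact div_le_one_of_le₀ ((div_le_one_of_le₀ h1 (by positivity)).trans h2) (by positivity)

theorem coprime_natCard {p : ℕ} (hp : p.Coprime (Nat.card Γ)) {n : ℕ} (h : ∃ k, n = p ^ k) :
    (Nat.card Γ).Coprime n := by
  obtain ⟨k, rfl⟩ := h
  exact (hp.pow_left k).symm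

theorem prime_pow_of_mul {p : ℕ} [Fact p.Prime] {a b : ℕ} (h : ∃ k, a * b = p ^ k) :
    (∃ k, a = p ^ k) ∧ ∃ k, b = p ^ k := by
  obtain ⟨k, hk⟩ := h
  obtain ⟨i, -, hi⟩ := (Nat.dvd_prime_pow (Fact.out : p.Prime)).1 ⟨b, hk.symm⟩
  obtain ⟨j, -, hj⟩ := (Nat.dvd_prime_pow (Fact.out : p.Prime)).1 (Dvd.intro_left a hk)
  exact ⟨⟨i, hi⟩, j, hj⟩

theorem exists_natCard_eq_pow {V : Type*} [AddCommGroup V] [Finite V] {p : ℕ} [Fact p.Prime]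
    (h : ∀ x : V, p • x = 0) : ∃ k, Nat.card V = p ^ k := by
  have hp : IsPGroup p (Multiplicative V) := fun x => ⟨1, by
    rw [pow_one]
    exact h x.toAdd⟩
  obtain ⟨k, hk⟩ := IsPGroup.iff_card.1 hp
  exact ⟨k, hk⟩

section Cyclic

variable {p : ℕ} [Fact p.Prime] {K : Submodule ℤ[Γ] ℤ[Γ]}

theorem smul_quotient_eq_zero (hK : ∀ r : ℤ[Γ], p • r ∈ K) (v : ℤ[Γ] ⧸ K) : p • v = 0 := by
  obtain ⟨r, rfl⟩ := K.mkQ_surjective v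
  rw [← map_nsmul]
  exact (Submodule.Quotient.mk_eq_zero _).2 (hK r)

theorem finite_quotient [Finite Γ] (hK : ∀ r : ℤ[Γ], p • r ∈ K) : Finite (ℤ[Γ] ⧸ K) := by
  have h1 : Module.Finite ℤ (ℤ[Γ] ⧸ K) :=
    Module.Finite.of_surjective (K.mkQ.restrictScalars ℤ) K.mkQ_surjective
  exact Module.finite_of_fg_torsion _ fun v => ⟨⟨(p : ℤ), mem_nonZeroDivisors_iff_ne_zero.2
    (Int.natCast_ne_zero.2 (Fact.out : p.Prime).ne_zero)⟩, by
      change (p : ℤ) • v = 0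
      rw [natCast_zsmul]
      exact smul_quotient_eq_zero hK v⟩

end Cyclic

end Moments

end FinGMod

end CohenMartinet

namespace CohenMartinet

namespace FinGMod

open scoped MonoidAlgebra

section Bound

set_option linter.unusedSectionVars false

variable {Γ : Type} [Group Γ] [Finite Γ] {ι : Type*} [Fintype ι] {p : ℕ} [Fact p.Prime]
  {K : Submodule ℤ[Γ] ℤ[Γ]}

theorem Pushout.proj_surjective {N : Type u} [AddCommGroup N] [Module ℤ[Γ] N]
    (κ : K →ₗ[ℤ[Γ]] N) : Function.Surjective (Pushout.proj κ) := fun v => by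
  obtain ⟨r, rfl⟩ := K.mkQ_surjective v
  exact ⟨r • Pushout.gen κ, by rw [LinearMap.map_smul, Pushout.proj_gen, ← mkQ_eq_smul]⟩

/-- The kernel of the projection from the pushout. -/
noncomputable def Pushout.kerEquiv {N : Type u} [AddCommGroup N] [Module ℤ[Γ] N]
    (κ : K →ₗ[ℤ[Γ]] N) : N ≃ₗ[ℤ[Γ]] LinearMap.ker (Pushout.proj κ) :=
  (LinearEquiv.ofInjective _ (Pushout.inc_injective κ)).trans
    (LinearEquiv.ofEq _ _ (Pushout.range_inc κ))

theorem Pushout.natCard {N : Type u} [AddCommGroup N] [Module ℤ[Γ] N]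
    (κ : K →ₗ[ℤ[Γ]] N) : Nat.card (Pushout κ) = Nat.card N * Nat.card (ℤ[Γ] ⧸ K) := by
  rw [natCard_eq_ker_mul _ (Pushout.proj_surjective κ), Nat.card_congr (Pushout.kerEquiv κ).toEquiv]

theorem finite_hom (hp : p.Coprime (Nat.card Γ)) (hK : ∀ r : ℤ[Γ], p • r ∈ K) (N : Type u)
    [AddCommGroup N] [Module ℤ[Γ] N] [Finite N] (hN : ∃ k, Nat.card N = p ^ k) :
    Finite (K →ₗ[ℤ[Γ]] N) :=
  Nat.finite_of_card_ne_zero (by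
    rw [natCard_hom_leftIdeal K hK hp _ N hN le_rfl]
    exact Nat.card_pos.ne')

theorem fixedCard_rep_pushout (D : ι → Subgroup Γ) (hp : p.Coprime (Nat.card Γ))
    (hK : ∀ r : ℤ[Γ], p • r ∈ K) [Finite (ℤ[Γ] ⧸ K)] {N : Type u} [AddCommGroup N] [Module ℤ[Γ] N]
    [Finite N] (hN : ∃ k, Nat.card N = p ^ k) (κ : K →ₗ[ℤ[Γ]] N) [Finite (Pushout κ)] :
    fixedCard D (rep (cls Γ (Pushout κ))) = fixedCard D N * fixedCard D (ℤ[Γ] ⧸ K) := by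
  obtain ⟨k, hk⟩ := hN
  obtain ⟨l, hl⟩ := exists_natCard_eq_pow (smul_quotient_eq_zero hK)
  obtain ⟨e⟩ := nonempty_equiv_rep (Γ := Γ) (Pushout κ)
  rw [← fixedCard_congr D e, fixedCard_eq_mul D (coprime_natCard hp ⟨k + l, by
    rw [Pushout.natCard, hk, hl, pow_add]⟩) _ (Pushout.proj_surjective κ),
    fixedCard_congr D (Pushout.kerEquiv κ)]

theorem sum_classWeight_mul_surj_le (D : ι → Subgroup Γ) (hp : p.Coprime (Nat.card Γ))
    (hK : ∀ r : ℤ[Γ], p • r ∈ K) (A : Finset (IsoClass.{u} Γ))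
    (hA : ∀ c ∈ A, ∃ k, Nat.card (rep c) = p ^ k)
    (hker : ∀ c ∈ A, ∀ π : Surj K (rep c), cls Γ (LinearMap.ker π.1) ∈ A) :
    ∑ c ∈ A, classWeight D c * Nat.card (Surj K (rep c)) ≤ ∑ c ∈ A, classWeight D c := by
  classical
  have := finite_quotient hK
  have hfin : ∀ d ∈ A, Finite (K →ₗ[ℤ[Γ]] rep d) := fun d hd => finite_hom hp hK _ (hA d hd)
  refine (sum_mul_natCard_surj A A hker hfin fun c => 1 / fixedCard D (rep c)).trans_le ?_
  refine Finset.sum_le_sum fun d hd => ?_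
  have := hfin d hd
  have := Fintype.ofFinite (K →ₗ[ℤ[Γ]] rep d)
  have hcard : (0 : ℝ) < Nat.card (rep d) := Nat.cast_pos.2 Nat.card_pos
  have haut : (0 : ℝ) < Nat.card (rep d ≃ₗ[ℤ[Γ]] rep d) := Nat.cast_pos.2 (natCard_aut_pos d)
  have hfix : (0 : ℝ) < fixedCard D (rep d) := Nat.cast_pos.2 (fixedCard_pos D _)
  have hV : (1 : ℝ) ≤ fixedCard D (ℤ[Γ] ⧸ K) := Nat.one_le_cast.2 (fixedCard_pos D _)
  rw [finsum_eq_sum_of_fintype, div_le_iff₀ (mul_pos hcard haut)]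
  calc _ ≤ ∑ κ : K →ₗ[ℤ[Γ]] rep d, (1 / fixedCard D (rep d) : ℝ) := by
        refine Finset.sum_le_sum fun κ _ => ?_
        have := Pushout.finite κ
        rw [fixedCard_rep_pushout D hp hK (hA d hd)]
        split_ifs
        · rw [Nat.cast_mul]
          exact one_div_le_one_div_of_le hfix (le_mul_of_one_le_right hfix.le hV)
        · positivity
    _ = _ := by
        rw [Finset.sum_const, Finset.card_univ, ← Nat.card_eq_fintype_card,
          natCard_hom_leftIdeal K hK hp _ _ (hA d hd) le_rfl, nsmul_eq_mul, classWeight]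
        field_simp

theorem ker_mem_classesUpTo_iff (hp : p.Coprime (Nat.card Γ)) (hK : ∀ r : ℤ[Γ], p • r ∈ K)
    [Finite (ℤ[Γ] ⧸ K)] (hinv : Nat.card (fixedBy (⊤ : Subgroup Γ) (ℤ[Γ] ⧸ K)) = 1) {n : ℕ} {X : Type u}
    [AddCommGroup X] [Module ℤ[Γ] X] [Finite X] (π : X →ₗ[ℤ[Γ]] ℤ[Γ] ⧸ K)
    (hπ : Function.Surjective π) :
    cls Γ (LinearMap.ker π) ∈ classesUpTo.{u} Γ p (n / Nat.card (ℤ[Γ] ⧸ K)) ↔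
      cls Γ X ∈ classesUpTo.{u} Γ p n := by
  rw [mem_classesUpTo_iff, mem_classesUpTo_iff, natCard_eq_ker_mul π hπ]
  have hV := exists_natCard_eq_pow (smul_quotient_eq_zero hK)
  have h1 : (∃ k, Nat.card (LinearMap.ker π) * Nat.card (ℤ[Γ] ⧸ K) = p ^ k) ↔
      ∃ k, Nat.card (LinearMap.ker π) = p ^ k := by
    refine ⟨fun h => (prime_pow_of_mul h).1, ?_⟩
    rintro ⟨k, hk⟩
    obtain ⟨l, hl⟩ := hV
    exact ⟨k + l, by rw [hk, hl, pow_add]⟩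
  rw [h1, Nat.le_div_iff_mul_le Nat.card_pos]
  refine and_congr_right fun hk => and_congr_right fun _ => ?_
  have key : ∀ (Y : Type u) [AddCommGroup Y] [Module ℤ[Γ] Y] [Finite Y],
      (∀ x : Y, (∀ g : Γ, (MonoidAlgebra.single g (1 : ℤ) : ℤ[Γ]) • x = x) → x = 0) ↔
        Nat.card (fixedBy (⊤ : Subgroup Γ) Y) = 1 := by
    intro Y _ _ _
    rw [AddSubgroup.card_eq_one, AddSubgroup.eq_bot_iff_forall]
    exact forall_congr' fun x => ⟨fun h hx => h fun g => hx g trivial,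
      fun h hx => h fun g _ => hx g⟩
  rw [key, key, natCard_fixedBy_eq_mul ⊤ (coprime_natCard hp (by
    rw [natCard_eq_ker_mul π hπ]; exact h1.2 hk)) π hπ, hinv, mul_one]

/-- The classes of order at most `n` with no invariants. -/
noncomputable def classes (Γ : Type) [Group Γ] [Finite Γ] (p n : ℕ) : Finset (IsoClass.{u} Γ) :=
  (finite_classesUpTo p n).toFinset

theorem mem_classes {n : ℕ} {c : IsoClass.{u} Γ} :
    c ∈ classes Γ p n ↔ c ∈ classesUpTo.{u} Γ p n := Set.Finite.mem_toFinset _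

theorem sum_classWeight_mul_surj_eq (D : ι → Subgroup Γ) (hp : p.Coprime (Nat.card Γ))
    (hK : ∀ r : ℤ[Γ], p • r ∈ K) (hinv : Nat.card (fixedBy (⊤ : Subgroup Γ) (ℤ[Γ] ⧸ K)) = 1) (n : ℕ) :
    ∑ c ∈ classes.{u} Γ p n, classWeight D c * Nat.card (Surj K (rep c)) =
      (∑ c ∈ classes.{u} Γ p (n / Nat.card (ℤ[Γ] ⧸ K)), classWeight D c) /
        fixedCard D (ℤ[Γ] ⧸ K) := by
  classical
  have := finite_quotient hK
  have hmem : ∀ {m c}, c ∈ classes.{u} Γ p m → ∃ k, Nat.card (rep c) = p ^ k :=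
    fun h => (mem_classes.1 h).1
  have hfin : ∀ d ∈ classes.{u} Γ p (n / Nat.card (ℤ[Γ] ⧸ K)), Finite (K →ₗ[ℤ[Γ]] rep d) :=
    fun d hd => finite_hom hp hK _ (hmem hd)
  refine (sum_mul_natCard_surj (classes.{u} Γ p n) (classes.{u} Γ p (n / Nat.card (ℤ[Γ] ⧸ K)))
    (fun c hc π => ?_) hfin fun c => 1 / fixedCard D (rep c)).trans ?_
  · rw [mem_classes, ker_mem_classesUpTo_iff hp hK hinv π.1 π.2, cls_rep]
    exact mem_classes.1 hc
  rw [Finset.sum_div]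
  refine Finset.sum_congr rfl fun d hd => ?_
  have := hfin d hd
  have := Fintype.ofFinite (K →ₗ[ℤ[Γ]] rep d)
  have hcard : (Nat.card (rep d) : ℝ) ≠ 0 := Nat.cast_ne_zero.2 Nat.card_pos.ne'
  rw [finsum_eq_sum_of_fintype]
  have h1 : ∀ κ : K →ₗ[ℤ[Γ]] rep d, (haveI := Pushout.finite κ;
      if cls Γ (Pushout κ) ∈ classes.{u} Γ p n then
        (1 / fixedCard D (rep (cls Γ (Pushout κ))) : ℝ) else 0) =
      1 / (fixedCard D (rep d) * fixedCard D (ℤ[Γ] ⧸ K)) := by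
    intro κ
    have := Pushout.finite κ
    rw [fixedCard_rep_pushout D hp hK (hmem hd), if_pos, Nat.cast_mul]
    rw [mem_classes, ← ker_mem_classesUpTo_iff hp hK hinv _ (Pushout.proj_surjective κ),
      ← cls_eq_iff.2 ⟨Pushout.kerEquiv κ⟩, cls_rep]
    exact mem_classes.1 hd
  rw [Finset.sum_congr rfl fun κ _ => h1 κ, Finset.sum_const, Finset.card_univ,
    ← Nat.card_eq_fintype_card, natCard_hom_leftIdeal K hK hp _ _ (hmem hd) le_rfl, nsmul_eq_mul,
    classWeight]
  field_simp

/-! ### Boundedness of the total weight -/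

/-- The maximal left ideals of the group ring that contain `p`. -/
def maximalIdeals (Γ : Type) [Group Γ] (p : ℕ) : Set (Submodule ℤ[Γ] ℤ[Γ]) :=
  {K | IsCoatom K ∧ ∀ r : ℤ[Γ], p • r ∈ K}

theorem finite_maximalIdeals : (maximalIdeals Γ p).Finite := by
  let P : Submodule ℤ[Γ] ℤ[Γ] := LinearMap.range (p • LinearMap.id)
  have := finite_quotient (p := p) (K := P) fun r => ⟨r, rfl⟩
  have : Finite (Submodule ℤ[Γ] (ℤ[Γ] ⧸ P)) := Finite.of_injective _ SetLike.coe_injective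
  rw [← Set.finite_coe_iff]
  refine Finite.of_injective (fun K : maximalIdeals Γ p => K.1.map P.mkQ) fun K K' h => ?_
  have hle : ∀ K : maximalIdeals Γ p, P ≤ K.1 := by
    rintro K _ ⟨r, rfl⟩
    exact K.2.2 r
  have h1 := congrArg (Submodule.comap P.mkQ) h
  simp only [Submodule.comap_map_eq, Submodule.ker_mkQ, sup_eq_left.2 (hle _)] at h1
  exact Subtype.ext h1

theorem range_eq_top_or_eq_zero {X V : Type*} [AddCommGroup X] [Module ℤ[Γ] X] [AddCommGroup V]
    [Module ℤ[Γ] V] [IsSimpleModule ℤ[Γ] V] (f : X →ₗ[ℤ[Γ]] V) :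
    Function.Surjective f ∨ ∀ x, f x = 0 := by
  rcases eq_bot_or_eq_top (LinearMap.range f) with h | h
  · exact Or.inr fun x => by rw [LinearMap.range_eq_bot.1 h]; rfl
  · exact Or.inl (LinearMap.range_eq_top.1 h)

theorem smul_eq_zero_of_simple {V : Type*} [AddCommGroup V] [Module ℤ[Γ] V]
    [IsSimpleModule ℤ[Γ] V] {k : ℕ} (h : ∀ v : V, p ^ k • v = 0) (v : V) : p • v = 0 := by
  rcases range_eq_top_or_eq_zero (p • LinearMap.id : V →ₗ[ℤ[Γ]] V) with hs | h0
  · have : ∀ j : ℕ, Function.Surjective fun v : V => p ^ j • v := fun j => by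
      induction j with
      | zero => exact fun v => ⟨v, by simp⟩
      | succ j ih =>
        intro v
        obtain ⟨w, rfl⟩ := ih v
        obtain ⟨z, rfl⟩ := hs w
        exact ⟨z, by
          change p ^ (j + 1) • z = p ^ j • (p • z)
          rw [smul_smul, pow_succ]⟩
    obtain ⟨w, hw⟩ := this k v
    have hw : p ^ k • w = v := hw
    rw [← hw, h, smul_zero]
  · exact h0 v

theorem exists_surj_of_nontrivial (X : Type u) [AddCommGroup X] [Module ℤ[Γ] X] [Finite X]
    [Nontrivial X] (hX : ∃ k, Nat.card X = p ^ k) :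
    ∃ K ∈ maximalIdeals Γ p, Nonempty (Surj K X) := by
  have : Finite (Submodule ℤ[Γ] X) := Finite.of_injective _ SetLike.coe_injective
  obtain ⟨Y, hY, -⟩ := (eq_top_or_exists_le_coatom (⊥ : Submodule ℤ[Γ] X)).resolve_left bot_ne_top
  have hsimple : IsSimpleModule ℤ[Γ] (X ⧸ Y) := isSimpleModule_iff_isCoatom.2 hY
  have := IsSimpleModule.nontrivial ℤ[Γ] (X ⧸ Y)
  obtain ⟨v, hv⟩ := exists_ne (0 : X ⧸ Y)
  let f : ℤ[Γ] →ₗ[ℤ[Γ]] X ⧸ Y := LinearMap.toSpanSingleton ℤ[Γ] (X ⧸ Y) v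
  have hf : Function.Surjective f := (range_eq_top_or_eq_zero f).resolve_right fun h =>
    hv (by simpa [f] using h 1)
  let e := f.quotKerEquivOfSurjective hf
  obtain ⟨k, hk⟩ := hX
  refine ⟨LinearMap.ker f, ⟨?_, fun r => ?_⟩, ⟨e.symm.toLinearMap.comp Y.mkQ, ?_⟩⟩
  · rw [← isSimpleModule_iff_isCoatom]
    exact IsSimpleModule.congr e
  · rw [LinearMap.mem_ker, map_nsmul]
    refine smul_eq_zero_of_simple (Γ := Γ) (k := k) (fun w => ?_) _
    obtain ⟨x, rfl⟩ := Y.mkQ_surjective w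
    rw [← map_nsmul, ← hk, card_nsmul_eq_zero', map_zero]
  · exact e.symm.surjective.comp Y.mkQ_surjective

/-- A simple quotient of a submodule, with cokernel killed by `p`, is a quotient of the module. -/
theorem surj_of_surj_ker (hp : p.Coprime (Nat.card Γ)) (hK : ∀ r : ℤ[Γ], p • r ∈ K)
    {K' : Submodule ℤ[Γ] ℤ[Γ]} (hK' : K' ∈ maximalIdeals Γ p) {X : Type u} [AddCommGroup X]
    [Module ℤ[Γ] X] (π : X →ₗ[ℤ[Γ]] ℤ[Γ] ⧸ K) (h : Nonempty (Surj K' (LinearMap.ker π))) :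
    Nonempty (Surj K' X) := by
  obtain ⟨ψ, hψ⟩ := h
  have hsimple : IsSimpleModule ℤ[Γ] (ℤ[Γ] ⧸ K') := isSimpleModule_iff_isCoatom.2 hK'.1
  have := finite_quotient hK'.2
  by_cases h0 : ∀ a : LinearMap.ker π, (∃ b : X, (LinearMap.ker π).subtype a = p • b) → ψ a = 0
  · obtain ⟨ψ', h'⟩ := exists_linearMap_extension
      (coprime_natCard hp (exists_natCard_eq_pow (smul_quotient_eq_zero hK'.2)))
      (smul_quotient_eq_zero hK'.2) _ ψ h0
    refine ⟨ψ', fun v => ?_⟩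
    obtain ⟨a, rfl⟩ := hψ v
    exact ⟨_, h' a⟩
  · push Not at h0
    obtain ⟨a, ⟨b, hb⟩, ha⟩ := h0
    let μ : X →ₗ[ℤ[Γ]] LinearMap.ker π := (p • LinearMap.id).codRestrict _ fun x => by
      rw [LinearMap.mem_ker]
      change π (p • x) = 0
      rw [map_nsmul, smul_quotient_eq_zero hK]
    refine ⟨ψ.comp μ, (range_eq_top_or_eq_zero _).resolve_right fun hz => ha ?_⟩
    have : a = μ b := Subtype.ext hb
    rw [this]
    exact hz b

theorem surj_congr {X Y : Type u} [AddCommGroup X] [Module ℤ[Γ] X] [AddCommGroup Y]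
    [Module ℤ[Γ] Y] (e : X ≃ₗ[ℤ[Γ]] Y) (h : Nonempty (Surj K Y)) : Nonempty (Surj K X) :=
  h.map fun π => ⟨π.1.comp e.toLinearMap, π.2.comp e.surjective⟩

theorem two_le_natCard_surj (h2 : p ≠ 2) (hK : K ∈ maximalIdeals Γ p) {X : Type u}
    [AddCommGroup X] [Module ℤ[Γ] X] [Finite X] (h : Nonempty (Surj K X)) :
    2 ≤ Nat.card (Surj K X) := by
  obtain ⟨π⟩ := h
  have := finite_quotient hK.2
  have : Finite (X →ₗ[ℤ[Γ]] ℤ[Γ] ⧸ K) := Finite.of_injective _ DFunLike.coe_injective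
  have hne : π ≠ ⟨-π.1, fun v => by
      obtain ⟨x, hx⟩ := π.2 (-v)
      exact ⟨x, by rw [LinearMap.neg_apply, hx, neg_neg]⟩⟩ := by
    intro h
    have hsimple : IsSimpleModule ℤ[Γ] (ℤ[Γ] ⧸ K) := isSimpleModule_iff_isCoatom.2 hK.1
    have := IsSimpleModule.nontrivial ℤ[Γ] (ℤ[Γ] ⧸ K)
    obtain ⟨v, hv⟩ := exists_ne (0 : ℤ[Γ] ⧸ K)
    obtain ⟨x, hx⟩ := π.2 v
    have h1 : v = -v := by
      have h3 := LinearMap.congr_fun (congrArg Subtype.val h) x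
      rw [LinearMap.neg_apply, hx] at h3
      exact h3
    have h2v : 2 • v = 0 := by
      rw [two_smul]
      nth_rewrite 1 [h1]
      exact neg_add_cancel v
    have hodd : Odd p := (Fact.out : p.Prime).odd_of_ne_two h2
    obtain ⟨m, hm⟩ := hodd
    apply hv
    have := smul_quotient_eq_zero hK.2 v
    rwa [hm, add_smul, mul_comm, mul_smul, h2v, smul_zero, zero_add, one_smul] at this
  have := Fintype.ofFinite (Surj K X)
  rw [Nat.card_eq_fintype_card]
  exact Fintype.one_lt_card_iff.2 ⟨_, _, hne⟩

open Classical in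
theorem sum_classWeight_le (D : ι → Subgroup Γ) (hp : p.Coprime (Nat.card Γ)) (h2 : p ≠ 2) (n : ℕ)
    (T : Finset (Submodule ℤ[Γ] ℤ[Γ])) (hT : ∀ K ∈ T, K ∈ maximalIdeals Γ p) :
    ∑ c ∈ classes.{u} Γ p n, classWeight D c ≤ 2 ^ T.card *
      ∑ c ∈ (classes.{u} Γ p n).filter (fun c => ∀ K ∈ T, IsEmpty (Surj K (rep c))),
        classWeight D c := by
  induction T using Finset.induction_on with
  | empty => simp
  | insert K T hKT ih =>
    have hK := hT K (Finset.mem_insert_self _ _)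
    have := finite_quotient hK.2
    refine (ih fun K' hK' => hT K' (Finset.mem_insert_of_mem hK')).trans ?_
    rw [Finset.card_insert_of_notMem hKT, pow_succ, mul_assoc]
    refine mul_le_mul_of_nonneg_left ?_ (by positivity)
    set A := (classes.{u} Γ p n).filter (fun c => ∀ K ∈ T, IsEmpty (Surj K (rep c))) with hA
    have hA' : (classes.{u} Γ p n).filter (fun c => ∀ K' ∈ insert K T, IsEmpty (Surj K' (rep c))) =
        A.filter (fun c => IsEmpty (Surj K (rep c))) := by
      rw [hA, Finset.filter_filter]
      refine Finset.filter_congr fun c _ => ?_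
      rw [Finset.forall_mem_insert, and_comm]
    rw [hA']
    have hmoment := sum_classWeight_mul_surj_le D hp hK.2 A
      (fun c hc => (mem_classes.1 (Finset.mem_filter.1 hc).1).1) (fun c hc π => by
        obtain ⟨hc, hcT⟩ := Finset.mem_filter.1 hc
        refine Finset.mem_filter.2 ⟨mem_classes.2 ?_, fun K' hK' => ?_⟩
        · have h1 := mem_classes.1 hc
          rw [← cls_rep c, mem_classesUpTo_iff] at h1
          rw [mem_classesUpTo_iff]
          refine ⟨?_, (Nat.card_le_card_of_injective _ Subtype.val_injective).trans h1.2.1,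
            fun x hx => Subtype.ext (h1.2.2 _ fun g => congrArg Subtype.val (hx g))⟩
          have h3 := h1.1
          rw [natCard_eq_ker_mul π.1 π.2] at h3
          exact (prime_pow_of_mul h3).1
        · by_contra hne
          rw [not_isEmpty_iff] at hne
          obtain ⟨e⟩ := nonempty_equiv_rep (Γ := Γ) (LinearMap.ker π.1)
          have := surj_of_surj_ker hp hK.2 (hT K' (Finset.mem_insert_of_mem hK')) π.1
            (surj_congr e hne)
          exact not_isEmpty_iff.2 this (hcT K' hK'))
    have hsplit := Finset.sum_filter_add_sum_filter_not A (fun c => IsEmpty (Surj K (rep c)))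
      (fun c => classWeight D c)
    have hge : 2 * ∑ c ∈ A.filter (fun c => ¬ IsEmpty (Surj K (rep c))), classWeight D c ≤
        ∑ c ∈ A, classWeight D c * Nat.card (Surj K (rep c)) := by
      rw [Finset.mul_sum]
      refine (Finset.sum_le_sum fun c hc => ?_).trans (Finset.sum_le_sum_of_subset_of_nonneg
        (Finset.filter_subset _ A) fun c _ _ => mul_nonneg (classWeight_pos D c).le
          (Nat.cast_nonneg _))
      rw [mul_comm]
      refine mul_le_mul_of_nonneg_left ?_ (classWeight_pos D c).le
      exact_mod_cast two_le_natCard_surj h2 hK (not_isEmpty_iff.1 (Finset.mem_filter.1 hc).2)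
    linarith

/-- The total weight of the modules of bounded order is bounded. -/
theorem exists_bound_sum_classWeight (D : ι → Subgroup Γ) (hp : p.Coprime (Nat.card Γ))
    (h2 : p ≠ 2) : ∃ C : ℝ, ∀ n, ∑ c ∈ classes.{u} Γ p n, classWeight D c ≤ C := by
  classical
  let T := (finite_maximalIdeals (Γ := Γ) (p := p)).toFinset
  have hT : ∀ K, K ∈ T ↔ K ∈ maximalIdeals Γ p := fun K => Set.Finite.mem_toFinset _
  refine ⟨2 ^ T.card, fun n => (sum_classWeight_le D hp h2 n T fun K => (hT K).1).trans ?_⟩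
  refine mul_le_of_le_one_right (by positivity) ?_
  set A := (classes.{u} Γ p n).filter (fun c => ∀ K ∈ T, IsEmpty (Surj K (rep c))) with hA
  have hsub : ∀ c ∈ A, Subsingleton (rep c) := fun c hc => by
    obtain ⟨hc, hcT⟩ := Finset.mem_filter.1 hc
    by_contra hne
    rw [not_subsingleton_iff_nontrivial] at hne
    obtain ⟨K, hK, hs⟩ := exists_surj_of_nontrivial (Γ := Γ) (p := p) (rep c) (mem_classes.1 hc).1
    exact not_isEmpty_iff.2 hs (hcT K ((hT K).2 hK))
  have hcard : A.card ≤ 1 := Finset.card_le_one.2 fun c hc d hd => by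
    have := hsub c hc
    have := hsub d hd
    rw [← cls_rep c, ← cls_rep d]
    exact cls_eq_iff.2 ⟨(0 : rep c ≃ₗ[ℤ[Γ]] rep d)⟩
  calc ∑ c ∈ A, classWeight D c ≤ ∑ c ∈ A, (1 : ℝ) :=
        Finset.sum_le_sum fun c _ => classWeight_le_one D c
    _ ≤ 1 := by
        rw [Finset.sum_const, nsmul_eq_mul, mul_one]
        exact_mod_cast hcard

/-- The average number of surjections onto a cyclic module of exponent `p` without invariants. -/
theorem tendsto_average_surj (D : ι → Subgroup Γ) (hp : p.Coprime (Nat.card Γ)) (h2 : p ≠ 2)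
    (hK : ∀ r : ℤ[Γ], p • r ∈ K) (hinv : Nat.card (fixedBy (⊤ : Subgroup Γ) (ℤ[Γ] ⧸ K)) = 1) :
    Tendsto (fun n => (∑ c ∈ classes.{u} Γ p n, (1 + Nat.card (Surj K (rep c))) * classWeight D c) /
      ∑ c ∈ classes.{u} Γ p n, classWeight D c) atTop
        (𝓝 (1 + 1 / fixedCard D (ℤ[Γ] ⧸ K))) := by
  set S : ℕ → ℝ := fun n => ∑ c ∈ classes.{u} Γ p n, classWeight D c with hS
  have := finite_quotient hK
  have hmono : Monotone S := fun m n hmn => by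
    refine Finset.sum_le_sum_of_subset_of_nonneg (fun c hc => ?_) fun c _ _ =>
      (classWeight_pos D c).le
    have := mem_classes.1 hc
    exact mem_classes.2 ⟨this.1, this.2.1.trans hmn, this.2.2⟩
  obtain ⟨C, hC⟩ := exists_bound_sum_classWeight D hp h2
  have hlim := tendsto_atTop_ciSup hmono ⟨C, by rintro _ ⟨n, rfl⟩; exact hC n⟩
  set L := ⨆ n, S n with hL
  have hS1 : 0 < S 1 := by
    refine Finset.sum_pos (fun c _ => classWeight_pos D c) ⟨cls Γ PUnit, mem_classes.2 ?_⟩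
    rw [mem_classesUpTo_iff]
    exact ⟨⟨0, by simp⟩, by simp, fun _ _ => Subsingleton.elim _ _⟩
  have hLpos : 0 < L := hS1.trans_le (hmono.ge_of_tendsto hlim 1)
  have hlim' : Tendsto (fun n => S (n / Nat.card (ℤ[Γ] ⧸ K))) atTop (𝓝 L) :=
    hlim.comp (Nat.tendsto_div_const_atTop Nat.card_pos.ne')
  have hmain := (hlim.add (hlim'.div_const (fixedCard D (ℤ[Γ] ⧸ K) : ℝ))).div hlim hLpos.ne'
  have hval : (L + L / (fixedCard D (ℤ[Γ] ⧸ K) : ℝ)) / L = 1 + 1 / fixedCard D (ℤ[Γ] ⧸ K) := by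
    field_simp
  rw [hval] at hmain
  refine hmain.congr fun n => ?_
  have h1 : ∑ c ∈ classes.{u} Γ p n, (1 + Nat.card (Surj K (rep c))) * classWeight D c =
      S n + S (n / Nat.card (ℤ[Γ] ⧸ K)) / fixedCard D (ℤ[Γ] ⧸ K) := by
    rw [← sum_classWeight_mul_surj_eq D hp hK hinv n, hS, ← Finset.sum_add_distrib]
    exact Finset.sum_congr rfl fun c _ => by ring
  rw [h1]
  rfl

end Bound

end FinGMod

end CohenMartinet

namespace CohenMartinet

namespace FinGMod

open scoped MonoidAlgebra

/-! ### Modules induced from quadratic characters -/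

section Induced

set_option linter.unusedSectionVars false

variable {Γ : Type} [Group Γ] [Finite Γ] {S : Subgroup Γ} (χ : S →* ℤˣ) (p : ℕ) [NeZero p]

/-- The `𝔽_p`-valued functions on the group that transform under right translation by `S` through
the character `χ`. -/
def inducedFunctions : AddSubgroup (Γ → ZMod p) where
  carrier := {φ | ∀ (g : Γ) (s : S), φ (g * s) = (χ s : ℤ) • φ g}
  zero_mem' g s := by simp
  add_mem' {φ ψ} hφ hψ g s := by rw [Pi.add_apply, Pi.add_apply, hφ, hψ, smul_add]
  neg_mem' {φ} hφ g s := by rw [Pi.neg_apply, Pi.neg_apply, hφ, smul_neg]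

instance inducedAction : DistribMulAction Γ (inducedFunctions χ p) where
  smul h φ := ⟨fun g => φ.1 (h⁻¹ * g), fun g s => by
    change φ.1 (h⁻¹ * (g * s)) = (χ s : ℤ) • φ.1 (h⁻¹ * g)
    rw [← mul_assoc]
    exact φ.2 _ s⟩
  one_smul φ := Subtype.ext (funext fun g => by
    change φ.1 (1⁻¹ * g) = φ.1 g
    rw [inv_one, one_mul])
  mul_smul h k φ := Subtype.ext (funext fun g => by
    change φ.1 ((h * k)⁻¹ * g) = φ.1 (k⁻¹ * (h⁻¹ * g))
    rw [mul_inv_rev, mul_assoc])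
  smul_zero _ := rfl
  smul_add _ _ _ := rfl

theorem inducedAction_apply (h g : Γ) (φ : inducedFunctions χ p) :
    (h • φ).1 g = φ.1 (h⁻¹ * g) := rfl

/-- The module induced from the one-dimensional module given by `χ`. -/
def induced : FinGMod.{0} Γ where
  carrier := inducedFunctions χ p

/-- Frobenius reciprocity for maps from a set with an action. -/
def frobenius (Ω : Type*) [MulAction Γ Ω] :
    {f : Ω → inducedFunctions χ p // ∀ (g : Γ) (w : Ω), f (g • w) = g • f w} ≃
      {θ : Ω → ZMod p // ∀ (s : S) (w : Ω), θ ((s : Γ) • w) = (χ s : ℤ) • θ w} where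
  toFun f := ⟨fun w => (f.1 w).1 1, fun s w => by
    have h := (f.1 w).2 1 s⁻¹
    have h2 : χ s⁻¹ = χ s := by rw [map_inv, Int.units_inv_eq_self]
    change (f.1 ((s : Γ) • w)).1 1 = (χ s : ℤ) • (f.1 w).1 1
    rw [f.2, inducedAction_apply, ← h2, ← h, one_mul, mul_one]
    rfl⟩
  invFun θ := ⟨fun w => ⟨fun g => θ.1 (g⁻¹ • w), fun g s => by
      have h := θ.2 s⁻¹ (g⁻¹ • w)
      have h2 : χ s⁻¹ = χ s := by rw [map_inv, Int.units_inv_eq_self]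
      change θ.1 ((g * s)⁻¹ • w) = (χ s : ℤ) • θ.1 (g⁻¹ • w)
      rw [← h2, ← h, mul_inv_rev, mul_smul]
      rfl⟩,
    fun g w => Subtype.ext (funext fun h => by
      change θ.1 (h⁻¹ • g • w) = θ.1 ((g⁻¹ * h)⁻¹ • w)
      rw [mul_inv_rev, inv_inv, mul_smul])⟩
  left_inv f := Subtype.ext (funext fun w => Subtype.ext (funext fun g => by
    change (f.1 (g⁻¹ • w)).1 1 = (f.1 w).1 g
    rw [f.2, inducedAction_apply, inv_inv, mul_one]))
  right_inv θ := Subtype.ext (funext fun w => by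
    change θ.1 ((1 : Γ)⁻¹ • w) = θ.1 w
    rw [inv_one, one_smul])

theorem map_group_smul {M N : FinGMod Γ} (f : M.carrier →ₗ[ℤ[Γ]] N.carrier) (g : Γ)
    (x : M.carrier) : f (g • x) = g • f x := by
  rw [← single_smul, ← single_smul, f.map_smul]

/-- Frobenius reciprocity for homomorphisms. -/
noncomputable def frobeniusHom (M : FinGMod.{u} Γ) :
    (M.carrier →ₗ[ℤ[Γ]] (induced χ p).carrier) ≃
      {ψ : M.carrier →+ ZMod p // ∀ (s : S) (x : M.carrier),
        ψ ((s : Γ) • x) = (χ s : ℤ) • ψ x} where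
  toFun f :=
    let θ := frobenius χ p M.carrier ⟨fun x => f x, fun g x => map_group_smul f g x⟩
    ⟨AddMonoidHom.mk' θ.1 fun x y => by
      change (f (x + y) : inducedFunctions χ p).1 1 = (f x : inducedFunctions χ p).1 1 +
        (f y : inducedFunctions χ p).1 1
      rw [map_add]
      rfl, θ.2⟩
  invFun ψ :=
    let f := (frobenius χ p M.carrier).symm ⟨ψ.1, ψ.2⟩
    linearMapOfEquivariant (Γ := Γ) (Y := (induced χ p).carrier)
      (AddMonoidHom.mk' (fun x => (f.1 x : (induced χ p).carrier)) fun x y => Subtype.ext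
        (funext fun g => by
          change ψ.1 (g⁻¹ • (x + y)) = ψ.1 (g⁻¹ • x) + ψ.1 (g⁻¹ • y)
          rw [smul_add, map_add]))
      fun g x => by
        rw [single_smul, single_smul]
        exact f.2 g x
  left_inv f := LinearMap.ext fun x => by
    have := (frobenius χ p M.carrier).symm_apply_apply ⟨fun x => f x, fun g x => map_group_smul f g x⟩
    exact congrFun (congrArg Subtype.val this) x
  right_inv ψ := Subtype.ext (AddMonoidHom.ext fun x =>
    congrFun (congrArg Subtype.val ((frobenius χ p M.carrier).apply_symm_apply ⟨ψ.1, ψ.2⟩)) x)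

theorem induced_smul_eq_zero (v : (induced χ p).carrier) : p • v = 0 :=
  Subtype.ext (funext fun g => by
    change p • (v : inducedFunctions χ p).1 g = 0
    rw [nsmul_eq_mul, ZMod.natCast_self, zero_mul])

open Classical in
/-- The character, extended by zero. -/
noncomputable def delta : inducedFunctions χ p :=
  ⟨fun g => if h : g ∈ S then ((χ ⟨g, h⟩ : ℤˣ) : ℤ) else 0, fun g s => by
    beta_reduce
    by_cases h : g ∈ S
    · have h' : g * s ∈ S := S.mul_mem h s.2
      have h2 : (⟨g * s, h'⟩ : S) = ⟨g, h⟩ * s := rfl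
      rw [dif_pos h, dif_pos h', h2, map_mul, Units.val_mul, Int.cast_mul, mul_comm, zsmul_eq_mul]
    · have h' : g * s ∉ S := fun h' => h (by simpa using S.mul_mem h' (S.inv_mem s.2))
      rw [dif_neg h, dif_neg h', smul_zero]⟩

/-- The character, extended by zero, as an element of the induced module. -/
noncomputable def inducedGen : (induced χ p).carrier := delta χ p

theorem delta_apply_of_mem {g : Γ} (h : g ∈ S) : (delta χ p).1 g = ((χ ⟨g, h⟩ : ℤˣ) : ℤ) :=
  dif_pos h

theorem delta_apply_of_notMem {g : Γ} (h : g ∉ S) : (delta χ p).1 g = 0 := dif_neg h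

variable {χ p}

theorem apply_of_mem (φ : inducedFunctions χ p) {g : Γ} (h : g ∈ S) :
    φ.1 g = φ.1 1 * (delta χ p).1 g := by
  rw [delta_apply_of_mem χ p h, mul_comm, ← zsmul_eq_mul, ← φ.2 1 ⟨g, h⟩, one_mul]

theorem val_smul_apply (a : ZMod p) (φ : inducedFunctions χ p) (g : Γ) :
    (a.val • φ).1 g = a * φ.1 g := by
  change a.val • φ.1 g = a * φ.1 g
  rw [nsmul_eq_mul, ZMod.natCast_zmod_val]

theorem sum_smul_delta [Fintype Γ] (φ : inducedFunctions χ p) :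
    ∑ g : Γ, (φ.1 g).val • g • delta χ p = Nat.card S • φ := by
  classical
  refine Subtype.ext (funext fun h => ?_)
  rw [AddSubgroup.val_finsetSum, Finset.sum_apply]
  have h1 : ∀ k : Γ, ((φ.1 (h * k⁻¹)).val • (h * k⁻¹) • delta χ p).1 h =
      if k ∈ S then φ.1 h else 0 := by
    intro k
    rw [val_smul_apply, inducedAction_apply, mul_inv_rev, inv_inv, mul_assoc, inv_mul_cancel,
      mul_one]
    split_ifs with hk
    · have h2 := φ.2 h ⟨k⁻¹, S.inv_mem hk⟩
      have h3 : χ ⟨k⁻¹, S.inv_mem hk⟩ = χ ⟨k, hk⟩ := by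
        have : (⟨k⁻¹, S.inv_mem hk⟩ : S) = ⟨k, hk⟩⁻¹ := rfl
        rw [this, map_inv, Int.units_inv_eq_self]
      rw [h2, h3, delta_apply_of_mem χ p hk, zsmul_eq_mul, mul_comm, ← mul_assoc, ← Int.cast_mul,
        ← Units.val_mul, Int.units_mul_self, Units.val_one, Int.cast_one, one_mul]
    · rw [delta_apply_of_notMem χ p hk, mul_zero]
  rw [← Equiv.sum_comp ((Equiv.inv Γ).trans (Equiv.mulLeft h))]
  refine (Finset.sum_congr rfl fun k _ => h1 k).trans ?_
  rw [← Finset.sum_filter, Finset.sum_const]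
  change _ = Nat.card S • φ.1 h
  congr 1
  rw [Nat.card_eq_fintype_card, Fintype.card_subtype]

theorem span_delta [Fact p.Prime] (hp : p.Coprime (Nat.card Γ)) :
    Submodule.span ℤ[Γ] {inducedGen χ p} = ⊤ := by
  have := Fintype.ofFinite Γ
  rw [eq_top_iff]
  rintro φ -
  obtain ⟨m, hm⟩ := exists_nat_mul_smul_eq (M := (induced χ p).carrier) (n := Nat.card S)
    ((coprime_natCard hp (exists_natCard_eq_pow (induced_smul_eq_zero χ p))).coprime_dvd_left
      (Subgroup.card_subgroup_dvd_card S))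
  rw [← hm φ]
  refine nsmul_mem ?_ m
  have h : ∑ g : Γ, ((φ : inducedFunctions χ p).1 g).val •
      (g • inducedGen χ p) = Nat.card S • φ := sum_smul_delta (χ := χ) (p := p) φ
  rw [← h]
  refine sum_mem fun g _ => nsmul_mem ?_ _
  rw [← single_smul (induced χ p)]
  exact Submodule.smul_mem _ _ (Submodule.mem_span_singleton_self _)

variable (χ) in
/-- An element of `S` of sign `-1` whose conjugates outside the stabilizer of `S` have sign `1`. -/
structure IsSeparating (t : Γ) : Prop where
  mem : t ∈ S
  sign : χ ⟨t, mem⟩ = -1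
  conj : ∀ g, g ∉ S → ∃ h : g⁻¹ * t⁻¹ * g ∈ S, χ ⟨g⁻¹ * t⁻¹ * g, h⟩ = 1

theorem IsSeparating.apply_inv {t : Γ} (ht : IsSeparating χ t) (φ : inducedFunctions χ p) (g : Γ) :
    (g ∈ S → φ.1 (t⁻¹ * g) = -φ.1 g) ∧ (g ∉ S → φ.1 (t⁻¹ * g) = φ.1 g) := by
  have key : ∀ h : g⁻¹ * t⁻¹ * g ∈ S, φ.1 (t⁻¹ * g) = (χ ⟨g⁻¹ * t⁻¹ * g, h⟩ : ℤ) • φ.1 g := by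
    intro h
    rw [← φ.2]
    simp only [mul_assoc, mul_inv_cancel_left]
  constructor
  · intro hg
    have h : g⁻¹ * t⁻¹ * g ∈ S := S.mul_mem (S.mul_mem (S.inv_mem hg) (S.inv_mem ht.mem)) hg
    have h1 : (⟨g⁻¹ * t⁻¹ * g, h⟩ : S) = ⟨g, hg⟩⁻¹ * ⟨t, ht.mem⟩⁻¹ * ⟨g, hg⟩ := rfl
    rw [key h, h1, map_mul, map_mul, map_inv, map_inv, ht.sign, mul_right_comm, inv_mul_cancel,
      one_mul, Int.units_inv_eq_self, Units.val_neg, Units.val_one, neg_smul, one_smul]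
  · intro hg
    obtain ⟨h, h1⟩ := ht.conj g hg
    rw [key h, h1, Units.val_one, one_smul]

theorem IsSeparating.fixed_eq_zero [Fact p.Prime] (h2 : p ≠ 2) {t : Γ} (ht : IsSeparating χ t)
    (φ : inducedFunctions χ p) (hφ : ∀ g : Γ, g • φ = φ) : φ = 0 := by
  have hconst : ∀ g, φ.1 g = φ.1 1 := fun g => by
    have := congrFun (congrArg Subtype.val (hφ g⁻¹)) 1
    rwa [inducedAction_apply, inv_inv, mul_one] at this
  have h1 := (ht.apply_inv φ 1).1 S.one_mem
  rw [hconst] at h1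
  have h0 : φ.1 1 = 0 := by
    have : (2 : ZMod p) ≠ 0 := by
      have h3 : ((2 : ℕ) : ZMod p) ≠ 0 := fun h => h2
        ((Nat.prime_dvd_prime_iff_eq Fact.out Nat.prime_two).1 ((ZMod.natCast_eq_zero_iff 2 p).1 h))
      exact_mod_cast h3
    refine (mul_eq_zero.1 (?_ : (2 : ZMod p) * φ.1 1 = 0)).resolve_left this
    rw [two_mul]
    nth_rewrite 1 [h1]
    exact neg_add_cancel _
  exact Subtype.ext (funext fun g => (hconst g).trans h0)

theorem IsSeparating.delta_mem [Fact p.Prime] (h2 : p ≠ 2) {t : Γ} (ht : IsSeparating χ t)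
    (W : Submodule ℤ[Γ] (induced χ p).carrier) (φ : (induced χ p).carrier) (hφ : φ ∈ W)
    (hne : φ ≠ 0) : inducedGen χ p ∈ W := by
  have hsmul : ∀ (g : Γ) (x : (induced χ p).carrier), x ∈ W → g • x ∈ W := fun g x hx => by
    rw [← single_smul]
    exact W.smul_mem _ hx
  obtain ⟨g, hg⟩ : ∃ g, (φ : inducedFunctions χ p).1 g ≠ 0 := by
    by_contra! h
    exact hne (Subtype.ext (funext h))
  let φ' : (induced χ p).carrier := g⁻¹ • φ
  have hφ' : φ' ∈ W := hsmul _ _ hφ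
  have hval : (φ' : inducedFunctions χ p).1 1 ≠ 0 := by
    change (φ : inducedFunctions χ p).1 (g⁻¹⁻¹ * 1) ≠ 0
    rwa [inv_inv, mul_one]
  have h2' : (2 : ZMod p) ≠ 0 := by
    have h3 : ((2 : ℕ) : ZMod p) ≠ 0 := fun h => h2
      ((Nat.prime_dvd_prime_iff_eq Fact.out Nat.prime_two).1 ((ZMod.natCast_eq_zero_iff 2 p).1 h))
    exact_mod_cast h3
  have hmem : φ' - t • φ' ∈ W := W.sub_mem hφ' (hsmul _ _ hφ')
  have hdelta : inducedGen χ p =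
      ((2 * (φ' : inducedFunctions χ p).1 1)⁻¹).val • (φ' - t • φ') := by
    refine Subtype.ext (funext fun k => ?_)
    have h3 : ((((2 * (φ' : inducedFunctions χ p).1 1)⁻¹).val • (φ' - t • φ') :
        inducedFunctions χ p)).1 k = (2 * (φ' : inducedFunctions χ p).1 1)⁻¹ *
          ((φ' : inducedFunctions χ p).1 k - (φ' : inducedFunctions χ p).1 (t⁻¹ * k)) :=
      val_smul_apply _ _ _
    refine Eq.trans ?_ h3.symm
    change (delta χ p).1 k = _
    by_cases hk : k ∈ S
    · rw [(ht.apply_inv φ' k).1 hk, apply_of_mem φ' hk, sub_neg_eq_add, ← two_mul]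
      exact ((congrArg _ (mul_assoc _ _ _).symm).trans
        (inv_mul_cancel_left₀ (mul_ne_zero h2' hval) _)).symm
    · rw [(ht.apply_inv φ' k).2 hk, sub_self, mul_zero, delta_apply_of_notMem χ p hk]
  rw [hdelta]
  exact nsmul_mem hmem _

variable (χ p) in
/-- The relations between the translates of the generator. -/
noncomputable def relationIdeal : Submodule ℤ[Γ] ℤ[Γ] :=
  LinearMap.ker (LinearMap.toSpanSingleton ℤ[Γ] (induced χ p).carrier (inducedGen χ p))

/-- The induced module is cyclic. -/
noncomputable def quotientRelationIdealEquiv [Fact p.Prime] (hp : p.Coprime (Nat.card Γ)) :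
    (ℤ[Γ] ⧸ relationIdeal χ p) ≃ₗ[ℤ[Γ]] (induced χ p).carrier :=
  (LinearMap.toSpanSingleton ℤ[Γ] (induced χ p).carrier (inducedGen χ p)).quotKerEquivOfSurjective (by
    rw [← LinearMap.range_eq_top, LinearMap.range_toSpanSingleton, span_delta hp])

theorem smul_mem_relationIdeal (r : ℤ[Γ]) : p • r ∈ relationIdeal χ p := by
  rw [relationIdeal, LinearMap.mem_ker, map_nsmul]
  exact induced_smul_eq_zero χ p _

theorem IsSeparating.natCard_fixedBy_top [Fact p.Prime] (hp : p.Coprime (Nat.card Γ)) (h2 : p ≠ 2)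
    {t : Γ} (ht : IsSeparating χ t) :
    Nat.card (fixedBy (⊤ : Subgroup Γ) (ℤ[Γ] ⧸ relationIdeal χ p)) = 1 := by
  rw [natCard_fixedBy_congr ⊤ (quotientRelationIdealEquiv hp), AddSubgroup.card_eq_one,
    AddSubgroup.eq_bot_iff_forall]
  intro φ hφ
  refine ht.fixed_eq_zero h2 φ fun g => ?_
  have := hφ g trivial
  rwa [single_smul] at this

theorem IsSeparating.natCard_hom [Fact p.Prime] (hp : p.Coprime (Nat.card Γ)) (h2 : p ≠ 2)
    {t : Γ} (ht : IsSeparating χ t) (M : FinGMod.{u} Γ) :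
    Nat.card (M.carrier →ₗ[ℤ[Γ]] (induced χ p).carrier) =
      1 + Nat.card (Surj (relationIdeal χ p) M.carrier) := by
  classical
  let e := quotientRelationIdealEquiv (χ := χ) (p := p) hp
  have : Finite (ℤ[Γ] ⧸ relationIdeal χ p) := Finite.of_equiv _ e.symm.toEquiv
  have : Finite (M.carrier →ₗ[ℤ[Γ]] ℤ[Γ] ⧸ relationIdeal χ p) :=
    Finite.of_injective _ DFunLike.coe_injective
  have h1 : Nat.card (M.carrier →ₗ[ℤ[Γ]] (induced χ p).carrier) =
      Nat.card (M.carrier →ₗ[ℤ[Γ]] ℤ[Γ] ⧸ relationIdeal χ p) :=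
    Nat.card_congr
      { toFun := fun f => e.symm.toLinearMap.comp f
        invFun := fun f => e.toLinearMap.comp f
        left_inv := fun f => by ext; simp
        right_inv := fun f => by ext; simp }
  have hsurj : ∀ f : M.carrier →ₗ[ℤ[Γ]] ℤ[Γ] ⧸ relationIdeal χ p,
      f ≠ 0 ↔ Function.Surjective f := by
    intro f
    constructor
    · intro hf
      obtain ⟨x, hx⟩ : ∃ x, f x ≠ 0 := by
        by_contra! h
        exact hf (LinearMap.ext h)
      have hmem := ht.delta_mem h2 (LinearMap.range (e.toLinearMap.comp f)) (e (f x)) ⟨x, rfl⟩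
        (fun h => hx ((map_eq_zero_iff e e.injective).1 h))
      have htop : LinearMap.range (e.toLinearMap.comp f) = ⊤ := by
        rw [eq_top_iff, ← span_delta hp, Submodule.span_singleton_le_iff_mem]
        exact hmem
      intro v
      obtain ⟨y, hy⟩ := LinearMap.range_eq_top.1 htop (e v)
      exact ⟨y, e.injective hy⟩
    · rintro hf rfl
      have hall : ∀ φ : inducedFunctions χ p, φ = 0 := fun φ => by
        obtain ⟨x, hx⟩ := hf (e.symm φ)
        exact (e.apply_symm_apply φ).symm.trans ((congrArg e hx).symm.trans (map_zero e))
      have h3 := congrFun (congrArg Subtype.val (hall (delta χ p))) 1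
      rw [delta_apply_of_mem χ p S.one_mem] at h3
      have h4 : χ ⟨1, S.one_mem⟩ = 1 := map_one χ
      rw [h4] at h3
      have : Fact (1 < p) := ⟨(Fact.out : p.Prime).one_lt⟩
      exact one_ne_zero (α := ZMod p) (by simp at h3)
  have := Fintype.ofFinite (M.carrier →ₗ[ℤ[Γ]] ℤ[Γ] ⧸ relationIdeal χ p)
  rw [h1, Nat.card_eq_fintype_card, Nat.card_eq_fintype_card, Fintype.card_subtype,
    ← Finset.filter_congr fun f _ => hsurj f, Finset.filter_ne', Finset.card_erase_of_mem
      (Finset.mem_univ _), Finset.card_univ]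
  exact (Nat.add_sub_cancel' Fintype.card_pos).symm

/-- The average number of homomorphisms to a one-dimensional representation `χ` of `S`. -/
theorem IsSeparating.tendsto_average [Fact p.Prime] (hp : p.Coprime (Nat.card Γ)) (h2 : p ≠ 2)
    {t : Γ} (ht : IsSeparating χ t) {ι : Type*} [Fintype ι] (D : ι → Subgroup Γ) :
    Tendsto (fun n => (∑ c ∈ classes.{u} Γ p n,
      (Nat.card {ψ : rep c →+ ZMod p // ∀ (s : S) (x : rep c),
        ψ ((s : Γ) • x) = (χ s : ℤ) • ψ x} : ℝ) * classWeight D c) /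
      ∑ c ∈ classes.{u} Γ p n, classWeight D c) atTop
        (𝓝 (1 + 1 / fixedCard D (induced χ p).carrier)) := by
  have h := tendsto_average_surj.{u} D hp h2 (smul_mem_relationIdeal (χ := χ))
    (ht.natCard_fixedBy_top hp h2)
  rw [fixedCard_congr D (quotientRelationIdealEquiv hp)] at h
  refine h.congr fun n => ?_
  congr 1
  refine Finset.sum_congr rfl fun c _ => ?_
  rw [← Nat.card_congr (frobeniusHom χ p (Quotient.out c)), ht.natCard_hom hp h2, Nat.cast_add,
    Nat.cast_one]

end Induced

end FinGMod

end CohenMartinet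

namespace CohenMartinet

/-! ### Permutation 2-groups containing a transposition -/

section PermutationGroups

set_option linter.unusedSectionVars false

variable {B : Type} [DecidableEq B] [Finite B] {G : Subgroup (Equiv.Perm B)} {b b' : B}

theorem apply_eq_of_apply_eq (hG : IsPGroup 2 G) (hb : b ≠ b') (hswap : Equiv.swap b b' ∈ G) (g : G)
    (hg : g • b = b) : g • b' = b' := by
  have := Fintype.ofFinite B
  by_contra hc
  have hg' : (g : Equiv.Perm B) b = b := hg
  have hc' : (g : Equiv.Perm B) b' ≠ b' := hc
  have hbc : b ≠ (g : Equiv.Perm B) b' := fun h =>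
    hb ((g : Equiv.Perm B).injective (hg'.trans h))
  have hconj : Equiv.swap b ((g : Equiv.Perm B) b') ∈ G := by
    have := G.mul_mem (G.mul_mem g.2 hswap) (G.inv_mem g.2)
    rwa [← Equiv.swap_apply_apply, hg'] at this
  have h3 := Equiv.Perm.isThreeCycle_swap_mul_swap_same hb hbc hc'.symm
  obtain ⟨k, hk⟩ := (IsPGroup.iff_orderOf.1 hG) ⟨_, G.mul_mem hswap hconj⟩
  rw [Subgroup.orderOf_mk, h3.orderOf] at hk
  rcases k with _ | k
  · norm_num at hk
  · rw [pow_succ] at hk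
    omega

theorem apply_eq_left_of_apply_eq_right (hG : IsPGroup 2 G) (hb : b ≠ b')
    (hswap : Equiv.swap b b' ∈ G) (g : G) (hg : g • b = b') : g • b' = b := by
  have h1 : (⟨Equiv.swap b b', hswap⟩ * g : G) • b = b := by
    rw [mul_smul, hg]
    exact Equiv.swap_apply_right b b'
  have h2 := apply_eq_of_apply_eq hG hb hswap _ h1
  rw [mul_smul] at h2
  have h3 : Equiv.swap b b' (g • b') = b' := h2
  rw [Equiv.swap_apply_eq_iff, Equiv.swap_apply_right] at h3
  exact h3

theorem mem_stabilizer_pair_iff (hG : IsPGroup 2 G) (hb : b ≠ b') (hswap : Equiv.swap b b' ∈ G)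
    (g : G) : g ∈ MulAction.stabilizer G ({b, b'} : Set B) ↔ g • b = b ∨ g • b = b' := by
  rw [MulAction.mem_stabilizer_iff]
  have himg : g • ({b, b'} : Set B) = {g • b, g • b'} := Set.image_pair _ _ _
  rw [himg]
  constructor
  · intro h
    have : g • b ∈ ({b, b'} : Set B) := h ▸ Set.mem_insert _ _
    exact this
  · rintro (h | h)
    · rw [h, apply_eq_of_apply_eq hG hb hswap g h]
    · rw [h, apply_eq_left_of_apply_eq_right hG hb hswap g h, Set.pair_comm]

/-- The character of the stabilizer of `{b, b'}` on the signs of the two points. -/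
def signChar (hG : IsPGroup 2 G) (hb : b ≠ b') (hswap : Equiv.swap b b' ∈ G) :
    MulAction.stabilizer G ({b, b'} : Set B) →* ℤˣ where
  toFun g := if (g : G) • b = b then 1 else -1
  map_one' := by simp
  map_mul' g h := by
    have hg := (mem_stabilizer_pair_iff hG hb hswap g).1 g.2
    have hh := (mem_stabilizer_pair_iff hG hb hswap h).1 h.2
    have hmul : ((g * h : MulAction.stabilizer G ({b, b'} : Set B)) : G) • b =
        (g : G) • (h : G) • b := mul_smul (g : G) (h : G) b
    rw [hmul]
    rcases hh with hh | hh
    · rw [hh, if_pos rfl, mul_one]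
    · rw [hh, if_neg hb.symm]
      rcases hg with hg | hg
      · rw [apply_eq_of_apply_eq hG hb hswap g hg, if_neg hb.symm, if_pos hg, one_mul]
      · rw [apply_eq_left_of_apply_eq_right hG hb hswap g hg, if_pos rfl, hg, if_neg hb.symm]
        rfl

theorem isSeparating_swap (hG : IsPGroup 2 G) (hb : b ≠ b') (hswap : Equiv.swap b b' ∈ G) :
    FinGMod.IsSeparating (signChar hG hb hswap) ⟨Equiv.swap b b', hswap⟩ where
  mem := (mem_stabilizer_pair_iff hG hb hswap _).2 (Or.inr (Equiv.swap_apply_left b b'))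
  sign := if_neg (by
    have : (⟨Equiv.swap b b', hswap⟩ : G) • b = b' := Equiv.swap_apply_left b b'
    exact fun h => hb (h.symm.trans this))
  conj g hg := by
    rw [mem_stabilizer_pair_iff hG hb hswap, not_or] at hg
    have hfix : (g⁻¹ * (⟨Equiv.swap b b', hswap⟩ : G)⁻¹ * g) • b = b := by
      rw [mul_smul, mul_smul, inv_smul_eq_iff]
      have h : (⟨Equiv.swap b b', hswap⟩ : G)⁻¹ = ⟨Equiv.swap b b', hswap⟩ :=
        Subtype.ext (Equiv.swap_inv b b')
      rw [h]
      exact Equiv.swap_apply_of_ne_of_ne hg.1 hg.2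
    exact ⟨(mem_stabilizer_pair_iff hG hb hswap _).2 (Or.inl hfix), if_pos hfix⟩

theorem signHoms_eq (hG : IsPGroup 2 G) (hb : b ≠ b') (hswap : Equiv.swap b b' ∈ G)
    (M : FinGMod.{u} G) : signHoms G b b' M =
      Nat.card {ψ : M.carrier →+ ZMod 3 // ∀ (s : MulAction.stabilizer G ({b, b'} : Set B))
        (x : M.carrier), ψ ((s : G) • x) = (signChar hG hb hswap s : ℤ) • ψ x} := by
  rw [signHoms]
  congr 1
  refine Nat.card_congr (Equiv.subtypeEquivRight fun ψ => ?_)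
  have key : ∀ g (hg : g ∈ MulAction.stabilizer G ({b, b'} : Set B)) (x : M.carrier),
      (signChar hG hb hswap ⟨g, hg⟩ : ℤ) • ψ x = (if g • b = b then 1 else -1) * ψ x := ?_
  · exact ⟨fun h s x => (h s s.2 x).trans ((key s s.2 x).symm ▸ by congr!), fun h g hg x =>
      (h ⟨g, hg⟩ x).trans ((key g hg x).trans (by congr!))⟩
  intro g hg x
  have : (((signChar hG hb hswap ⟨g, hg⟩ : ℤˣ) : ℤ) : ZMod 3) = if g • b = b then 1 else -1 := by
    change (((if g • b = b then 1 else -1 : ℤˣ) : ℤ) : ZMod 3) = _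
    split_ifs <;> simp
  rw [zsmul_eq_mul, this]

theorem coprime_three_natCard (hG : IsPGroup 2 G) : Nat.Coprime 3 (Nat.card G) := by
  obtain ⟨k, hk⟩ := IsPGroup.iff_card.1 hG
  rw [hk]
  exact Nat.Coprime.pow_right k (by norm_num)

end PermutationGroups

/-! ### Counting functions that transform through a character -/

section Counting

variable {Γ : Type*} [Group Γ] {S H : Subgroup Γ} {Ω : Type*} [MulAction Γ Ω]

theorem natCard_invariant_functions [Finite Ω] (p : ℕ) [NeZero p] :
    Nat.card {θ : Ω → ZMod p // ∀ h ∈ H, ∀ w, θ (h • w) = θ w} =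
      p ^ Nat.card (MulAction.orbitRel.Quotient H Ω) := by
  have e : {θ : Ω → ZMod p // ∀ h ∈ H, ∀ w, θ (h • w) = θ w} ≃
      (MulAction.orbitRel.Quotient H Ω → ZMod p) :=
    { toFun := fun θ q => Quotient.liftOn q θ.1 (by
        rintro _ w ⟨h, rfl⟩
        exact θ.2 h h.2 w)
      invFun := fun f => ⟨fun w => f (Quotient.mk _ w), fun h hh w =>
        congrArg f (Quotient.sound ⟨⟨h, hh⟩, rfl⟩)⟩
      left_inv := fun θ => rfl
      right_inv := fun f => funext fun q => by
        induction q using Quotient.inductionOn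
        rfl }
  rw [Nat.card_congr e, Nat.card_fun, Nat.card_zmod]

/-- If `χ` is a quadratic character of `S` with kernel `H`, the invariant functions of `H` are the
sums of those of `S` and those that transform through `χ`. -/
theorem natCard_character_functions [Finite Ω] {p : ℕ} [Fact p.Prime] (h2 : p ≠ 2) (χ : S →* ℤˣ)
    (hH : ∀ g : Γ, g ∈ H ↔ ∃ h : g ∈ S, χ ⟨g, h⟩ = 1) {t : Γ} (ht : t ∈ S) (htχ : χ ⟨t, ht⟩ = -1) :
    Nat.card {θ : Ω → ZMod p // ∀ (s : S) (w : Ω), θ ((s : Γ) • w) = (χ s : ℤ) • θ w} *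
      p ^ Nat.card (MulAction.orbitRel.Quotient S Ω) =
        p ^ Nat.card (MulAction.orbitRel.Quotient H Ω) := by
  have h2' : (2 : ZMod p) ≠ 0 := by
    have h3 : ((2 : ℕ) : ZMod p) ≠ 0 := fun h => h2
      ((Nat.prime_dvd_prime_iff_eq Fact.out Nat.prime_two).1 ((ZMod.natCast_eq_zero_iff 2 p).1 h))
    exact_mod_cast h3
  have hdichotomy : ∀ s : S, (s : Γ) ∈ H ∧ χ s = 1 ∨ χ s = -1 ∧ ∃ h ∈ H, (s : Γ) = h * t := by
    intro s
    rcases Int.units_eq_one_or (χ s) with h | h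
    · exact Or.inl ⟨(hH s).2 ⟨s.2, h⟩, h⟩
    · refine Or.inr ⟨h, s * t⁻¹, (hH _).2 ⟨S.mul_mem s.2 (S.inv_mem ht), ?_⟩, by
        rw [inv_mul_cancel_right]⟩
      have : (⟨s * t⁻¹, S.mul_mem s.2 (S.inv_mem ht)⟩ : S) = s * ⟨t, ht⟩⁻¹ := rfl
      rw [this, map_mul, map_inv, h, htχ]
      rfl
  have hχH : ∀ h (hh : h ∈ H), ∃ hS : h ∈ S, χ ⟨h, hS⟩ = 1 := fun h hh => (hH h).1 hh
  have hconj : ∀ h ∈ H, t * h * t⁻¹ ∈ H := fun h hh => by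
    obtain ⟨hS, h1⟩ := hχH h hh
    refine (hH _).2 ⟨S.mul_mem (S.mul_mem ht hS) (S.inv_mem ht), ?_⟩
    have : (⟨t * h * t⁻¹, S.mul_mem (S.mul_mem ht hS) (S.inv_mem ht)⟩ : S) =
      ⟨t, ht⟩ * ⟨h, hS⟩ * ⟨t, ht⟩⁻¹ := rfl
    rw [this, map_mul, map_mul, map_inv, h1, mul_one, mul_inv_cancel]
  have htt : t * t ∈ H := by
    refine (hH _).2 ⟨S.mul_mem ht ht, ?_⟩
    have : (⟨t * t, S.mul_mem ht ht⟩ : S) = ⟨t, ht⟩ * ⟨t, ht⟩ := rfl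
    rw [this, map_mul, Int.units_mul_self]
  rw [← natCard_invariant_functions, ← natCard_invariant_functions, ← Nat.card_prod]
  have htinv : ∀ θ : Ω → ZMod p, (∀ h ∈ H, ∀ w, θ (h • w) = θ w) → ∀ h ∈ H, ∀ w,
      θ (t • h • w) = θ (t • w) := fun θ hθ h hh w => by
    have := hθ _ (hconj h hh) (t • w)
    rwa [smul_smul, inv_mul_cancel_right, mul_smul] at this
  refine Nat.card_congr
    { toFun := fun x => ⟨fun w => x.1.1 w + x.2.1 w, fun h hh w => ?_⟩
      invFun := fun θ => (⟨fun w => 2⁻¹ * (θ.1 w - θ.1 (t • w)), fun s w => ?_⟩,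
        ⟨fun w => 2⁻¹ * (θ.1 w + θ.1 (t • w)), fun s hs w => ?_⟩)
      left_inv := fun x => ?_
      right_inv := fun θ => Subtype.ext (funext fun w => ?_) }
  · obtain ⟨hS, h1⟩ := hχH h hh
    have h3 := x.1.2 ⟨h, hS⟩ w
    rw [h1, Units.val_one, one_smul] at h3
    have h4 : x.1.1 (h • w) = x.1.1 w := h3
    change x.1.1 (h • w) + x.2.1 (h • w) = x.1.1 w + x.2.1 w
    rw [h4, x.2.2 h hS]
  · change 2⁻¹ * (θ.1 ((s : Γ) • w) - θ.1 (t • (s : Γ) • w)) =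
      (χ s : ℤ) • (2⁻¹ * (θ.1 w - θ.1 (t • w)))
    rcases hdichotomy s with ⟨hs, h1⟩ | ⟨h1, h, hh, hs⟩
    · rw [h1, Units.val_one, one_smul, θ.2 _ hs, htinv θ.1 θ.2 _ hs]
    · rw [h1, hs, mul_smul, θ.2 _ hh, htinv θ.1 θ.2 _ hh, smul_smul t t, θ.2 _ htt, Units.val_neg,
        Units.val_one, neg_smul, one_smul]
      ring
  · change 2⁻¹ * (θ.1 (s • w) + θ.1 (t • s • w)) = 2⁻¹ * (θ.1 w + θ.1 (t • w))
    rcases hdichotomy ⟨s, hs⟩ with ⟨hs, h1⟩ | ⟨h1, h, hh, hs⟩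
    · rw [θ.2 _ hs, htinv θ.1 θ.2 _ hs]
    · have hs : s = h * t := hs
      rw [hs, mul_smul, θ.2 _ hh, htinv θ.1 θ.2 _ hh, smul_smul t t, θ.2 _ htt, add_comm]
  · have h3 : ∀ w, x.1.1 (t • w) = - x.1.1 w := fun w => by
      have := x.1.2 ⟨t, ht⟩ w
      rwa [htχ, Units.val_neg, Units.val_one, neg_smul, one_smul] at this
    refine Prod.ext (Subtype.ext (funext fun w => ?_)) (Subtype.ext (funext fun w => ?_))
    · change 2⁻¹ * (x.1.1 w + x.2.1 w - (x.1.1 (t • w) + x.2.1 (t • w))) = x.1.1 w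
      rw [h3, x.2.2 t ht]
      field_simp
      ring
    · change 2⁻¹ * (x.1.1 w + x.2.1 w + (x.1.1 (t • w) + x.2.1 (t • w))) = x.2.1 w
      rw [h3, x.2.2 t ht]
      field_simp
      ring
  · change 2⁻¹ * (θ.1 w - θ.1 (t • w)) + 2⁻¹ * (θ.1 w + θ.1 (t • w)) = θ.1 w
    field_simp
    ring

/-- Equivariant maps are determined by their values on representatives of the orbits. -/
theorem natCard_equivariant_maps {V : Type*} [MulAction Γ V] {ι : Type*} [Fintype ι] (r : ι → Ω)
    (hr : ∀ w, ∃ i, ∃ g : Γ, g • r i = w)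
    (hinj : ∀ i j (g : Γ), g • r i = r j → i = j) :
    Nat.card {f : Ω → V // ∀ (g : Γ) (w : Ω), f (g • w) = g • f w} =
      ∏ i, Nat.card {v : V // ∀ g ∈ MulAction.stabilizer Γ (r i), g • v = v} := by
  rw [← Nat.card_pi]
  choose i g hg using hr
  refine Nat.card_eq_of_bijective (fun f j => ⟨f.1 (r j), fun g hg => by rw [← f.2, hg]⟩) ⟨?_, ?_⟩
  · intro f f' h
    refine Subtype.ext (funext fun w => ?_)
    have := congrArg Subtype.val (congrFun h (i w))
    have h1 : f.1 (r (i w)) = f'.1 (r (i w)) := this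
    rw [← hg w, f.2, f'.2, h1]
  · intro v
    have key : ∀ (k : Γ) (j : ι), g (k • r j) • (v (i (k • r j))).1 = k • (v j).1 := by
      intro k j
      have h1 := hg (k • r j)
      have h2 : i (k • r j) = j := hinj _ _ (k⁻¹ * g (k • r j)) (by
        rw [mul_smul, h1, inv_smul_smul])
      have h3 : k⁻¹ * g (k • r j) ∈ MulAction.stabilizer Γ (r j) := by
        rw [MulAction.mem_stabilizer_iff, mul_smul]
        nth_rewrite 2 [← h2]
        rw [h1, inv_smul_smul]
      have h4 := (v j).2 _ h3
      rw [mul_smul, inv_smul_eq_iff] at h4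
      rw [h2, h4]
    refine ⟨⟨fun w => g w • (v (i w)).1, fun k w => ?_⟩, funext fun j => Subtype.ext ?_⟩
    · have h1 := key (k * g w) (i w)
      rwa [mul_smul, hg, mul_smul] at h1
    · have h1 := key 1 j
      rwa [one_smul, one_smul] at h1

end Counting

end CohenMartinet

namespace CohenMartinet

section PermutationGroups

set_option linter.unusedSectionVars false

variable {B : Type} [DecidableEq B] [Finite B] {G : Subgroup (Equiv.Perm B)} {b b' : B}

theorem stabilizer_le_stabilizer_pair (hG : IsPGroup 2 G) (hb : b ≠ b')
    (hswap : Equiv.swap b b' ∈ G) :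
    MulAction.stabilizer G b ≤ MulAction.stabilizer G ({b, b'} : Set B) := fun g hg =>
  (mem_stabilizer_pair_iff hG hb hswap g).2 (Or.inl hg)

theorem mem_stabilizer_iff_signChar (hG : IsPGroup 2 G) (hb : b ≠ b')
    (hswap : Equiv.swap b b' ∈ G) (g : G) : g ∈ MulAction.stabilizer G b ↔
      ∃ h : g ∈ MulAction.stabilizer G ({b, b'} : Set B), signChar hG hb hswap ⟨g, h⟩ = 1 := by
  constructor
  · exact fun hg => ⟨stabilizer_le_stabilizer_pair hG hb hswap hg, if_pos hg⟩
  · rintro ⟨h, h1⟩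
    by_contra hg
    have : signChar hG hb hswap ⟨g, h⟩ = -1 := if_neg hg
    rw [h1] at this
    exact absurd this (by decide)

theorem natCard_stabilizer_pair (hG : IsPGroup 2 G) (hb : b ≠ b') (hswap : Equiv.swap b b' ∈ G) :
    Nat.card (MulAction.stabilizer G ({b, b'} : Set B)) = 2 * Nat.card (MulAction.stabilizer G b) := by
  have ht := isSeparating_swap hG hb hswap
  have hsurj : Function.Surjective (signChar hG hb hswap) := fun z => by
    rcases Int.units_eq_one_or z with rfl | rfl
    · exact ⟨1, map_one _⟩
    · exact ⟨_, ht.sign⟩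
  have h1 := Subgroup.card_mul_index (signChar hG hb hswap).ker
  have h2 : (signChar hG hb hswap).ker.index = 2 := by
    rw [Subgroup.index_ker, MonoidHom.range_eq_top.2 hsurj, Subgroup.card_top,
      Nat.card_eq_fintype_card]
    rfl
  have h3 : Nat.card (signChar hG hb hswap).ker = Nat.card (MulAction.stabilizer G b) :=
    Nat.card_congr
      { toFun := fun x => ⟨x.1.1, (mem_stabilizer_iff_signChar hG hb hswap _).2 ⟨x.1.2, x.2⟩⟩
        invFun := fun x => ⟨⟨x.1, stabilizer_le_stabilizer_pair hG hb hswap x.2⟩,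
          ((mem_stabilizer_iff_signChar hG hb hswap _).1 x.2).2⟩
        left_inv := fun x => rfl
        right_inv := fun x => rfl }
  rw [← h1, h2, h3, mul_comm]

theorem eq_stabilizer_pair (hG : IsPGroup 2 G) (hb : b ≠ b') (hswap : Equiv.swap b b' ∈ G)
    {A : Subgroup G} (hA : MulAction.stabilizer G b ≤ A)
    (hcard : Nat.card A = 2 * Nat.card (MulAction.stabilizer G b)) :
    A = MulAction.stabilizer G ({b, b'} : Set B) := by
  have hpos : 0 < Nat.card (MulAction.stabilizer G b) := Nat.card_pos
  obtain ⟨g, hgA, hg⟩ : ∃ g ∈ A, g • b = b' := by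
    obtain ⟨g, hgA, hg⟩ : ∃ g ∈ A, g • b ≠ b := by
      by_contra! h
      have : A = MulAction.stabilizer G b := le_antisymm h hA
      rw [this] at hcard
      omega
    by_cases hc : g • b = b'
    · exact ⟨g, hgA, hc⟩
    · refine ⟨⟨Equiv.swap b b', hswap⟩, ?_, Equiv.swap_apply_left b b'⟩
      have h1 : g⁻¹ * ⟨Equiv.swap b b', hswap⟩ * g ∈ MulAction.stabilizer G b := by
        rw [MulAction.mem_stabilizer_iff, mul_smul, mul_smul, inv_smul_eq_iff]
        exact Equiv.swap_apply_of_ne_of_ne hg hc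
      have h2 := A.mul_mem (A.mul_mem hgA (hA h1)) (A.inv_mem hgA)
      rwa [mul_assoc g⁻¹, mul_inv_cancel_left, mul_inv_cancel_right] at h2
  refine (Subgroup.eq_of_le_of_card_ge (fun s hs => ?_) ?_).symm
  · rcases (mem_stabilizer_pair_iff hG hb hswap s).1 hs with h | h
    · exact hA h
    · have h1 : g⁻¹ * s ∈ MulAction.stabilizer G b := by
        rw [MulAction.mem_stabilizer_iff, mul_smul, h, inv_smul_eq_iff, hg]
      have := A.mul_mem hgA (hA h1)
      rwa [mul_inv_cancel_left] at this
  · rw [hcard, natCard_stabilizer_pair hG hb hswap]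

end PermutationGroups

/-! ### The quadratic subextension and its class group -/

section Galois

set_option linter.unusedSectionVars false

variable {B : Type} [DecidableEq B] [Finite B] {G : Subgroup (Equiv.Perm B)} {b b' : B}
  {k K L : Type*} [Field k] [Field K] [Field L] [Algebra k K] [Algebra K L] [Algebra k L]
  [IsScalarTower k K L]

/-- The elements of `Gal(L/k)` that fix a field between `k` and `K` pointwise. -/
def fixing (F : IntermediateField k K) : Subgroup Gal(L/k) :=
  (F.map (IsScalarTower.toAlgHom k K L)).fixingSubgroup

theorem mem_fixing_iff {F : IntermediateField k K} {σ : Gal(L/k)} :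
    σ ∈ fixing F ↔ ∀ x : F, σ (algebraMap F L x) = algebraMap F L x := by
  rw [fixing, IntermediateField.mem_fixingSubgroup_iff]
  constructor
  · exact fun h x => h _ ⟨x, x.2, rfl⟩
  · rintro h _ ⟨x, hx, rfl⟩
    exact h ⟨x, hx⟩

theorem finrank_mul_natCard_fixing [FiniteDimensional k L] [IsGalois k L]
    (F : IntermediateField k K) :
    Module.finrank k F * Nat.card (fixing (L := L) F) = Module.finrank k L := by
  rw [fixing, IsGalois.card_fixingSubgroup_eq_finrank]
  have h := Module.finrank_mul_finrank k (F.map (IsScalarTower.toAlgHom k K L)) L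
  rw [← h]
  congr 1
  exact (F.equivMap (IsScalarTower.toAlgHom k K L)).toLinearEquiv.finrank_eq

theorem natCard_fixing [FiniteDimensional k L] [IsGalois k L] (F : IntermediateField k K) :
    Nat.card (fixing (L := L) F) = Module.finrank F K * Nat.card (fixing (L := L) (⊤ : IntermediateField k K)) := by
  have h1 := finrank_mul_natCard_fixing (L := L) F
  have h2 := finrank_mul_natCard_fixing (L := L) (⊤ : IntermediateField k K)
  have : FiniteDimensional k K := FiniteDimensional.left k K L
  have h3 := Module.finrank_mul_finrank k F K
  rw [IntermediateField.finrank_top', ← h3, ← h1, mul_assoc] at h2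
  exact (Nat.eq_of_mul_eq_mul_left Module.finrank_pos h2).symm

theorem fixing_injective [FiniteDimensional k L] [IsGalois k L] :
    Function.Injective (fixing (L := L) : IntermediateField k K → Subgroup Gal(L/k)) := by
  intro F F' h
  have h1 := congrArg IntermediateField.fixedField h
  rw [fixing, fixing, IsGalois.fixedField_fixingSubgroup, IsGalois.fixedField_fixingSubgroup] at h1
  exact IntermediateField.map_injective _ h1

theorem exists_fixing_eq [FiniteDimensional k L] [IsGalois k L] {A : Subgroup Gal(L/k)}
    (hA : fixing (⊤ : IntermediateField k K) ≤ A) : ∃ F : IntermediateField k K, fixing F = A := by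
  refine ⟨(IntermediateField.fixedField A).comap (IsScalarTower.toAlgHom k K L), ?_⟩
  have : ((IntermediateField.fixedField A).comap (IsScalarTower.toAlgHom k K L)).map
      (IsScalarTower.toAlgHom k K L) = IntermediateField.fixedField A := by
    refine le_antisymm ?_ fun x hx => ?_
    · rintro _ ⟨x, hx, rfl⟩
      exact hx
    · have h1 := IntermediateField.fixedField_antitone hA hx
      rw [fixing, IsGalois.fixedField_fixingSubgroup] at h1
      obtain ⟨y, -, rfl⟩ := h1
      exact ⟨y, hx, rfl⟩
  rw [fixing, this, IntermediateField.fixingSubgroup_fixedField]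

variable [FiniteDimensional k L] [IsGalois k L] (iso : Gal(L/k) ≃* G)

theorem finrank_eq_two_iff (hG : IsPGroup 2 G) (hb : b ≠ b') (hswap : Equiv.swap b b' ∈ G)
    (hiso : fixing (⊤ : IntermediateField k K) = (MulAction.stabilizer G b).comap iso.toMonoidHom)
    (F : IntermediateField k K) : Module.finrank F K = 2 ↔
      fixing F = (MulAction.stabilizer G ({b, b'} : Set B)).comap iso.toMonoidHom := by
  have hcard : ∀ A : Subgroup G, Nat.card (A.comap iso.toMonoidHom) = Nat.card A := fun A =>
    Nat.card_congr (iso.toEquiv.subtypeEquiv fun _ => Iff.rfl)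
  have h1 := natCard_fixing (L := L) F
  rw [hiso, hcard] at h1
  have hpos : 0 < Nat.card (MulAction.stabilizer G b) := Nat.card_pos
  constructor
  · intro h
    rw [h] at h1
    have h2 : (fixing F).map iso.toMonoidHom = MulAction.stabilizer G ({b, b'} : Set B) := by
      refine eq_stabilizer_pair hG hb hswap (fun g hg => ?_) ?_
      · refine ⟨iso.symm g, ?_, iso.apply_symm_apply g⟩
        have h3 : iso.symm g ∈ fixing (⊤ : IntermediateField k K) := by
          rw [hiso, Subgroup.mem_comap]
          exact (iso.apply_symm_apply g).symm ▸ hg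
        exact mem_fixing_iff.2 fun x => mem_fixing_iff.1 h3 ⟨x, trivial⟩
      · rw [← h1]
        exact (Nat.card_congr ((fixing F).equivMapOfInjective _ iso.injective).toEquiv).symm
    rw [← h2, Subgroup.comap_map_eq_self_of_injective iso.injective]
  · intro h
    rw [h, hcard, natCard_stabilizer_pair hG hb hswap] at h1
    exact (Nat.eq_of_mul_eq_mul_right hpos h1).symm

theorem existsUnique_finrank_eq_two (hG : IsPGroup 2 G) (hb : b ≠ b') (hswap : Equiv.swap b b' ∈ G)
    (hiso : fixing (⊤ : IntermediateField k K) = (MulAction.stabilizer G b).comap iso.toMonoidHom) :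
    ∃! F : IntermediateField k K, Module.finrank F K = 2 := by
  have h := finrank_eq_two_iff iso hG hb hswap hiso
  obtain ⟨F, hF⟩ := exists_fixing_eq (K := K)
    (A := (MulAction.stabilizer G ({b, b'} : Set B)).comap iso.toMonoidHom)
    (hiso.trans_le (Subgroup.comap_mono (stabilizer_le_stabilizer_pair hG hb hswap)))
  exact ⟨F, (h F).2 hF, fun F' hF' => fixing_injective (((h F').1 hF').trans hF.symm)⟩

end Galois

end CohenMartinet

namespace CohenMartinet

section RelativeClassGroup

set_option linter.unusedSectionVars false

variable {B : Type} [DecidableEq B] [Finite B] {G : Subgroup (Equiv.Perm B)} {b b' : B}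
  {k K L : Type*} [Field k] [Field K] [Field L] [NumberField k] [NumberField K] [NumberField L]
  [Algebra k K] [Algebra K L] [Algebra k L] [IsScalarTower k K L] [IsGalois k L]
  (iso : Gal(L/k) ≃* G)

/-- The part of the torsion on which the elements outside of the kernel of a quadratic character act
by inversion lies in the kernel of the norm. -/
theorem mem_relClassGroup_of_galClass_eq_inv {ℓ : ℕ} (hℓ : ℓ.Coprime 2) {c : ClassGroup (𝓞 L)}
    (hc : c ^ ℓ = 1) {τ : Gal(L/k)} (hτ : galClass k L τ c = c⁻¹) : c ∈ relClassGroup k L := by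
  change classNorm k L c = 1
  refine eq_one_of_pow_eq_one_of_coprime hℓ (by rw [← map_pow, hc, map_one]) ?_
  have h := classNorm_galClass k L τ c
  rw [hτ, map_inv] at h
  rw [pow_two]
  nth_rewrite 1 [← h]
  exact inv_mul_cancel _

theorem relTorsion_eq_natCard_torsion (hG : IsPGroup 2 G) (hb : b ≠ b')
    (hswap : Equiv.swap b b' ∈ G)
    (hiso : fixing (⊤ : IntermediateField k K) = (MulAction.stabilizer G b).comap iso.toMonoidHom)
    (F : IntermediateField k K) (hF : Module.finrank F K = 2) {p : ℕ} [Fact p.Prime] (h2 : p ≠ 2) :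
    relTorsion F K p = Nat.card {x : relClassPart k L p // p • x = 0 ∧
      ∀ s : MulAction.stabilizer G ({b, b'} : Set B),
        iso.symm s.1 • x = (signChar hG hb hswap s : ℤ) • x} := by
  have : FiniteDimensional k L := Module.Finite.of_restrictScalars_finite ℚ k L
  have hfix := (finrank_eq_two_iff iso hG hb hswap hiso F).1 hF
  have hS : ∀ τ : Gal(L/k), iso τ ∈ MulAction.stabilizer G ({b, b'} : Set B) ↔
      ∀ x : F, τ (algebraMap F L x) = algebraMap F L x := fun τ => by
    rw [← mem_fixing_iff, hfix]
    rfl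
  have hH : ∀ τ : Gal(L/k), iso τ • b = b ↔ ∀ x : K, τ (algebraMap K L x) = algebraMap K L x :=
    fun τ => by
      have h1 : iso τ • b = b ↔ τ ∈ fixing (⊤ : IntermediateField k K) := by
        rw [hiso]
        rfl
      rw [h1, mem_fixing_iff]
      exact ⟨fun h x => h ⟨x, trivial⟩, fun h x => h x⟩
  have hp2 : p.Coprime 2 := (Nat.coprime_primes Fact.out Nat.prime_two).2 h2
  have hcop : p.Coprime (Module.finrank F L) := by
    have h1 : Nat.card (fixing (L := L) F) = Module.finrank F L := by
      have := finrank_mul_natCard_fixing (L := L) F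
      rw [← Module.finrank_mul_finrank k F L] at this
      exact Nat.eq_of_mul_eq_mul_left Module.finrank_pos this
    obtain ⟨n, hn⟩ := IsPGroup.iff_card.1 (hG.of_injective iso.toMonoidHom iso.injective)
    obtain ⟨j, -, hj⟩ := (Nat.dvd_prime_pow Nat.prime_two).1
      (hn ▸ Subgroup.card_subgroup_dvd_card (fixing (L := L) F))
    rw [← h1, hj]
    exact hp2.pow_right j
  have : IsGalois F L := IsGalois.tower_top_of_isGalois k F L
  rw [relTorsion_eq_card F K L hF hcop]
  have hcond : ∀ c : ClassGroup (𝓞 L), (∀ σ : Gal(L/F),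
      ((∀ x : K, σ (algebraMap K L x) = algebraMap K L x) → galClass F L σ c = c) ∧
      ((¬ ∀ x : K, σ (algebraMap K L x) = algebraMap K L x) → galClass F L σ c = c⁻¹)) ↔
      ∀ s : MulAction.stabilizer G ({b, b'} : Set B),
        galClass k L (iso.symm s.1) c = c ^ (signChar hG hb hswap s : ℤ) := by
    intro c
    constructor
    · rintro h s
      have hs := (hS (iso.symm s.1)).1 (by rw [iso.apply_symm_apply]; exact s.2)
      have hσ := h { iso.symm s.1 with commutes' := hs }
      have hgal : galClass F L { iso.symm s.1 with commutes' := hs } c =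
        galClass k L (iso.symm s.1) c := (galClass_eq_of_coe_eq k F L _ _ (fun _ => rfl) c).symm
      have hbs := hH (iso.symm s.1)
      rw [iso.apply_symm_apply] at hbs
      by_cases hx : s.1 • b = b
      · have h1 : signChar hG hb hswap s = 1 := if_pos hx
        rw [h1, Units.val_one, zpow_one, ← hgal]
        exact hσ.1 (hbs.1 hx)
      · have h1 : signChar hG hb hswap s = -1 := if_neg hx
        rw [h1, Units.val_neg, Units.val_one, zpow_neg, zpow_one, ← hgal]
        exact hσ.2 (fun h => hx (hbs.2 h))
    · intro h σ
      have hs : iso (σ.restrictScalars k) ∈ MulAction.stabilizer G ({b, b'} : Set B) :=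
        (hS _).2 fun x => σ.commutes x
      have h1 := h ⟨_, hs⟩
      rw [iso.symm_apply_apply] at h1
      have hgal : galClass F L σ c = galClass k L (σ.restrictScalars k) c :=
        (galClass_eq_of_coe_eq k F L _ _ (fun _ => rfl) c).symm
      have hbs := hH (σ.restrictScalars k)
      rw [hgal, h1]
      refine ⟨fun hx => ?_, fun hx => ?_⟩
      · have h2 : signChar hG hb hswap ⟨_, hs⟩ = 1 := if_pos (hbs.2 hx)
        rw [h2, Units.val_one, zpow_one]
      · have h2 : signChar hG hb hswap ⟨_, hs⟩ = -1 := if_neg fun h => hx (hbs.1 h)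
        rw [h2, Units.val_neg, Units.val_one, zpow_neg, zpow_one]
  have hker : ∀ c : ClassGroup (𝓞 L), c ^ p = 1 → (∀ s : MulAction.stabilizer G ({b, b'} : Set B),
      galClass k L (iso.symm s.1) c = c ^ (signChar hG hb hswap s : ℤ)) →
      Additive.ofMul c ∈ relClassPart k L p := by
    intro c hc h
    refine ⟨?_, 1, ?_⟩
    · have ht := isSeparating_swap hG hb hswap
      have h1 := h ⟨_, ht.mem⟩
      rw [ht.sign, Units.val_neg, Units.val_one, zpow_neg, zpow_one] at h1
      exact mem_relClassGroup_of_galClass_eq_inv hp2 hc h1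
    · rw [pow_one]
      exact hc
  refine Nat.card_congr
    { toFun := fun c => ⟨⟨Additive.ofMul c.1, hker c.1 c.2.1 ((hcond c.1).1 c.2.2)⟩,
        Subtype.ext c.2.1, fun s => Subtype.ext ((hcond c.1).1 c.2.2 s)⟩
      invFun := fun x => ⟨x.1.1.toMul, congrArg Subtype.val x.2.1, (hcond _).2 fun s =>
        congrArg Subtype.val (x.2.2 s)⟩
      left_inv := fun c => rfl
      right_inv := fun x => rfl }

end RelativeClassGroup

/-! ### Infinite places -/

section Places

set_option linter.unusedSectionVars false

open NumberField

variable {Γ : Type*} [Group Γ] {k M L : Type*} [Field k] [Field M] [Field L] [NumberField k]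
  [NumberField M] [NumberField L] [Algebra k M] [Algebra M L] [Algebra k L] [IsScalarTower k M L]
  [IsGalois k L] (iso : Gal(L/k) ≃* Γ)

/-- The action on the infinite places of a group that is identified with the Galois group. -/
abbrev placesAction : MulAction Γ (InfinitePlace L) :=
  MulAction.compHom _ iso.symm.toMonoidHom

theorem natCard_orbits_places {A : Subgroup Γ}
    (hA : ∀ τ : Gal(L/k), iso τ ∈ A ↔ ∀ x : M, τ (algebraMap M L x) = algebraMap M L x) :
    letI := placesAction iso
    Nat.card (MulAction.orbitRel.Quotient A (InfinitePlace L)) =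
      Fintype.card (InfinitePlace M) := by
  let := placesAction iso
  have : IsGalois M L := IsGalois.tower_top_of_isGalois k M L
  rw [← Nat.card_eq_fintype_card, ← Nat.card_congr (InfinitePlace.orbitRelEquiv (k := M) (K := L))]
  refine Nat.card_congr (Quotient.congrRight fun v w => ?_)
  change v ∈ MulAction.orbit A w ↔ v ∈ MulAction.orbit Gal(L/M) w
  constructor
  · rintro ⟨a, rfl⟩
    have ha := (hA (iso.symm a.1)).1 (by rw [iso.apply_symm_apply]; exact a.2)
    exact ⟨{ iso.symm a.1 with commutes' := ha }, rfl⟩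
  · rintro ⟨σ, rfl⟩
    refine ⟨⟨iso (σ.restrictScalars k), (hA _).2 fun x => σ.commutes x⟩, ?_⟩
    change iso.symm (iso (σ.restrictScalars k)) • w = _
    rw [iso.symm_apply_apply]
    rfl

end Places

end CohenMartinet

namespace CohenMartinet

open NumberField

namespace GExt

set_option linter.unusedSectionVars false

variable {k : Type u} [Field k] [NumberField k] {B : Type} {G : Subgroup (Equiv.Perm B)}

instance (E : GExt k G) : IsGalois k E.closure where

theorem fixing_top_eq (E : GExt k G) (b : B) :
    let := (E.emb b).toRingHom.toAlgebra
    have : IsScalarTower k E.K E.closure := IsScalarTower.of_algebraMap_eq' (E.emb b).comp_algebraMap.symm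
    fixing (⊤ : IntermediateField k E.K) = (MulAction.stabilizer G b).comap E.iso.toMonoidHom := by
  intro _ _
  ext σ
  rw [mem_fixing_iff, Subgroup.mem_comap, MulAction.mem_stabilizer_iff]
  have h1 : E.iso.toMonoidHom σ • b = b ↔ σ.toAlgHom.comp (E.emb b) = E.emb b := by
    rw [← E.compat]
    exact E.emb.injective.eq_iff.symm
  rw [h1, AlgHom.ext_iff]
  exact ⟨fun h x => h ⟨x, trivial⟩, fun h x => h x⟩

variable [DecidableEq B] [Finite B] {b b' : B}

theorem existsUnique_quadratic (hG : IsPGroup 2 G) (hb : b ≠ b') (hswap : Equiv.swap b b' ∈ G)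
    (E : GExt k G) : ∃! F : IntermediateField k E.K, Module.finrank F E.K = 2 := by
  let := (E.emb b).toRingHom.toAlgebra
  have : IsScalarTower k E.K E.closure :=
    IsScalarTower.of_algebraMap_eq' (E.emb b).comp_algebraMap.symm
  exact existsUnique_finrank_eq_two E.iso hG hb hswap (E.fixing_top_eq b)

theorem finrank_quadSubfield (hG : IsPGroup 2 G) (hb : b ≠ b') (hswap : Equiv.swap b b' ∈ G)
    (E : GExt k G) : Module.finrank E.quadSubfield E.K = 2 := by
  obtain ⟨F, hF, hu⟩ := E.existsUnique_quadratic hG hb hswap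
  have : {F : IntermediateField k E.K | Module.finrank F E.K = 2} = {F} :=
    Set.eq_singleton_iff_unique_mem.2 ⟨hF, hu⟩
  rw [quadSubfield, this, sInf_singleton]
  exact hF

theorem h3_eq_signHoms (hG : IsPGroup 2 G) (hb : b ≠ b') (hswap : Equiv.swap b b' ∈ G)
    (E : GExt k G) : (E.h3 : ℝ) = signHoms G b b' (E.classModule 3) := by
  let := (E.emb b).toRingHom.toAlgebra
  have : IsScalarTower k E.K E.closure :=
    IsScalarTower.of_algebraMap_eq' (E.emb b).comp_algebraMap.symm
  have : Fact (Nat.Prime 3) := ⟨Nat.prime_three⟩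
  rw [signHoms_eq hG hb hswap, h3, relTorsion_eq_natCard_torsion E.iso hG hb hswap
    (E.fixing_top_eq b) E.quadSubfield (E.finrank_quadSubfield hG hb hswap) (by norm_num)]
  have hcop : (Nat.card (MulAction.stabilizer G ({b, b'} : Set B))).Coprime
      (Nat.card (E.classModule 3).carrier) := by
    obtain ⟨i, hi⟩ := IsPGroup.iff_card.1 (hG.to_subgroup (MulAction.stabilizer G ({b, b'} : Set B)))
    have h3 : ∀ x : Multiplicative (E.classModule 3).carrier, ∃ n : ℕ, x ^ 3 ^ n = 1 := by
      rintro ⟨c, -, n, hn⟩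
      exact ⟨n, Subtype.ext hn⟩
    obtain ⟨j, hj⟩ := IsPGroup.iff_card.1 (show IsPGroup 3 _ from h3)
    have hj' : Nat.card (E.classModule 3).carrier = 3 ^ j := hj
    rw [hi, hj']
    exact Nat.Coprime.pow i j (by norm_num)
  exact congrArg _ (card_isotypic_torsion (signChar hG hb hswap) hcop)

/-- The fixed points of the decomposition groups count the equivariant maps from the set of infinite
places of the Galois closure. -/
theorem fixedCard_decomposition (E : GExt k G) (V : FinGMod.{v} G) :
    letI := placesAction E.iso
    FinGMod.fixedCard E.decomposition V.carrier = Nat.card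
      {f : InfinitePlace E.closure → V.carrier // ∀ (g : G) (w), f (g • w) = g • f w} := by
  let := placesAction E.iso
  have hcomap : ∀ v, (E.placeAbove v).comap (algebraMap k E.closure) = v := fun v =>
    (InfinitePlace.comap_surjective (k := k) (K := E.closure) v).choose_spec
  rw [natCard_equivariant_maps E.placeAbove]
  · refine Finset.prod_congr rfl fun v _ => Nat.card_congr (Equiv.subtypeEquivRight fun x => ?_)
    have hD : ∀ g : G, g ∈ E.decomposition v ↔ g ∈ MulAction.stabilizer G (E.placeAbove v) := by
      intro g
      constructor
      · rintro ⟨σ, hσ, rfl⟩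
        change E.iso.symm (E.iso σ) • E.placeAbove v = E.placeAbove v
        rw [E.iso.symm_apply_apply]
        exact hσ
      · exact fun hg => ⟨E.iso.symm g, hg, E.iso.apply_symm_apply g⟩
    change (∀ g ∈ E.decomposition v, (MonoidAlgebra.single g (1 : ℤ)) • x = x) ↔ _
    simp only [hD, FinGMod.single_smul]
  · intro w
    obtain ⟨σ, hσ⟩ := InfinitePlace.exists_smul_eq_of_comap_eq (hcomap (w.comap (algebraMap k E.closure)))
    refine ⟨w.comap (algebraMap k E.closure), E.iso σ, ?_⟩
    change E.iso.symm (E.iso σ) • E.placeAbove (w.comap (algebraMap k E.closure)) = w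
    rw [E.iso.symm_apply_apply]
    exact hσ
  · intro v v' g h
    have h1 : E.placeAbove v' ∈ MulAction.orbit Gal(E.closure/k) (E.placeAbove v) :=
      ⟨E.iso.symm g, h⟩
    rw [InfinitePlace.mem_orbit_iff, hcomap, hcomap] at h1
    exact h1

theorem natCard_orbits_stabilizer (E : GExt k G) (b : B) :
    letI := placesAction E.iso
    Nat.card (MulAction.orbitRel.Quotient (MulAction.stabilizer G b) (InfinitePlace E.closure)) =
      Fintype.card (InfinitePlace E.K) := by
  let := (E.emb b).toRingHom.toAlgebra
  have : IsScalarTower k E.K E.closure :=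
    IsScalarTower.of_algebraMap_eq' (E.emb b).comp_algebraMap.symm
  refine natCard_orbits_places E.iso fun τ => ?_
  have h1 : E.iso τ ∈ MulAction.stabilizer G b ↔ τ ∈ fixing (⊤ : IntermediateField k E.K) := by
    rw [E.fixing_top_eq b]
    rfl
  rw [h1, mem_fixing_iff]
  exact ⟨fun h x => h ⟨x, trivial⟩, fun h x => h x⟩

theorem natCard_orbits_stabilizer_pair (hG : IsPGroup 2 G) (hb : b ≠ b')
    (hswap : Equiv.swap b b' ∈ G) (E : GExt k G) :
    letI := placesAction E.iso
    Nat.card (MulAction.orbitRel.Quotient (MulAction.stabilizer G ({b, b'} : Set B))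
      (InfinitePlace E.closure)) = Fintype.card (InfinitePlace E.quadSubfield) := by
  let := (E.emb b).toRingHom.toAlgebra
  have : IsScalarTower k E.K E.closure :=
    IsScalarTower.of_algebraMap_eq' (E.emb b).comp_algebraMap.symm
  refine natCard_orbits_places E.iso fun τ => ?_
  rw [← mem_fixing_iff, (finrank_eq_two_iff E.iso hG hb hswap (E.fixing_top_eq b)
    E.quadSubfield).1 (E.finrank_quadSubfield hG hb hswap)]
  rfl

/-- The relative unit rank is the difference of the numbers of infinite places. -/
theorem relUnitRank_eq (E : GExt k G) : E.relUnitRank =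
    (Fintype.card (InfinitePlace E.K) : ℤ) - Fintype.card (InfinitePlace E.quadSubfield) := by
  have h1 : 0 < Fintype.card (InfinitePlace E.K) := Fintype.card_pos
  have h2 : 0 < Fintype.card (InfinitePlace E.quadSubfield) := Fintype.card_pos
  rw [relUnitRank, Units.rank, Units.rank]
  omega

theorem fixedCard_induced (hG : IsPGroup 2 G) (hb : b ≠ b') (hswap : Equiv.swap b b' ∈ G)
    (E : GExt k G) : (FinGMod.fixedCard E.decomposition
      (FinGMod.induced (signChar hG hb hswap) 3).carrier : ℝ) = (3 : ℝ) ^ E.relUnitRank := by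
  let := placesAction E.iso
  have : Fact (Nat.Prime 3) := ⟨Nat.prime_three⟩
  have ht := isSeparating_swap hG hb hswap
  have h := natCard_character_functions (Ω := InfinitePlace E.closure) (p := 3) (by norm_num)
    (signChar hG hb hswap) (mem_stabilizer_iff_signChar hG hb hswap) ht.mem ht.sign
  rw [natCard_orbits_stabilizer, natCard_orbits_stabilizer_pair hG hb hswap,
    ← Nat.card_congr (FinGMod.frobenius (signChar hG hb hswap) 3 (InfinitePlace E.closure))] at h
  have h2 := E.fixedCard_decomposition (FinGMod.induced (signChar hG hb hswap) 3)
  rw [relUnitRank_eq, zpow_sub₀ (by norm_num), eq_div_iff (by positivity), zpow_natCast,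
    zpow_natCast, h2]
  exact_mod_cast h

theorem weight_eq (E : GExt k G) (c : FinGMod.IsoClass.{u} G) :
    E.weight (Quotient.out c) = FinGMod.classWeight E.decomposition c := by
  rw [weight, FinGMod.classWeight, FinGMod.fixedCard, Nat.card_congr (FinGMod.isoEquiv _ _),
    div_div, Nat.cast_prod]
  congr 2
  refine Finset.prod_congr rfl fun v _ => congrArg _ (Nat.card_congr
    (Equiv.subtypeEquivRight fun x => ?_))
  change _ ↔ ∀ g ∈ E.decomposition v, (MonoidAlgebra.single g (1 : ℤ)) • x = x
  simp only [FinGMod.single_smul]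

theorem hasPrediction_signHoms (hG : IsPGroup 2 G) (hb : b ≠ b') (hswap : Equiv.swap b b' ∈ G)
    (E : GExt k G) :
    E.HasPrediction 3 (signHoms G b b') (1 + (3 : ℝ) ^ (-E.relUnitRank)) := by
  have : Fact (Nat.Prime 3) := ⟨Nat.prime_three⟩
  have h := (isSeparating_swap hG hb hswap).tendsto_average.{u} (p := 3) (coprime_three_natCard hG)
    (by norm_num) E.decomposition
  rw [fixedCard_induced, one_div, ← zpow_neg] at h
  refine h.congr fun n => ?_
  have hsum : ∀ f : FinGMod.IsoClass.{u} G → ℝ, ∑ᶠ c ∈ FinGMod.classesUpTo.{u} G 3 n, f c =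
      ∑ c ∈ FinGMod.classes.{u} G 3 n, f c := fun f =>
    finsum_mem_eq_finite_toFinset_sum f (FinGMod.finite_classesUpTo 3 n)
  rw [hsum, hsum]
  simp only [weight_eq, signHoms_eq hG hb hswap]

end GExt

end CohenMartinet

namespace CohenMartinet

open NumberField

/-! ### Permutation representations -/

section PermutationRepresentations

variable {Γ X Y : Type*} [Group Γ] [MulAction Γ X] [MulAction Γ Y]

theorem ofMulAction_coeff (g : Γ) (x : MonoidAlgebra ℚ X) (w : X) :
    (Representation.ofMulAction ℚ Γ X g x).coeff w = x.coeff (g⁻¹ • w) := by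
  change Finsupp.mapDomain (g • ·) x.coeff w = _
  nth_rewrite 1 [← smul_inv_smul g w]
  exact Finsupp.mapDomain_apply (MulAction.injective g) _ _

/-- The elements of a representation that are invariant under a subgroup. -/
def invariantsOf {V : Type*} [AddCommGroup V] [Module ℚ V] (ρ : Representation ℚ Γ V)
    (A : Subgroup Γ) : Submodule ℚ V where
  carrier := {x | ∀ a ∈ A, ρ a x = x}
  zero_mem' a _ := map_zero _
  add_mem' {x y} hx hy a ha := by rw [map_add, hx a ha, hy a ha]
  smul_mem' c {x} hx a ha := by rw [map_smul, hx a ha]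

theorem finrank_invariantsOf_congr {V W : Type*} [AddCommGroup V] [Module ℚ V] [AddCommGroup W]
    [Module ℚ W] {ρ : Representation ℚ Γ V} {σ : Representation ℚ Γ W} (e : ρ.Equiv σ)
    (A : Subgroup Γ) :
    Module.finrank ℚ (invariantsOf ρ A) = Module.finrank ℚ (invariantsOf σ A) := by
  have he : ∀ g x, e.toLinearEquiv (ρ g x) = σ g (e.toLinearEquiv x) := fun g x =>
    LinearMap.congr_fun (e.isIntertwining' g) x
  have h : (invariantsOf ρ A).map (e.toLinearEquiv : V →ₗ[ℚ] W) = invariantsOf σ A := by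
    ext y
    constructor
    · rintro ⟨x, hx, rfl⟩ a ha
      change σ a (e.toLinearEquiv x) = e.toLinearEquiv x
      rw [← he, hx a ha]
    · intro hy
      refine ⟨e.toLinearEquiv.symm y, fun a ha => e.toLinearEquiv.injective ?_,
        e.toLinearEquiv.apply_symm_apply y⟩
      rw [he, e.toLinearEquiv.apply_symm_apply, hy a ha]
  rw [← h]
  exact (e.toLinearEquiv.submoduleMap _).finrank_eq

/-- The invariants of a permutation representation are the functions on the orbits. -/
theorem finrank_invariantsOf_ofMulAction [Finite X] (A : Subgroup Γ) :
    Module.finrank ℚ (invariantsOf (Representation.ofMulAction ℚ Γ X) A) =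
      Nat.card (MulAction.orbitRel.Quotient A X) := by
  have hcoeff : ∀ x ∈ invariantsOf (Representation.ofMulAction ℚ Γ X) A, ∀ a ∈ A, ∀ w,
      x.coeff (a • w) = x.coeff w := fun x hx a ha w => by
    conv_lhs => rw [← hx a ha, ofMulAction_coeff, inv_smul_smul]
  let f : invariantsOf (Representation.ofMulAction ℚ Γ X) A ≃ₗ[ℚ]
      (MulAction.orbitRel.Quotient A X → ℚ) :=
    { toFun := fun x q => Quotient.liftOn q (fun w => x.1.coeff w) (by
        rintro _ w ⟨a, rfl⟩
        exact hcoeff x.1 x.2 a a.2 w)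
      map_add' := fun x y => funext fun q => by
        induction q using Quotient.inductionOn
        rfl
      map_smul' := fun c x => funext fun q => by
        induction q using Quotient.inductionOn
        rfl
      invFun := fun f => ⟨(MonoidAlgebra.coeffLinearEquiv ℚ).symm
          (Finsupp.equivFunOnFinite.symm fun w => f (Quotient.mk _ w)), fun a ha => by
        refine MonoidAlgebra.ext (Finsupp.ext fun w => ?_)
        rw [ofMulAction_coeff]
        exact congrArg f (Quotient.sound ⟨⟨a⁻¹, A.inv_mem ha⟩, rfl⟩)⟩
      left_inv := fun x => Subtype.ext (MonoidAlgebra.ext (Finsupp.ext fun w => rfl))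
      right_inv := fun f => funext fun q => by
        induction q using Quotient.inductionOn
        rfl }
  have := Fintype.ofFinite (MulAction.orbitRel.Quotient A X)
  rw [f.finrank_eq, Module.finrank_fintype_fun_eq_card, Nat.card_eq_fintype_card]

/-- Isomorphic permutation representations have the same numbers of orbits for all subgroups. -/
theorem natCard_orbits_congr [Finite X] [Finite Y]
    (e : (Representation.ofMulAction ℚ Γ X).Equiv (Representation.ofMulAction ℚ Γ Y))
    (A : Subgroup Γ) : Nat.card (MulAction.orbitRel.Quotient A X) =
      Nat.card (MulAction.orbitRel.Quotient A Y) := by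
  rw [← finrank_invariantsOf_ofMulAction, ← finrank_invariantsOf_ofMulAction,
    finrank_invariantsOf_congr e]

/-- The action of a group on a set, transported along an embedding of the set. -/
def actionGraph (Γ : Type*) {X N : Type*} [Group Γ] [MulAction Γ X] (e : X ↪ N) :
    Set (Γ × N × N) :=
  {t | ∃ w, t.2.1 = e w ∧ t.2.2 = e (t.1 • w)}

theorem exists_equiv_of_actionGraph_eq {N : Type*} {e : X ↪ N} {e' : Y ↪ N}
    (h : actionGraph Γ e = actionGraph Γ e') :
    ∃ f : X ≃ Y, ∀ (g : Γ) (x : X), f (g • x) = g • f x := by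
  have key : ∀ x, ∃ y, e x = e' y := fun x => by
    have : ((1 : Γ), e x, e x) ∈ actionGraph Γ e := ⟨x, rfl, by rw [one_smul]⟩
    rw [h] at this
    exact ⟨_, this.choose_spec.1⟩
  have key' : ∀ y, ∃ x, e' y = e x := fun y => by
    have : ((1 : Γ), e' y, e' y) ∈ actionGraph Γ e' := ⟨y, rfl, by rw [one_smul]⟩
    rw [← h] at this
    exact ⟨_, this.choose_spec.1⟩
  choose f hf using key
  choose f' hf' using key'
  refine ⟨⟨f, f', fun x => e.injective (by rw [← hf', ← hf]),
    fun y => e'.injective (by rw [← hf, ← hf'])⟩, fun g x => ?_⟩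
  have : (g, e x, e (g • x)) ∈ actionGraph Γ e := ⟨x, rfl, rfl⟩
  rw [h] at this
  obtain ⟨y, h1, h2⟩ := this
  have h3 : y = f x := e'.injective (h1.symm.trans (hf x))
  have h2 : e (g • x) = e' (g • y) := h2
  have h4 : e' (f (g • x)) = e' (g • f x) := by rw [← h3, ← h2, hf]
  exact e'.injective h4

/-- Isomorphic sets with an action have isomorphic permutation representations. -/
theorem nonempty_equiv_ofMulAction (f : X ≃ Y) (hf : ∀ (g : Γ) (x : X), f (g • x) = g • f x) :
    Nonempty ((Representation.ofMulAction ℚ Γ X).Equiv (Representation.ofMulAction ℚ Γ Y)) := by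
  refine ⟨.mk (MonoidAlgebra.mapDomainLinearEquiv ℚ ℚ f) fun g => LinearMap.ext fun x =>
    MonoidAlgebra.ext (Finsupp.ext fun y => ?_)⟩
  change (Representation.ofMulAction ℚ Γ X g x).coeff (f.symm y) =
    (Representation.ofMulAction ℚ Γ Y g _).coeff y
  rw [ofMulAction_coeff, ofMulAction_coeff]
  change _ = x.coeff (f.symm (g⁻¹ • y))
  congr 1
  rw [Equiv.eq_symm_apply, hf, f.apply_symm_apply]

end PermutationRepresentations

namespace GExt

set_option linter.unusedSectionVars false

variable {k : Type u} [Field k] [NumberField k] {B : Type} [Finite B]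
  {G : Subgroup (Equiv.Perm B)}

theorem mem_sameSignature_self (E : GExt k G) : E ∈ E.sameSignature :=
  ⟨Representation.Equiv.refl _⟩

theorem mem_sameSignature_of_equiv {E E' : GExt k G} :
    letI := placesAction E.iso
    letI := placesAction E'.iso
    ∀ f : InfinitePlace E.closure ≃ InfinitePlace E'.closure,
      (∀ (g : G) w, f (g • w) = g • f w) → E' ∈ E.sameSignature := by
  let := placesAction E.iso
  let := placesAction E'.iso
  intro f hf
  obtain ⟨e⟩ := nonempty_equiv_ofMulAction f hf
  exact ⟨e⟩

theorem sameSignature_eq_of_mem {E E' : GExt k G} (h : E' ∈ E.sameSignature) :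
    E'.sameSignature = E.sameSignature := by
  obtain ⟨e⟩ := h
  ext E''
  exact ⟨fun ⟨f⟩ => ⟨e.trans f⟩, fun ⟨f⟩ => ⟨e.symm.trans f⟩⟩

variable [DecidableEq B] {b b' : B}

/-- The relative unit rank is determined by the enriched signature. -/
theorem sameSignature_subset_unitRankFamily (hG : IsPGroup 2 G) (hb : b ≠ b')
    (hswap : Equiv.swap b b' ∈ G) {n : ℤ} {E : GExt k G} (hE : E ∈ unitRankFamily k G n) :
    E.sameSignature ⊆ unitRankFamily k G n := by
  rintro E' ⟨e⟩
  let := placesAction E.iso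
  let := placesAction E'.iso
  have h := natCard_orbits_congr (X := InfinitePlace E.closure) (Y := InfinitePlace E'.closure)
    (Γ := G) e
  have h1 := h (MulAction.stabilizer G b)
  have h2 := h (MulAction.stabilizer G ({b, b'} : Set B))
  rw [natCard_orbits_stabilizer, natCard_orbits_stabilizer] at h1
  rw [natCard_orbits_stabilizer_pair hG hb hswap, natCard_orbits_stabilizer_pair hG hb hswap] at h2
  have hE : E.relUnitRank = n := hE
  change E'.relUnitRank = n
  rw [relUnitRank_eq] at hE ⊢
  rw [← h1, ← h2, hE]

theorem card_places_le (E : GExt k G) :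
    Fintype.card (InfinitePlace E.closure) ≤ Nat.card G * Module.finrank ℚ k := by
  have h1 : Fintype.card (InfinitePlace E.closure) ≤ Fintype.card (E.closure →+* ℂ) :=
    Fintype.card_le_of_surjective InfinitePlace.mk fun w => ⟨w.embedding, w.mk_embedding⟩
  rwa [Embeddings.card, ← Module.finrank_mul_finrank ℚ k E.closure,
    ← IsGalois.card_aut_eq_finrank k E.closure, Nat.card_congr E.iso.toEquiv, mul_comm] at h1

/-- There are only finitely many enriched signatures. -/
theorem finite_range_sameSignature :
    (Set.range (sameSignature : GExt k G → Set (GExt k G))).Finite := by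
  have hemb : ∀ E : GExt k G,
      Nonempty (InfinitePlace E.closure ↪ Fin (Nat.card G * Module.finrank ℚ k)) := fun E =>
    Function.Embedding.nonempty_of_card_le (by rw [Fintype.card_fin]; exact E.card_places_le)
  let t : GExt k G → Set (G × Fin (Nat.card G * Module.finrank ℚ k) ×
      Fin (Nat.card G * Module.finrank ℚ k)) := fun E =>
    letI := placesAction E.iso
    actionGraph G (hemb E).some
  have ht : ∀ E E' : GExt k G, t E = t E' → E.sameSignature = E'.sameSignature := by
    intro E E' h
    let := placesAction E.iso
    let := placesAction E'.iso
    obtain ⟨f, hf⟩ := exists_equiv_of_actionGraph_eq (Γ := G) (e := (hemb E).some)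
      (e' := (hemb E').some) h
    exact (sameSignature_eq_of_mem (mem_sameSignature_of_equiv f hf)).symm
  have : Finite (Set.range (sameSignature : GExt k G → Set (GExt k G))) := Finite.of_injective (fun S : Set.range (sameSignature : GExt k G → Set (GExt k G)) =>
    t S.2.choose) fun S S' h => Subtype.ext (by
      rw [← S.2.choose_spec, ← S'.2.choose_spec]
      exact ht _ _ h)
  exact Set.toFinite _

theorem finite_setOf_K_eq (K : IntermediateField k (AlgebraicClosure k)) :
    {E : GExt k G | E.K = K}.Finite := by
  by_cases hfin : FiniteDimensional k K
  · let L := IntermediateField.normalClosure k K (AlgebraicClosure k)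
    have hiso : Finite (Gal(L/k) ≃* G) :=
      Finite.of_injective (fun e => (e : Gal(L/k) → G)) DFunLike.coe_injective
    refine (Set.finite_range fun x : {x : (B ≃ (K →ₐ[k] L)) × (Gal(L/k) ≃* G) //
      ∀ (σ : Gal(L/k)) (b : B), x.1 ((x.2 σ : Equiv.Perm B) b) = σ.toAlgHom.comp (x.1 b)} =>
      (⟨K, hfin, x.1.1, x.1.2, x.2⟩ : GExt k G)).subset ?_
    rintro E rfl
    exact ⟨⟨(E.emb, E.iso), E.compat⟩, rfl⟩
  · refine Set.finite_empty.subset ?_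
    rintro E rfl
    exact hfin E.finite

/-- Hermite's theorem for extensions with a given permutation Galois group. -/
theorem finite_absDisc_le (X : ℝ) : {E : GExt k G | (E.absDisc : ℝ) ≤ X}.Finite := by
  have h := NumberField.finite_of_discr_bdd (AlgebraicClosure k) ⌊X⌋₊
  let res : GExt k G → {F : IntermediateField ℚ (AlgebraicClosure k) // FiniteDimensional ℚ F} :=
    fun E => ⟨E.K.restrictScalars ℚ, (inferInstance : FiniteDimensional ℚ E.K)⟩
  refine (h.preimage' (f := res) fun F _ => ?_).subset fun E hE => ?_
  · by_cases hF : ∃ E : GExt k G, res E = F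
    · obtain ⟨E, rfl⟩ := hF
      refine (finite_setOf_K_eq E.K).subset fun E' hE' => ?_
      exact IntermediateField.restrictScalars_injective ℚ (congrArg Subtype.val hE')
    · refine Set.finite_empty.subset fun E hE => hF ⟨E, hE⟩
  · have hE' : (E.absDisc : ℝ) ≤ X := hE
    have h1 : E.absDisc ≤ ⌊X⌋₊ := Nat.le_floor hE'
    change |discr E.K| ≤ (⌊X⌋₊ : ℤ)
    rw [Int.abs_eq_natAbs]
    exact_mod_cast h1

/-- The averages over a union of finitely many families. -/
theorem tendsto_average_of_sameSignature {S : Set (GExt k G)} (hS : S.Nonempty) {q : GExt k G → ℝ}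
    {a : ℝ} (hsub : ∀ E ∈ S, E.sameSignature ⊆ S)
    (h : ∀ E ∈ S, Tendsto (average E.sameSignature q) atTop (𝓝 a)) :
    Tendsto (average S q) atTop (𝓝 a) := by
  classical
  have hfin : ∀ (T : Set (GExt k G)) (X : ℝ), {E | E ∈ T ∧ (E.absDisc : ℝ) ≤ X}.Finite :=
    fun T X => (finite_absDisc_le X).subset fun E hE => hE.2
  have hdev : ∀ (T : Set (GExt k G)) (X : ℝ), ∑ E ∈ (hfin T X).toFinset, (q E - a) =
      (hfin T X).toFinset.card * (average T q X - a) := by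
    intro T X
    rw [average, finsum_mem_eq_finite_toFinset_sum _ (hfin T X), Set.ncard_eq_toFinset_card _ (hfin T X),
      Finset.sum_sub_distrib, Finset.sum_const, nsmul_eq_mul, mul_sub]
    congr 1
    rcases (hfin T X).toFinset.eq_empty_or_nonempty with h0 | h0
    · rw [h0, Finset.sum_empty, Finset.card_empty, Nat.cast_zero, zero_mul]
    · rw [mul_div_cancel₀ _ (Nat.cast_ne_zero.2 h0.card_pos.ne')]
  have hcls := (finite_range_sameSignature (k := k) (G := G)).subset (Set.image_subset_range _ S)
  obtain ⟨E₀, hE₀⟩ := hS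
  have hbound : ∀ X : ℝ, (E₀.absDisc : ℝ) ≤ X →
      |average S q X - a| ≤ ∑ T ∈ hcls.toFinset, |average T q X - a| := by
    intro X hX
    have hpos : (0 : ℝ) < (hfin S X).toFinset.card := Nat.cast_pos.2
      (Finset.card_pos.2 ⟨E₀, (hfin S X).mem_toFinset.2 ⟨hE₀, hX⟩⟩)
    refine le_of_mul_le_mul_left ?_ hpos
    rw [← abs_of_pos hpos, ← abs_mul, ← hdev, abs_of_pos hpos, Finset.mul_sum,
      ← Finset.sum_fiberwise_of_maps_to (t := hcls.toFinset) (g := sameSignature) fun E hE =>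
        hcls.mem_toFinset.2 ⟨E, ((hfin S X).mem_toFinset.1 hE).1, rfl⟩]
    refine (Finset.abs_sum_le_sum_abs _ _).trans (Finset.sum_le_sum fun T hT => ?_)
    obtain ⟨E, hE, rfl⟩ := hcls.mem_toFinset.1 hT
    have hfiber : (hfin S X).toFinset.filter (fun E' => E'.sameSignature = E.sameSignature) =
        (hfin E.sameSignature X).toFinset := by
      ext E'
      rw [Finset.mem_filter, Set.Finite.mem_toFinset, Set.Finite.mem_toFinset]
      exact ⟨fun h => ⟨h.2 ▸ E'.mem_sameSignature_self, h.1.2⟩,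
        fun h => ⟨⟨hsub E hE h.1, h.2⟩, sameSignature_eq_of_mem h.1⟩⟩
    rw [hfiber, hdev, abs_mul, Nat.abs_cast]
    refine mul_le_mul_of_nonneg_right (Nat.cast_le.2 (Finset.card_le_card fun E' hE' => ?_))
      (abs_nonneg _)
    rw [Set.Finite.mem_toFinset] at hE' ⊢
    exact ⟨hsub E hE hE'.1, hE'.2⟩
  have hlim : Tendsto (fun X => ∑ T ∈ hcls.toFinset, |average T q X - a|) atTop (𝓝 0) := by
    rw [← Finset.sum_const_zero (s := hcls.toFinset)]
    refine tendsto_finsetSum _ fun T hT => ?_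
    obtain ⟨E, hE, rfl⟩ := hcls.mem_toFinset.1 hT
    have := ((h E hE).sub_const a).abs
    rwa [sub_self, abs_zero] at this
  rw [tendsto_iff_norm_sub_tendsto_zero]
  refine squeeze_zero' (Eventually.of_forall fun X => norm_nonneg _) ?_ hlim
  filter_upwards [eventually_ge_atTop (E₀.absDisc : ℝ)] with X hX
  exact hbound X hX

end GExt

end CohenMartinet

theorem propositionP {k : Type u} [Field k] [NumberField k] (m : ℕ)
    (G : Subgroup (Equiv.Perm (Fin (2 ^ m)))) (hG : IsPGroup 2 G)
    (htrans : MulAction.IsPretransitive G (Fin (2 ^ m)))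
    (b b' : Fin (2 ^ m)) (hb : b ≠ b') (hswap : Equiv.swap b b' ∈ G)
    (u : ℤ) (hu : (CohenMartinet.unitRankFamily k G u).Nonempty) :
    (∀ E : CohenMartinet.GExt k G, ∃! F : IntermediateField k E.K, Module.finrank F E.K = 2) ∧
    (∀ E : CohenMartinet.GExt k G, (E.h3 : ℝ) = CohenMartinet.signHoms G b b' (E.classModule 3)) ∧
    (∀ E ∈ CohenMartinet.unitRankFamily k G u, E.HasPrediction 3 (CohenMartinet.signHoms G b b') (1 + (3 : ℝ) ^ (-u))) ∧
    ((∀ E ∈ CohenMartinet.unitRankFamily k G u, E.HeuristicHolds 3 (CohenMartinet.signHoms G b b')) →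
      Tendsto (CohenMartinet.GExt.average (CohenMartinet.unitRankFamily k G u) fun E => (E.h3 : ℝ)) atTop
        (𝓝 (1 + (3 : ℝ) ^ (-u)))) := by
  refine ⟨fun E => E.existsUnique_quadratic hG hb hswap, fun E => E.h3_eq_signHoms hG hb hswap,
    fun E hE => ?_, fun h => ?_⟩
  · have hE : E.relUnitRank = u := hE
    exact hE ▸ E.hasPrediction_signHoms hG hb hswap
  · refine CohenMartinet.GExt.tendsto_average_of_sameSignature hu
      (fun E hE => CohenMartinet.GExt.sameSignature_subset_unitRankFamily hG hb hswap hE)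
      fun E hE => ?_
    have hE' : E.relUnitRank = u := hE
    have h1 := h E hE _ (hE' ▸ E.hasPrediction_signHoms hG hb hswap)
    simpa only [CohenMartinet.GExt.h3_eq_signHoms hG hb hswap] using h1
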